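/- **LP-type problems.** Let $(\mathcal S,f)$ be an LP-type problem: $\mathcal S$ is a finite set of $n$ constraints, $R$ is a totally ordered set, and $f:2^{\mathcal S}\to R$ satisfies monotonicity ($f(X)\le f(Y)$ for $X\subseteq Y$) and locality (if $X\subseteq Y$ and $f(X)=f(Y)=f(X\cup\{e\})$, then $f(Y)=f(Y\cup\{e\})$). Suppose moreover that each constraint $X\in\mathcal S$ is associated with a set $S_X\subseteq R$ such that, for every $\mathcal A\subseteq\mathcal S$, $f(\mathcal A)$ is the least element of $\bigcap_{X\in\mathcal A}S_X$ (which is $R$ for $\mathcal A=\emptyset$). A *basis* of $\mathcal A\subseteq\mathcal S$ is a set $B\subseteq\mathcal A$ with $f(B)=f(\mathcal A)$ and $f(B')<f(B)$ for all $B'\subsetneq B$; a constraint $X$ *violates* $B$ if $f(B\cup\{X\})>f(B)$. Let * $\nu\ge 1$ be the combinatorial dimension, the maximum cardinality of a basis of a subset of $\mathcal S$; * $\lambda$ be the VC dimension of the range space with ground set $\mathcal S$ whose ranges are the sets $\{X\in\mathcal S: x\in S_X\}$, $x\in R$, i.e. the maximum cardinality of a set $T\subseteq\mathcal S$ such that every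 $U\subseteq T$ equals $\{X\in T : x\in S_X\}$ for some $x\in R$; * $\mathrm{bit}(\mathcal S)$ be such that the constraints are represented by distinct bit strings of length $\mathrm{bit}(\mathcal S)$. **Model.** $\mathcal S$ is arbitrarily partitioned into $\mathcal S_1,\dots,\mathcal S_k$ ($k\ge2$), and site $i$ receives $\mathcal S_i$, with $n_i=|\mathcal S_i|$. All parties know $n,k,r,\nu,\lambda$. In each round the coordinator sends a message to each site and each site then replies; all messages are charged by their length in bits. At the end the coordinator stops with an output. The coordinator and the sites run fixed programs on randomized random access machines with unit-cost instructions on words of any length $W\ge C\nu\log(nk)$ bits (this holds the integer weights that occur). Constraints are atomic. A procedure computes a basis of $m$ given constraints in time $T_b(m)$, and another finds, among $t$ given constraints, all those that violate a given set of $s$ constraints in time $T_v(t,s)$; these running times are nondecreasing in each argument and at least the input size, $T_b(m)\ge m$, $T_v(t,s)\ge t+s$. **Theorem.** There is an absolute constant $a$ such that for every integer $c\ge1$ there are a constant $C$ and a program for the coordinator and one for the sites (none of which depends on anything else) such that for every problem and partition as above and every integer $r$ with $1\le r\le\ln n$, with probability at least $1-1/n^{c}$ the coordinator outputs a basis $B$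 of $\mathcal S$, and so $f(\mathcal S)=f(B)$; and on every run the protocol stops, with * at most $C\nu r$ rounds, * at most $C(\ln n)^a\,(\lambda n^{1/r}\nu^2+k\nu^2)\cdot\mathrm{bit}(\mathcal S)$ bits of communication in total, * local computation time of the coordinator at most $C\,\nu r\,\bigl(T_b(M)+k\nu\bigr)$, where $M=\lfloor C(\ln n)^a\,\lambda n^{1/r}\nu\rfloor$, * local computation time of the $i$-th site at most $C\,\nu r\,T_v(n_i,\nu)$. -/

import Mathlib

universe u v

/-! ### LP-type problems -/

/-- An LP-type problem whose set of constraints is the whole (finite) type `E`, with values in the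
linear order `R`.  Every constraint `X` comes with the set `sat X` of the points of `R` that satisfy
it, and `f A` is the least point that satisfies all the constraints in `A`. -/
structure LPTypeProblem (E : Type u) (R : Type v) [DecidableEq E] [LinearOrder R] where
  f : Finset E → R
  mono : ∀ X Y : Finset E, X ⊆ Y → f X ≤ f Y
  locality : ∀ X Y : Finset E, X ⊆ Y → ∀ e : E,
    f X = f Y → f Y = f (insert e X) → f Y = f (insert e Y)
  sat : E → Set R
  isLeast_f : ∀ A : Finset E, IsLeast (⋂ X ∈ A, sat X) (f A)

namespace LPTypeProblem

variable {E : Type u} {R : Type v} [DecidableEq E] [LinearOrder R]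

/-- `B` is a basis of `A`: `B ⊆ A`, `f B = f A`, and every proper subset of `B` has a smaller
value. -/
def IsBasis (P : LPTypeProblem E R) (A B : Finset E) : Prop :=
  B ⊆ A ∧ P.f B = P.f A ∧ ∀ B' : Finset E, B' ⊂ B → P.f B' < P.f B

/-- The constraint `X` violates the set `B`. -/
def Violates (P : LPTypeProblem E R) (X : E) (B : Finset E) : Prop :=
  P.f B < P.f (insert X B)

open Classical in
/-- The combinatorial dimension: the largest cardinality of a basis (of some set of
constraints). -/
noncomputable def combDim [Fintype E] (P : LPTypeProblem E R) : ℕ :=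
  ((Finset.univ : Finset (Finset E)).filter (fun B => ∃ A, P.IsBasis A B)).sup Finset.card

/-- A set `T` of constraints is shattered by the points of `R`: every subset of `T` is the set of
those members of `T` that some point of `R` satisfies. -/
def Shattered (P : LPTypeProblem E R) (T : Finset E) : Prop :=
  ∀ U : Finset E, U ⊆ T → ∃ x : R, ∀ X ∈ T, x ∈ P.sat X ↔ X ∈ U

open Classical in
/-- The VC dimension of the range space with ground set `E` (the constraints), whose ranges are
the sets of constraints satisfied by a point of `R`.  Passing to the complementary ranges, the sets
of constraints that a point fails, does not change it. -/
noncomputable def vcDim [Fintype E] (P : LPTypeProblem E R) : ℕ :=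
  ((Finset.univ : Finset (Finset E)).filter P.Shattered).sup Finset.card

end LPTypeProblem

/-! ### Messages and their lengths in bits -/

/-- A message is a list of items; an item is a natural number or a constraint. -/
inductive Item (E : Type u) where
  | num (x : ℕ) : Item E
  | con (X : E) : Item E

abbrev Msg (E : Type u) := List (Item E)

/-- A self-delimiting binary code of the natural numbers. -/
def natCode (x : ℕ) : List Bool :=
  (Nat.bits x).flatMap (fun d => [true, d]) ++ [false]

/-- Every item starts with a bit that announces it and a bit that tells its kind; a constraint is
written with the `b` bits of its code `enc X`. -/
def itemCode {E : Type u} {b : ℕ} (enc : E → Fin b → Bool) : Item E → List Bool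
  | .num x => true :: false :: natCode x
  | .con X => true :: true :: List.ofFn (enc X)

/-- The items one after the other, followed by an end marker. -/
def msgCode {E : Type u} {b : ℕ} (enc : E → Fin b → Bool) (s : Msg E) : List Bool :=
  s.flatMap (itemCode enc) ++ [false]

/-- The number of bits of a message. -/
def msgBits {E : Type u} {b : ℕ} (enc : E → Fin b → Bool) (s : Msg E) : ℕ :=
  (msgCode enc s).length

/-! ### Local computation: a randomized random access machine with bounded loops -/

inductive ArithOp where
  | add | sub | mul | div

def ArithOp.apply : ArithOp → ℕ → ℕ → ℕ
  | .add, x, y => x + y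
  | .sub, x, y => x - y
  | .mul, x, y => x * y
  | .div, x, y => x / y

/-- Programs.  The arguments `x y z ...` of the instructions are numbers of registers.  There
are number registers, a random access memory for numbers, and a random access memory whose cells
hold constraints; constraints are atomic, and nothing about them can be computed except through the
instructions `basis` and `viol`. -/
inductive Prog where
  /-- `x := v` for a literal `v` -/
  | const (x v : ℕ)
  /-- `x := y op z` -/
  | arith (op : ArithOp) (x y z : ℕ)
  /-- `x :=` the number of binary digits of `y` -/
  | size (x y : ℕ)
  /-- `x :=` a uniformly random element of `{0, ..., y}` -/
  | rand (x y : ℕ)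
  /-- `x := mem[y]` -/
  | load (x y : ℕ)
  /-- `mem[x] := y` -/
  | store (x y : ℕ)
  /-- `cmem[x] := cmem[y]` -/
  | moveCon (x y : ℕ)
  /-- `x :=` the number of unread items of the message that came in on channel `y` -/
  | recvLen (x y : ℕ)
  /-- read the next item on channel `y`; if it is a number, put it into `x` -/
  | recvNum (x y : ℕ)
  /-- read the next item on channel `y`; if it is a constraint, put it into `cmem[x]` -/
  | recvCon (x y : ℕ)
  /-- append the number `x` to the message that goes out on channel `y` -/
  | sendNum (x y : ℕ)
  /-- append the constraint `cmem[x]` to the message that goes out on channel `y` -/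
  | sendCon (x y : ℕ)
  /-- compute a basis of the constraints `cmem[src], ..., cmem[src + len - 1]`, write it to
  `cmem[dst], cmem[dst + 1], ...` and its size to `x` -/
  | basis (src len dst x : ℕ)
  /-- for `i < tlen`, set `mem[dst + i]` to `1` if the constraint `cmem[tsrc + i]` violates the
  set `cmem[bsrc], ..., cmem[bsrc + blen - 1]`, and to `0` if it does not -/
  | viol (tsrc tlen bsrc blen dst : ℕ)
  /-- stop the protocol with the output `cmem[src], ..., cmem[src + len - 1]` -/
  | output (src len : ℕ)
  | skip
  | seq (p q : Prog)
  /-- if `x < y` then `p` else `q` -/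
  | ifLt (x y : ℕ) (p q : Prog)
  /-- execute `p` as many times as the value of `x` on entry says -/
  | loop (x : ℕ) (p : Prog)

/-- The state of one party, with the time that it has spent so far. -/
structure PState (E : Type u) where
  reg : ℕ → ℕ
  mem : ℕ → ℕ
  cmem : ℕ → Option E
  inbox : ℕ → Msg E
  outbox : ℕ → Msg E
  out : Option (List E)
  time : ℕ

/-- What programs are executed in: the word length, the problem, the procedure for computing
bases, and the running times of the two basic procedures. -/
structure Env (E : Type u) (R : Type v) [DecidableEq E] [LinearOrder R] where
  wordLen : ℕ
  prob : LPTypeProblem E R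
  basisOf : List E → List E
  Tb : ℕ → ℕ
  Tv : ℕ → ℕ → ℕ

namespace PState

variable {E : Type u}

def tick (s : PState E) (t : ℕ) : PState E := { s with time := s.time + t }

/-- Put the value `v` into register `x`; only its `W` last binary digits are kept. -/
def setReg (W : ℕ) (s : PState E) (x v : ℕ) : PState E :=
  { s with reg := Function.update s.reg x (v % 2 ^ W) }

/-- Append an item to the message that goes out on channel `y`. -/
def post (s : PState E) (y : ℕ) (z : Item E) : PState E :=
  { s with outbox := Function.update s.outbox y (s.outbox y ++ [z]) }

/-- The constraints in the cells `a, ..., a + l - 1`. -/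
def block (s : PState E) (a l : ℕ) : List E :=
  (List.range l).filterMap (fun i => s.cmem (a + i))

/-- Write a list of constraints to the cells from `a` on. -/
def writeBlock (s : PState E) (a : ℕ) (L : List E) : PState E :=
  { s with cmem := fun j => if a ≤ j ∧ j < a + L.length then L[j - a]? else s.cmem j }

end PState

/-- Repeat a randomized state change. -/
noncomputable def iterPMF {σ : Type u} (g : σ → PMF σ) : ℕ → σ → PMF σ
  | 0, s => PMF.pure s
  | m + 1, s => (g s).bind (iterPMF g m)

open Classical in
/-- The effect of the instruction `viol`. -/
noncomputable def violFlags {E : Type u} {R : Type v} [DecidableEq E] [LinearOrder R]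
    (P : LPTypeProblem E R) (s : PState E) (tsrc tlen bsrc blen dst : ℕ) : PState E :=
  { s with mem := fun j =>
      if dst ≤ j ∧ j < dst + tlen then
        (if ∃ X, s.cmem (tsrc + (j - dst)) = some X ∧ P.Violates X (s.block bsrc blen).toFinset
          then 1 else 0)
      else s.mem j }

/-- The (randomized) execution of a program.  Every instruction takes one unit of time, every turn
of a loop takes one unit in addition to its body, a basis of `m` constraints takes time `Tb m`, the
violation test of `t` constraints against `b` constraints takes time `Tv t b`, and an output takes
time proportional to its length. -/
noncomputable def exec {E : Type u} {R : Type v} [DecidableEq E] [LinearOrder R]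
    (env : Env E R) : Prog → PState E → PMF (PState E)
  | .const x v, s => PMF.pure ((s.setReg env.wordLen x v).tick 1)
  | .arith op x y z, s =>
      PMF.pure ((s.setReg env.wordLen x (op.apply (s.reg y) (s.reg z))).tick 1)
  | .size x y, s => PMF.pure ((s.setReg env.wordLen x (Nat.size (s.reg y))).tick 1)
  | .rand x y, s =>
      (PMF.uniformOfFinset (Finset.range (s.reg y + 1)) ⟨0, by simp⟩).bind
        (fun v => PMF.pure ((s.setReg env.wordLen x v).tick 1))
  | .load x y, s => PMF.pure ((s.setReg env.wordLen x (s.mem (s.reg y))).tick 1)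
  | .store x y, s =>
      PMF.pure ({ s with mem := Function.update s.mem (s.reg x) (s.reg y) }.tick 1)
  | .moveCon x y, s =>
      PMF.pure ({ s with cmem := Function.update s.cmem (s.reg x) (s.cmem (s.reg y)) }.tick 1)
  | .recvLen x y, s =>
      PMF.pure ((s.setReg env.wordLen x (s.inbox (s.reg y)).length).tick 1)
  | .recvNum x y, s =>
      let s' : PState E :=
        { s with inbox := Function.update s.inbox (s.reg y) (s.inbox (s.reg y)).tail }
      match (s.inbox (s.reg y)).head? with
      | some (.num v) => PMF.pure ((s'.setReg env.wordLen x v).tick 1)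
      | _ => PMF.pure (s'.tick 1)
  | .recvCon x y, s =>
      let s' : PState E :=
        { s with inbox := Function.update s.inbox (s.reg y) (s.inbox (s.reg y)).tail }
      match (s.inbox (s.reg y)).head? with
      | some (.con X) =>
          PMF.pure ({ s' with cmem := Function.update s.cmem (s.reg x) (some X) }.tick 1)
      | _ => PMF.pure (s'.tick 1)
  | .sendNum x y, s =>
      PMF.pure ((s.post (s.reg y) (.num (s.reg x))).tick 1)
  | .sendCon x y, s =>
      match s.cmem (s.reg x) with
      | some X => PMF.pure ((s.post (s.reg y) (.con X)).tick 1)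
      | none => PMF.pure (s.tick 1)
  | .basis src len dst x, s =>
      let L := env.basisOf (s.block (s.reg src) (s.reg len))
      PMF.pure (((s.writeBlock (s.reg dst) L).setReg env.wordLen x L.length).tick
        (env.Tb (s.reg len) + 1))
  | .viol tsrc tlen bsrc blen dst, s =>
      PMF.pure ((violFlags env.prob s (s.reg tsrc) (s.reg tlen) (s.reg bsrc) (s.reg blen)
        (s.reg dst)).tick (env.Tv (s.reg tlen) (s.reg blen) + 1))
  | .output src len, s =>
      PMF.pure ({ s with out := some (s.block (s.reg src) (s.reg len)) }.tick (s.reg len + 1))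
  | .skip, s => PMF.pure (s.tick 1)
  | .seq p q, s => (exec env p s).bind (exec env q)
  | .ifLt x y p q, s =>
      if s.reg x < s.reg y then exec env p (s.tick 1) else exec env q (s.tick 1)
  | .loop x p, s => iterPMF (fun s' => exec env p (s'.tick 1)) (s.reg x) (s.tick 1)

/-! ### The coordinator model -/

/-- A configuration of a protocol with `k` sites: the states of the coordinator and of the sites,
the number of bits communicated and the number of rounds so far. -/
structure Config (E : Type u) (k : ℕ) where
  coord : PState E
  site : Fin k → PState E
  bits : ℕ
  rounds : ℕ

/-- A protocol: the program that the coordinator executes at the beginning of every round, and the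
program that every site executes when it has received the coordinator's message. -/
structure Protocol where
  coordProg : Prog
  siteProg : Prog

section Coordinator

variable {E : Type u} {R : Type v} [DecidableEq E] [LinearOrder R]

/-- One after the other, the sites read the messages of the coordinator and execute their program,
each with its own randomness; the messages of the sites are left in their outboxes. -/
noncomputable def runSites (env : Env E R) (p : Prog) {k : ℕ} (sent : Fin k → Msg E) :
    List (Fin k) → (Fin k → PState E) → PMF (Fin k → PState E)
  | [], st => PMF.pure st
  | i :: is, st =>
      (exec env p { st i with
          inbox := fun j => if j = 0 then sent i else []
          outbox := fun _ => [] }).bind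
        (fun s => runSites env p sent is (Function.update st i s))

/-- One round: the coordinator computes and either stops, or sends a message to each site (to site
`i` on its channel `i`), whereupon each site computes and replies (on its channel `0`).  All
messages are charged with their lengths in bits. -/
noncomputable def roundStep (env : Env E R) (π : Protocol) {k b : ℕ} (enc : E → Fin b → Bool)
    (c : Config E k) : PMF (Config E k) :=
  if c.coord.out.isSome then PMF.pure c
  else
    (exec env π.coordProg c.coord).bind (fun a =>
      if a.out.isSome then PMF.pure { c with coord := a }
      else
        (runSites env π.siteProg (fun i : Fin k => a.outbox i) (List.finRange k) c.site).bind
          (fun st => PMF.pure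
            { coord := { a with
                inbox := fun j => if h : j < k then (st ⟨j, h⟩).outbox 0 else []
                outbox := fun _ => [] }
              site := st
              bits := c.bits +
                ∑ i : Fin k, (msgBits enc (a.outbox i) + msgBits enc ((st i).outbox 0))
              rounds := c.rounds + 1 }))

/-- The state of a party at the start: some numbers in the first registers, some constraints in the
first cells. -/
def startState (params : List ℕ) (input : List E) : PState E where
  reg := fun j => params.getD j 0
  mem := fun _ => 0
  cmem := fun j => input[j]?
  inbox := fun _ => []
  outbox := fun _ => []
  out := none
  time := 0

/-- At the start all parties know the numbers in `params`; site `i` also holds the constraints in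
`input i` and knows how many they are. -/
def startConfig {k : ℕ} (params : List ℕ) (input : Fin k → List E) : Config E k where
  coord := startState params []
  site := fun i => startState (params ++ [(input i).length]) (input i)
  bits := 0
  rounds := 0

/-- The distribution of the configuration after at most `t` rounds.  Once the coordinator has
stopped, nothing changes any more. -/
noncomputable def runProtocol (env : Env E R) (π : Protocol) {k b : ℕ} (enc : E → Fin b → Bool)
    (params : List ℕ) (input : Fin k → List E) (t : ℕ) : PMF (Config E k) :=
  iterPMF (roundStep env π enc) t (startConfig params input)

end Coordinator

/-! The protocol is Clarkson's reweighting method with independent sampling. Every constraint has a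
weight, initially 1, that only its own site knows. Write m for `multiplier n r`, roughly n^{1/r}, K
for `sampleScale`, and b_t for `totalBound n ν t`, which is n(1+1/ν)^t up to rounding. In iteration
t the coordinator distributes a basis B; the sites multiply the weights of the violators of B by m
(by 1 in iteration 0, where B is empty), keep each constraint X independently with probability
min(1, w(X)/(⌊b_t/K⌋+1)), and report how many violators and how many sampled constraints they have.
Unless the coordinator stops, the samples are sent in a second round and their basis is the next B.
The coordinator never learns the weights: it uses the deterministic b_t in place of the total
weight.

Call a sample good if it has at most 4K members and is a net: a point satisfying all sampled
constraints fails constraints of total weight at most b_t/(mν). As X violates B exactly when the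
point f(B) fails X (`violates_iff`), the violators of the basis of a net are light, and multiplying
them by m adds at most b_t/ν (`sum_reweight_le`), so b_{t+1} is again a bound. On the other hand, if
anything violates B, then so does a member of a fixed basis O of all constraints, and the product of
the weights over O grows by the factor m (`le_prod_reweight`). After νr good iterations with
violators that product would be at least m^{νr}, while each of its at most ν factors is at most
n·4^r < m^r (`totalBound_le`, `lt_multiplier_pow`, `false_of_heavy`). Hence on a good run some basis
has no violators by iteration νr, and such a basis is a basis of everything.

A sample is good except with exponentially small probability (`prob_sample_bad_le`). All that is
needed about the randomness is that the mean of a product of factors h(X) over the sample is at most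
the product of the means for the single constraints (`mean_sample_le`, `mean_site_le`,
`mean_runSites_le`). Factors 0 on a heavy set of failed constraints bound the probability of missing
it, and Sauer–Shelah bounds the number of such sets; factors 2 bound the size by Markov's
inequality. A bad iteration is not repaired, only charged to the failure probability.

The resource bounds hold on every run, since the coordinator stops after νr iterations at the latest
and collects samples only if they have at most 4K members in total. For this reason the invariants
`Reporting` and `Collecting`, which are sure, are kept apart from `GoodReporting` and
`GoodCollecting`, which also speak of the weights. -/

open scoped ENNReal

/-! ### Sure events and expectations -/

section Calculus

variable {α β : Type*}

/-- The property `Q` holds on the whole support of `μ`. -/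
def Surely (μ : PMF α) (Q : α → Prop) : Prop := ∀ a ∈ μ.support, Q a

/-- The expectation of a nonnegative function. -/
noncomputable def mean (μ : PMF α) (φ : α → ℝ≥0∞) : ℝ≥0∞ := ∑' a, μ a * φ a

@[simp] theorem surely_pure (a : α) (Q : α → Prop) : Surely (PMF.pure a) Q ↔ Q a := by
  simp [Surely]

@[simp] theorem surely_bind (μ : PMF α) (f : α → PMF β) (Q : β → Prop) :
    Surely (μ.bind f) Q ↔ Surely μ (fun a => Surely (f a) Q) := by
  simp only [Surely, PMF.mem_support_bind_iff]
  exact ⟨fun h a ha b hb => h b ⟨a, ha, hb⟩, fun h b ⟨a, ha, hb⟩ => h a ha b hb⟩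

theorem Surely.mono {μ : PMF α} {Q Q' : α → Prop} (h : Surely μ Q) (hQ : ∀ a, Q a → Q' a) :
    Surely μ Q' := fun a ha => hQ a (h a ha)

theorem surely_of_forall {μ : PMF α} {Q : α → Prop} (h : ∀ a, Q a) : Surely μ Q :=
  fun a _ => h a

@[simp] theorem mean_pure (a : α) (φ : α → ℝ≥0∞) : mean (PMF.pure a) φ = φ a := by
  rw [mean, tsum_eq_single a] <;> simp +contextual [PMF.pure_apply]

@[simp] theorem mean_bind (μ : PMF α) (f : α → PMF β) (φ : β → ℝ≥0∞) :
    mean (μ.bind f) φ = mean μ (fun a => mean (f a) φ) := by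
  simp only [mean, PMF.bind_apply, ← ENNReal.tsum_mul_right, ← ENNReal.tsum_mul_left]
  rw [ENNReal.tsum_comm]
  simp only [mul_assoc]

theorem mean_const (μ : PMF α) (c : ℝ≥0∞) : mean μ (fun _ => c) = c := by
  simp [mean, ENNReal.tsum_mul_right]

theorem mean_mono_of_surely {μ : PMF α} {φ ψ : α → ℝ≥0∞} (h : Surely μ (fun a => φ a ≤ ψ a)) :
    mean μ φ ≤ mean μ ψ := by
  refine ENNReal.tsum_le_tsum fun a => ?_
  by_cases ha : a ∈ μ.support
  · exact mul_le_mul_right (h a ha) _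
  · rw [PMF.mem_support_iff, not_not] at ha
    simp [ha]

theorem mean_le_of_surely {μ : PMF α} {φ : α → ℝ≥0∞} {c : ℝ≥0∞} (h : Surely μ (fun a => φ a ≤ c)) :
    mean μ φ ≤ c :=
  (mean_mono_of_surely h).trans_eq (mean_const μ c)

theorem mean_add (μ : PMF α) (φ ψ : α → ℝ≥0∞) :
    mean μ (fun a => φ a + ψ a) = mean μ φ + mean μ ψ := by
  simp only [mean, mul_add, ENNReal.tsum_add]

theorem mean_finsetSum {ι : Type*} (μ : PMF α) (s : Finset ι) (φ : ι → α → ℝ≥0∞) :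
    mean μ (fun a => ∑ i ∈ s, φ i a) = ∑ i ∈ s, mean μ (φ i) := by
  classical
  induction s using Finset.induction_on with
  | empty => simp [mean_const]
  | insert i s hi ih => simp only [Finset.sum_insert hi, mean_add, ih]

theorem mean_const_mul (μ : PMF α) (c : ℝ≥0∞) (φ : α → ℝ≥0∞) :
    mean μ (fun a => c * φ a) = c * mean μ φ := by
  simp only [mean, ← ENNReal.tsum_mul_left]
  exact tsum_congr fun a => by ring

theorem mean_uniformOfFinset (s : Finset α) (hs : s.Nonempty) (φ : α → ℝ≥0∞) :
    mean (PMF.uniformOfFinset s hs) φ = (∑ a ∈ s, φ a) / s.card := by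
  rw [mean, tsum_eq_sum (s := s)]
  · rw [ENNReal.div_eq_inv_mul, Finset.mul_sum]
    exact Finset.sum_congr rfl fun a ha => by rw [PMF.uniformOfFinset_apply_of_mem _ ha]
  · intro a ha
    rw [PMF.uniformOfFinset_apply_of_notMem _ ha, zero_mul]

open Classical in
/-- The probability of an event. -/
noncomputable def prob (μ : PMF α) (Q : α → Prop) : ℝ≥0∞ := mean μ (fun a => if Q a then 1 else 0)

theorem prob_eq_toOuterMeasure (μ : PMF α) (Q : α → Prop) :
    prob μ Q = μ.toOuterMeasure {a | Q a} := by
  classical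
  rw [prob, mean, PMF.toOuterMeasure_apply]
  refine tsum_congr fun a => ?_
  by_cases h : Q a <;> simp [h]

theorem prob_eq_zero {μ : PMF α} {Q : α → Prop} (h : Surely μ (fun a => ¬ Q a)) : prob μ Q = 0 :=
  le_antisymm (mean_le_of_surely (h.mono fun a ha => by simp [ha])) bot_le

theorem prob_le_one (μ : PMF α) (Q : α → Prop) : prob μ Q ≤ 1 :=
  mean_le_of_surely (surely_of_forall fun a => by split_ifs <;> simp)

theorem prob_add_prob_not (μ : PMF α) (Q : α → Prop) : prob μ Q + prob μ (fun a => ¬ Q a) = 1 := by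
  rw [prob, prob, ← mean_add]
  refine (congrArg _ (funext fun a => ?_)).trans (mean_const μ 1)
  by_cases h : Q a <;> simp [h]

theorem prob_mono_of_surely {μ : PMF α} {Q Q' : α → Prop} (h : Surely μ (fun a => Q a → Q' a)) :
    prob μ Q ≤ prob μ Q' :=
  mean_mono_of_surely (h.mono fun a ha => by
    by_cases h1 : Q a
    · simp [h1, ha h1]
    · simp [h1])

theorem prob_or_le (μ : PMF α) (Q Q' : α → Prop) :
    prob μ (fun a => Q a ∨ Q' a) ≤ prob μ Q + prob μ Q' := by
  rw [prob, prob, prob, ← mean_add]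
  refine mean_mono_of_surely (surely_of_forall fun a => ?_)
  by_cases h : Q a <;> by_cases h' : Q' a <;> simp [h, h']

open Classical in
theorem prob_exists_le {ι : Type*} (μ : PMF α) (s : Finset ι) (Q : ι → α → Prop) :
    prob μ (fun a => ∃ i ∈ s, Q i a) ≤ ∑ i ∈ s, prob μ (Q i) := by
  simp only [prob]
  rw [← mean_finsetSum]
  refine mean_mono_of_surely (surely_of_forall fun a => ?_)
  split_ifs with h
  · obtain ⟨i, hi, hQ⟩ := h
    exact (by simp [hQ] : (1 : ℝ≥0∞) ≤ if Q i a then 1 else 0).trans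
      (Finset.single_le_sum (f := fun i => if Q i a then (1 : ℝ≥0∞) else 0)
        (fun _ _ => bot_le) hi)
  · exact bot_le

/-- If the first stage fails to be good with probability at most `δ`, and the second stage is bad
with probability at most `ε` after every good first stage, then the outcome is bad with probability
at most `δ + ε`. -/
theorem prob_bind_le {μ : PMF α} {f : α → PMF β} {G : α → Prop} {Q : β → Prop} {δ ε : ℝ≥0∞}
    (hG : prob μ (fun a => ¬ G a) ≤ δ) (hQ : ∀ a, G a → prob (f a) Q ≤ ε) :
    prob (μ.bind f) Q ≤ δ + ε := by
  classical
  calc prob (μ.bind f) Q = mean μ (fun a => prob (f a) Q) := mean_bind ..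
    _ ≤ mean μ (fun a => (if ¬ G a then 1 else 0) + ε) := by
        refine mean_mono_of_surely (surely_of_forall fun a => ?_)
        by_cases h : G a
        · simpa [h] using hQ a h
        · simpa [h] using (prob_le_one _ _).trans le_self_add
    _ ≤ δ + ε := by
        rw [mean_add, mean_const]
        refine add_le_add_left (le_of_eq_of_le ?_ hG) ε
        rw [prob]
        congr! 1
        funext a
        congr

/-- The loop rule. The invariant is indexed by the number of completed turns; since the iteration
peels off its first turn, the induction shifts the index of the invariant. -/
theorem surely_iterPMF {σ : Type u} {g : σ → PMF σ} (I : ℕ → σ → Prop) {m : ℕ} {s : σ}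
    (hg : ∀ j < m, ∀ s, I j s → Surely (g s) (I (j + 1))) (h0 : I 0 s) :
    Surely (iterPMF g m s) (I m) := by
  induction m generalizing s I with
  | zero => simpa [iterPMF] using h0
  | succ m ih =>
    rw [iterPMF, surely_bind]
    exact (hg 0 (by omega) s h0).mono fun s' hs' =>
      ih (fun j => I (j + 1)) (fun j hj => hg (j + 1) (by omega)) hs'

/-- A supermartingale argument: a potential that does not grow in the mean in any turn, as long as
the invariant holds, does not grow over the whole loop. -/
theorem mean_iterPMF_le {σ : Type u} {g : σ → PMF σ} (I : ℕ → σ → Prop) (Φ : ℕ → σ → ℝ≥0∞) {m : ℕ}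
    {s : σ} (hg : ∀ j < m, ∀ s, I j s → Surely (g s) (I (j + 1)))
    (hΦ : ∀ j < m, ∀ s, I j s → mean (g s) (Φ (j + 1)) ≤ Φ j s) (h0 : I 0 s) :
    mean (iterPMF g m s) (Φ m) ≤ Φ 0 s := by
  induction m generalizing s I Φ with
  | zero => simp [iterPMF]
  | succ m ih =>
    rw [iterPMF, mean_bind]
    refine le_trans ?_ (hΦ 0 (by omega) s h0)
    exact mean_mono_of_surely ((hg 0 (by omega) s h0).mono fun s' hs' =>
      ih (fun j => I (j + 1)) (fun j => Φ (j + 1)) (fun j hj => hg (j + 1) (by omega))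
        (fun j hj => hΦ (j + 1) (by omega)) hs')

end Calculus

/-! ### Memory cells -/

namespace PState

variable {E : Type u}

@[simp] theorem tick_reg (s : PState E) (t : ℕ) : (s.tick t).reg = s.reg := rfl
@[simp] theorem tick_mem (s : PState E) (t : ℕ) : (s.tick t).mem = s.mem := rfl
@[simp] theorem tick_cmem (s : PState E) (t : ℕ) : (s.tick t).cmem = s.cmem := rfl
@[simp] theorem tick_inbox (s : PState E) (t : ℕ) : (s.tick t).inbox = s.inbox := rfl
@[simp] theorem tick_outbox (s : PState E) (t : ℕ) : (s.tick t).outbox = s.outbox := rfl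
@[simp] theorem tick_out (s : PState E) (t : ℕ) : (s.tick t).out = s.out := rfl
@[simp] theorem tick_time (s : PState E) (t : ℕ) : (s.tick t).time = s.time + t := rfl

theorem setReg_reg_apply (W : ℕ) (s : PState E) (x v y : ℕ) :
    (s.setReg W x v).reg y = if y = x then v % 2 ^ W else s.reg y := by
  simp [setReg, Function.update_apply]

@[simp] theorem setReg_mem (W : ℕ) (s : PState E) (x v : ℕ) : (s.setReg W x v).mem = s.mem := rfl
@[simp] theorem setReg_cmem (W : ℕ) (s : PState E) (x v : ℕ) : (s.setReg W x v).cmem = s.cmem :=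
  rfl
@[simp] theorem setReg_inbox (W : ℕ) (s : PState E) (x v : ℕ) :
    (s.setReg W x v).inbox = s.inbox := rfl
@[simp] theorem setReg_outbox (W : ℕ) (s : PState E) (x v : ℕ) :
    (s.setReg W x v).outbox = s.outbox := rfl
@[simp] theorem setReg_out (W : ℕ) (s : PState E) (x v : ℕ) : (s.setReg W x v).out = s.out := rfl
@[simp] theorem setReg_time (W : ℕ) (s : PState E) (x v : ℕ) : (s.setReg W x v).time = s.time :=
  rfl

@[simp] theorem post_reg (s : PState E) (y : ℕ) (z : Item E) : (s.post y z).reg = s.reg := rfl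
@[simp] theorem post_mem (s : PState E) (y : ℕ) (z : Item E) : (s.post y z).mem = s.mem := rfl
@[simp] theorem post_cmem (s : PState E) (y : ℕ) (z : Item E) : (s.post y z).cmem = s.cmem := rfl
@[simp] theorem post_inbox (s : PState E) (y : ℕ) (z : Item E) : (s.post y z).inbox = s.inbox :=
  rfl
@[simp] theorem post_out (s : PState E) (y : ℕ) (z : Item E) : (s.post y z).out = s.out := rfl
@[simp] theorem post_time (s : PState E) (y : ℕ) (z : Item E) : (s.post y z).time = s.time := rfl

/-- The cells from `a` on hold the list `L`. -/
def Holds (s : PState E) (a : ℕ) (L : List E) : Prop :=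
  ∀ j, j < L.length → s.cmem (a + j) = L[j]?

theorem Holds.block {s : PState E} {a : ℕ} {L : List E} (h : s.Holds a L) :
    s.block a L.length = L := by
  have : ∀ j ∈ List.range L.length, s.cmem (a + j) = L[j]? := fun j hj =>
    h j (List.mem_range.1 hj)
  rw [PState.block, List.filterMap_congr this]
  clear h this
  induction L using List.reverseRecOn with
  | nil => simp
  | append_singleton L x ih =>
    rw [List.length_append, List.length_singleton, List.range_succ, List.filterMap_append]
    congr 1
    · refine Eq.trans (List.filterMap_congr fun j hj => ?_) ih
      rw [List.getElem?_append_left (List.mem_range.1 hj)]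
    · simp

theorem Holds.congr {s s' : PState E} {a : ℕ} {L : List E} (h : s.Holds a L)
    (h' : ∀ j, j < L.length → s'.cmem (a + j) = s.cmem (a + j)) : s'.Holds a L :=
  fun j hj => (h' j hj).trans (h j hj)

theorem holds_writeBlock (s : PState E) (a : ℕ) (L : List E) : (s.writeBlock a L).Holds a L := by
  intro j hj
  simp [PState.writeBlock, hj]

theorem Holds.append {s : PState E} {a : ℕ} {L L' : List E} (h : s.Holds a L)
    (h' : s.Holds (a + L.length) L') : s.Holds a (L ++ L') := by
  intro j hj
  by_cases hjl : j < L.length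
  · rw [h j hjl, List.getElem?_append_left hjl]
  · have := h' (j - L.length) (by simp at hj; omega)
    rw [List.getElem?_append_right (by omega), ← this]
    congr 1
    omega

end PState

/-! ### Loops that receive and send lists of constraints -/

section Exec

variable {E : Type u} {R : Type v} [DecidableEq E] [LinearOrder R] (env : Env E R)

open PState

theorem exec_seq (p q : Prog) (s : PState E) :
    exec env (.seq p q) s = (exec env p s).bind (exec env q) := rfl

theorem exec_ifLt (x y : ℕ) (p q : Prog) (s : PState E) : exec env (.ifLt x y p q) s =
    if s.reg x < s.reg y then exec env p (s.tick 1) else exec env q (s.tick 1) := rfl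

theorem exec_loop (x : ℕ) (p : Prog) (s : PState E) :
    exec env (.loop x p) s = iterPMF (fun s' => exec env p (s'.tick 1)) (s.reg x) (s.tick 1) := rfl

/-- Receive as many constraints as register `x` says, on the channel in register `y`, into the
cells from the one in register `p` on. -/
def recvCons (x p y one : ℕ) : Prog :=
  .loop x (.seq (.recvCon p y) (.arith .add p p one))

theorem iter_recvCons {p y one : ℕ} (hpy : p ≠ y) (hp1 : p ≠ one) (L : List E) (rest : Msg E)
    (s : PState E) (h1 : s.reg one = 1) (hin : s.inbox (s.reg y) = L.map .con ++ rest)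
    (hW : s.reg p + L.length < 2 ^ env.wordLen) :
    iterPMF (fun s' : PState E =>
        exec env (.seq (.recvCon p y) (.arith .add p p one)) (s'.tick 1)) L.length s =
      PMF.pure { s with
        reg := Function.update s.reg p (s.reg p + L.length)
        cmem := (s.writeBlock (s.reg p) L).cmem
        inbox := Function.update s.inbox (s.reg y) rest
        time := s.time + 3 * L.length } := by
  induction L generalizing s with
  | nil =>
    simp only [List.map_nil, List.nil_append] at hin
    simp only [List.length_nil, iterPMF, add_zero, mul_zero, Function.update_eq_self,
      PState.writeBlock, ← hin]
    congr 1
    have : (fun j => if s.reg p ≤ j ∧ j < s.reg p then ([] : List E)[j - s.reg p]? else s.cmem j) =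
        s.cmem := funext fun j => if_neg (by omega)
    rw [this]
  | cons X L ih =>
    simp only [List.length_cons, iterPMF]
    simp only [List.length_cons] at hW
    have hmod : (s.reg p + 1) % 2 ^ env.wordLen = s.reg p + 1 := Nat.mod_eq_of_lt (by omega)
    have hstep : exec env (.seq (.recvCon p y) (.arith .add p p one)) (s.tick 1) =
        PMF.pure { s with
          reg := Function.update s.reg p (s.reg p + 1)
          cmem := Function.update s.cmem (s.reg p) (some X)
          inbox := Function.update s.inbox (s.reg y) (L.map .con ++ rest)
          time := s.time + 3 } := by
      simp [exec, hin, PState.setReg, PState.tick, ArithOp.apply, h1, hmod]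
    rw [hstep, PMF.pure_bind, ih]
    · congr 1
      simp only [Function.update_self, Function.update_idem, Function.update_of_ne hpy.symm,
        PState.writeBlock, PState.mk.injEq, true_and]
      refine ⟨by congr 1; omega, ?_, by omega⟩
      funext j
      rcases lt_trichotomy j (s.reg p) with hj | hj | hj
      · rw [if_neg (by omega), if_neg (by simp; omega), Function.update_of_ne (by omega)]
      · subst hj
        rw [if_neg (by omega), if_pos (by simp)]
        simp
      · by_cases hj' : j < s.reg p + 1 + L.length
        · rw [if_pos (by omega), if_pos (by simp; omega),
            show j - s.reg p = (j - (s.reg p + 1)) + 1 by omega, List.getElem?_cons_succ]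
        · rw [if_neg (by omega), if_neg (by simp; omega), Function.update_of_ne (by omega)]
    · simp [Function.update_of_ne hp1.symm, h1]
    · simp [Function.update_of_ne hpy.symm]
    · simp; omega

theorem exec_recvCons {x p y one : ℕ} (hpy : p ≠ y) (hp1 : p ≠ one) (L : List E) (rest : Msg E)
    (s : PState E) (h1 : s.reg one = 1) (hx : s.reg x = L.length)
    (hin : s.inbox (s.reg y) = L.map .con ++ rest)
    (hW : s.reg p + L.length < 2 ^ env.wordLen) :
    exec env (recvCons x p y one) s =
      PMF.pure { s with
        reg := Function.update s.reg p (s.reg p + L.length)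
        cmem := (s.writeBlock (s.reg p) L).cmem
        inbox := Function.update s.inbox (s.reg y) rest
        time := s.time + (3 * L.length + 1) } := by
  rw [recvCons, exec_loop, hx, iter_recvCons env hpy hp1 L rest]
  · congr 2
    simp; omega
  all_goals simpa

/-- Send as many constraints as register `x` says, on the channel in register `y`, from the cells
from the one in register `p` on. -/
def sendCons (x p y one : ℕ) : Prog :=
  .loop x (.seq (.sendCon p y) (.arith .add p p one))

theorem iter_sendCons {p y one : ℕ} (hpy : p ≠ y) (hp1 : p ≠ one) (L : List E)
    (s : PState E) (h1 : s.reg one = 1) (hL : s.Holds (s.reg p) L)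
    (hW : s.reg p + L.length < 2 ^ env.wordLen) :
    iterPMF (fun s' : PState E =>
        exec env (.seq (.sendCon p y) (.arith .add p p one)) (s'.tick 1)) L.length s =
      PMF.pure { s with
        reg := Function.update s.reg p (s.reg p + L.length)
        outbox := Function.update s.outbox (s.reg y) (s.outbox (s.reg y) ++ L.map .con)
        time := s.time + 3 * L.length } := by
  induction L generalizing s with
  | nil => simp [iterPMF]
  | cons X L ih =>
    simp only [List.length_cons, iterPMF]
    simp only [List.length_cons] at hW
    have hmod : (s.reg p + 1) % 2 ^ env.wordLen = s.reg p + 1 := Nat.mod_eq_of_lt (by omega)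
    have hX : s.cmem (s.reg p) = some X := by simpa using hL 0 (by simp)
    have hstep : exec env (.seq (.sendCon p y) (.arith .add p p one)) (s.tick 1) =
        PMF.pure { s with
          reg := Function.update s.reg p (s.reg p + 1)
          outbox := Function.update s.outbox (s.reg y) (s.outbox (s.reg y) ++ [.con X])
          time := s.time + 3 } := by
      simp [exec, hX, PState.setReg, PState.tick, PState.post, ArithOp.apply, h1, hmod]
    rw [hstep, PMF.pure_bind, ih]
    · congr 1
      simp only [Function.update_self, Function.update_idem, Function.update_of_ne hpy.symm,
        PState.mk.injEq, true_and, List.map_cons, List.append_assoc, List.singleton_append]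
      exact ⟨by congr 1; omega, by omega⟩
    · simp [Function.update_of_ne hp1.symm, h1]
    · intro j hj
      have := hL (j + 1) (by simpa using hj)
      simp only [Function.update_self]
      rw [add_assoc, add_comm 1, this, List.getElem?_cons_succ]
    · simp; omega

theorem exec_sendCons {x p y one : ℕ} (hpy : p ≠ y) (hp1 : p ≠ one) (L : List E)
    (s : PState E) (h1 : s.reg one = 1) (hx : s.reg x = L.length) (hL : s.Holds (s.reg p) L)
    (hW : s.reg p + L.length < 2 ^ env.wordLen) :
    exec env (sendCons x p y one) s =
      PMF.pure { s with
        reg := Function.update s.reg p (s.reg p + L.length)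
        outbox := Function.update s.outbox (s.reg y) (s.outbox (s.reg y) ++ L.map .con)
        time := s.time + (3 * L.length + 1) } := by
  rw [sendCons, exec_loop, hx, iter_sendCons env hpy hp1 L]
  · congr 2
    simp; omega
  all_goals simpa

end Exec

/-! ### The program of the sites -/

section Site

open PState

/-- One turn of the reweighting loop: if constraint number `reg 16` is flagged, multiply its weight
by `reg 7`.  The memory cell `j` holds the weight of constraint number `j`, minus one. -/
def reweighBody : Prog :=
  .seq (.load 11 16) <| .seq (.arith .add 11 11 6) <| .seq (.arith .add 18 5 16) <|
  .seq (.load 13 18) <|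
  .seq (.ifLt 19 13 (.seq (.arith .mul 11 11 7) (.arith .add 17 17 6)) .skip) <|
  .seq (.arith .sub 11 11 6) <| .seq (.store 16 11) (.arith .add 16 16 6)

/-- One turn of the sampling loop: keep constraint number `reg 16` if its weight exceeds a random
number from `{0, ..., reg 8}`. -/
def sampleBody : Prog :=
  .seq (.load 11 16) <| .seq (.arith .add 11 11 6) <| .seq (.rand 12 8) <|
  .seq (.ifLt 12 11
    (.seq (.moveCon 10 16) <| .seq (.arith .add 10 10 6) (.arith .add 14 14 6)) .skip)
  (.arith .add 16 16 6)

/-- Read the multiplier, the sampling threshold and the basis, and flag the violators. -/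
def readBasis : Prog :=
  .seq (.recvNum 7 19) <| .seq (.recvNum 8 19) <| .seq (.arith .sub 9 9 6) <|
  .seq (.arith .sub 9 9 6) <| .seq (.arith .add 10 5 19) <| .seq (recvCons 9 10 19 6) <|
  .seq (.viol 19 5 5 9 5) <| .seq (.const 16 0) (.const 17 0)

/-- Prepare the registers for the sampling loop. -/
def resetSample : Prog :=
  .seq (.const 16 0) <| .seq (.const 14 0) (.arith .add 10 5 19)

/-- The part of the program of a site that precedes the sampling loop. -/
def prepareSample : Prog :=
  .seq readBasis <| .seq (.loop 5 reweighBody) resetSample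

/-- Reply with the number of violators and the size of the sample. -/
def sendCounts : Prog :=
  .seq (.sendNum 17 19) (.sendNum 14 19)

/-- Send the sample. -/
def sendSample : Prog :=
  .seq (.arith .add 10 5 19) (sendCons 14 10 19 6)

def siteProgram : Prog :=
  .seq (.const 6 1) <| .seq (.recvLen 9 19) <|
  .ifLt 19 9
    (.seq prepareSample <| .seq (.loop 5 sampleBody) sendCounts)
    sendSample

variable {E : Type u} {R : Type v} [DecidableEq E] [LinearOrder R] (env : Env E R)

/-- The state after `j` turns of the reweighting loop, started in `s`, with `N` constraints. -/
structure Reweighed (W N : ℕ) (s : PState E) (j : ℕ) (s' : PState E) : Prop where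
  reg : ∀ x, x ≠ 11 → x ≠ 13 → x ≠ 16 → x ≠ 17 → x ≠ 18 → s'.reg x = s.reg x
  reg16 : s'.reg 16 = j
  reg17_le : s'.reg 17 ≤ j
  reg17_eq : s'.reg 17 = 0 ↔ ∀ i < j, s.mem (N + i) = 0
  cmem : s'.cmem = s.cmem
  inbox : s'.inbox = s.inbox
  outbox : s'.outbox = s.outbox
  out : s'.out = s.out
  time : s'.time ≤ s.time + 11 * j
  mem_old : ∀ x, j ≤ x → s'.mem x = s.mem x
  mem_new : ∀ i < j, 0 < s.reg 7 → (s.mem i + 1) * s.reg 7 < 2 ^ W →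
    s'.mem i + 1 = if 0 < s.mem (N + i) then (s.mem i + 1) * s.reg 7 else s.mem i + 1

/-- Turn j writes to cell j only, so the weight in cell j and the flag in cell N + j are still the
original ones. The clause on new weights carries its own no-overflow condition: after a bad sample
the weights may wrap around, and the other clauses, above all the one on time, must survive this. -/
theorem surely_reweighBody {N : ℕ} {s s' : PState E} {j : ℕ} (hj : j < N)
    (hW : 2 * N + 1 < 2 ^ env.wordLen) (h5 : s.reg 5 = N) (h6 : s.reg 6 = 1) (h19 : s.reg 19 = 0)
    (hflag : ∀ i < N, s.mem (N + i) ≤ 1) (h : Reweighed env.wordLen N s j s') :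
    Surely (exec env reweighBody (s'.tick 1)) (Reweighed env.wordLen N s (j + 1)) := by
  have e5 : s'.reg 5 = N := by rw [h.reg] <;> simp [h5]
  have e6 : s'.reg 6 = 1 := by rw [h.reg] <;> simp [h6]
  have e7 : s'.reg 7 = s.reg 7 := by rw [h.reg] <;> simp
  have e19 : s'.reg 19 = 0 := by rw [h.reg] <;> simp [h19]
  have m1 : (N + j) % 2 ^ env.wordLen = N + j := Nat.mod_eq_of_lt (by omega)
  have m2 : (j + 1) % 2 ^ env.wordLen = j + 1 := Nat.mod_eq_of_lt (by omega)
  have m3 : (s'.reg 17 + 1) % 2 ^ env.wordLen = s'.reg 17 + 1 :=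
    Nat.mod_eq_of_lt (by have := h.reg17_le; omega)
  have m4 : s.mem (N + j) % 2 ^ env.wordLen = s.mem (N + j) :=
    Nat.mod_eq_of_lt (by have := hflag j hj; omega)
  have eold := h.mem_old
  have hle := hflag j hj
  by_cases hf : 0 < s.mem (N + j)
  · simp only [reweighBody, exec, PMF.pure_bind, PState.setReg_reg_apply, ArithOp.apply, tick_reg,
      tick_mem, tick_cmem, setReg_mem, Nat.reduceEqDiff, if_false, if_true, e5, e6, e19, h.reg16,
      m1, eold (N + j) (by omega), m4, hf, surely_pure, m3, e7, eold j le_rfl]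
    refine ⟨?_, ?_, ?_, ?_, h.cmem, h.inbox, h.outbox, h.out, ?_, ?_, ?_⟩
    · intro x h1 h2 h3 h4 h5
      simp [PState.setReg_reg_apply, h1, h2, h3, h4, h5, h.reg x h1 h2 h3 h4 h5]
    · simp [PState.setReg_reg_apply, m2]
    · simpa [PState.setReg_reg_apply, m3] using h.reg17_le
    · simp only [PState.setReg_reg_apply, tick_reg]
      simp only [Nat.reduceEqDiff, if_false, if_true, m3, Nat.add_one_ne_zero, false_iff]
      exact fun H => hf.ne' (H j (by omega))
    · have := h.time; simp; omega
    · intro x hx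
      simp [Function.update_of_ne (show x ≠ j by omega), eold x (by omega)]
    · intro i hi h7 hlt
      rcases Nat.lt_succ_iff_lt_or_eq.1 hi with hi | rfl
      · have := h.mem_new i hi h7 hlt
        simp [Function.update_of_ne hi.ne]
        exact this
      -- The multiplier is positive, so if the product fits into a word, the old weight does too,
      -- and loading it loses no digits.
      · have l1 : s.mem i + 1 < 2 ^ env.wordLen := 
          lt_of_le_of_lt (Nat.le_mul_of_pos_right _ h7) hlt
        have l2 : 0 < (s.mem i + 1) * s.reg 7 := by positivity
        have l0 : s.mem i % 2 ^ env.wordLen = s.mem i := Nat.mod_eq_of_lt (by omega)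
        simp only [tick_mem, setReg_mem, Function.update_self, hf, if_true, l0, 
          Nat.mod_eq_of_lt l1, Nat.mod_eq_of_lt hlt]
        rw [Nat.mod_eq_of_lt (by omega)]
        omega
  · simp only [reweighBody, exec, PMF.pure_bind, PState.setReg_reg_apply, ArithOp.apply, tick_reg,
      tick_mem, tick_cmem, setReg_mem, Nat.reduceEqDiff, if_false, if_true, e5, e6, e19, h.reg16,
      m1, eold (N + j) (by omega), m4, hf, surely_pure, e7, eold j le_rfl]
    refine ⟨?_, ?_, ?_, ?_, h.cmem, h.inbox, h.outbox, h.out, ?_, ?_, ?_⟩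
    · intro x h1 h2 h3 h4 h5
      simp [PState.setReg_reg_apply, h1, h2, h3, h5, h.reg x h1 h2 h3 h4 h5]
    · simp [PState.setReg_reg_apply, m2]
    · simp [PState.setReg_reg_apply]; have := h.reg17_le; omega
    · simp only [PState.setReg_reg_apply, tick_reg]
      simp only [Nat.reduceEqDiff, if_false]
      rw [h.reg17_eq]
      constructor
      · intro H i hi
        rcases Nat.lt_succ_iff_lt_or_eq.1 hi with hi | rfl
        · exact H i hi
        · omega
      · exact fun H i hi => H i (by omega)
    · have := h.time; simp; omega
    · intro x hx
      simp [Function.update_of_ne (show x ≠ j by omega), eold x (by omega)]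
    · intro i hi h7 hlt
      rcases Nat.lt_succ_iff_lt_or_eq.1 hi with hi | rfl
      · have := h.mem_new i hi h7 hlt
        simp [Function.update_of_ne hi.ne]
        exact this
      · have l1 : s.mem i + 1 < 2 ^ env.wordLen := 
          lt_of_le_of_lt (Nat.le_mul_of_pos_right _ h7) hlt
        have l0 : s.mem i % 2 ^ env.wordLen = s.mem i := Nat.mod_eq_of_lt (by omega)
        simp only [tick_mem, setReg_mem, Function.update_self, hf, if_false, l0, 
          Nat.mod_eq_of_lt l1]
        rw [Nat.mod_eq_of_lt (by omega)]
        omega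

theorem surely_reweigh {N : ℕ} {s : PState E}
    (hW : 2 * N + 1 < 2 ^ env.wordLen) (h5 : s.reg 5 = N) (h6 : s.reg 6 = 1) (h19 : s.reg 19 = 0)
    (h16 : s.reg 16 = 0) (h17 : s.reg 17 = 0) (hflag : ∀ i < N, s.mem (N + i) ≤ 1) :
    Surely (exec env (.loop 5 reweighBody) s) (Reweighed env.wordLen N (s.tick 1) N) := by
  rw [exec_loop, h5]
  refine surely_iterPMF (Reweighed env.wordLen N (s.tick 1)) (fun j hj s' h => ?_) ?_
  · exact surely_reweighBody env hj hW h5 h6 h19 hflag h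
  · exact ⟨fun _ _ _ _ _ _ => rfl, h16, h17.le, by simp [h17], rfl, rfl, rfl, rfl, by simp,
      fun _ _ => rfl, by simp⟩

/-! ### The sampling loop of a site -/

/-- The state after `j` turns of the sampling loop, started in `s`. -/
structure Sampled (L : List E) (s : PState E) (j : ℕ) (s' : PState E) : Prop where
  reg : ∀ x, x ≠ 10 → x ≠ 11 → x ≠ 12 → x ≠ 14 → x ≠ 16 → s'.reg x = s.reg x
  reg16 : s'.reg 16 = j
  mem : s'.mem = s.mem
  inbox : s'.inbox = s.inbox
  outbox : s'.outbox = s.outbox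
  out : s'.out = s.out
  time : s'.time ≤ s.time + 9 * j
  holds : s'.Holds 0 L
  sample : ∃ N : List E, N.Sublist (L.take j) ∧ s'.reg 14 = N.length ∧
    s'.reg 10 = L.length + N.length ∧ s'.Holds L.length N

/-- The state after one turn of the sampling loop in which the random number is `v`. -/
def sampleStep (W : ℕ) (s : PState E) (v : ℕ) : PState E :=
  let w := (s.mem (s.reg 16) % 2 ^ W + s.reg 6) % 2 ^ W
  let s1 := ((((s.tick 1).setReg W 11 (s.mem (s.reg 16))).tick 1).setReg W 11 w).tick 1
  let s2 := (s1.setReg W 12 v).tick 1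
  if v % 2 ^ W < w then
    let s3 := { s2 with cmem := Function.update s.cmem (s.reg 10) (s.cmem (s.reg 16)) }
    let s4 := ((s3.tick 2).setReg W 10 (s.reg 10 + s.reg 6)).tick 1
    (((s4.setReg W 14 (s.reg 14 + s.reg 6)).tick 1).setReg W 16 (s.reg 16 + s.reg 6)).tick 1
  else ((s2.tick 2).setReg W 16 (s.reg 16 + s.reg 6)).tick 1

/-- Isolates the single random choice of a turn; whatever holds for every value `v` of the draw then
holds surely. -/
theorem exec_sampleBody (s : PState E) :
    exec env sampleBody (s.tick 1) =
      (PMF.uniformOfFinset (Finset.range (s.reg 8 + 1)) Finset.nonempty_range_add_one).bind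
        (fun v => PMF.pure (sampleStep env.wordLen s v)) := by
  simp only [sampleBody, exec, PMF.pure_bind, PMF.bind_bind, PState.setReg_reg_apply,
    ArithOp.apply, tick_reg, tick_mem, tick_cmem, setReg_mem, setReg_cmem, Nat.reduceEqDiff,
    if_false, if_true]
  congr 1
  funext v
  rw [sampleStep]
  split_ifs with h
  · simp [PMF.pure_bind, PState.tick, PState.setReg]
  · simp [PMF.pure_bind, PState.tick, PState.setReg]

/-- The sample grows in the cells behind the site's own constraints, which are therefore never
overwritten. After j turns it is a sublist of the first j constraints, so no address reaches 2|L| +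
1. -/
theorem Sampled.step {L : List E} {s s' : PState E} {j : ℕ} {W : ℕ} (hj : j < L.length)
    (hW : 2 * L.length + 1 < 2 ^ W) (h6 : s.reg 6 = 1) (h : Sampled L s j s') (v : ℕ) :
    Sampled L s (j + 1) (sampleStep W s' v) := by
  obtain ⟨N, hN, h14, h10, hNL⟩ := h.sample
  have hNle : N.length ≤ j := hN.length_le.trans (by simp)
  have e6 : s'.reg 6 = 1 := by rw [h.reg] <;> simp [h6]
  have m1 : (j + 1) % 2 ^ W = j + 1 := Nat.mod_eq_of_lt (by omega)
  have m2 : (N.length + 1) % 2 ^ W = N.length + 1 := Nat.mod_eq_of_lt (by omega)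
  have m3 : (L.length + N.length + 1) % 2 ^ W = L.length + N.length + 1 :=
    Nat.mod_eq_of_lt (by omega)
  have hLj : s'.cmem j = some L[j] := by simpa [hj] using h.holds j hj
  have htake : L.take (j + 1) = L.take j ++ [L[j]] := by simp
  by_cases hv : v % 2 ^ W < (s'.mem (s'.reg 16) % 2 ^ W + s'.reg 6) % 2 ^ W
  · simp only [sampleStep, if_pos hv]
    refine ⟨?_, ?_, h.mem, h.inbox, h.outbox, h.out, ?_, ?_, N ++ [L[j]], ?_, ?_, ?_, ?_⟩
    · intro x h1 h2 h3 h4 h5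
      simp [PState.setReg_reg_apply, h1, h2, h3, h4, h5, h.reg x h1 h2 h3 h4 h5]
    · simp [PState.setReg_reg_apply, h.reg16, e6, m1]
    · have := h.time; simp; omega
    · refine h.holds.congr fun i hi => ?_
      simp [Function.update_apply, h10]; omega
    · rw [htake]; exact hN.append (List.Sublist.refl _)
    · simp [PState.setReg_reg_apply, h14, e6, m2]
    · simp [PState.setReg_reg_apply, h10, e6, m3, ← add_assoc]
    · refine PState.Holds.append (hNL.congr fun i hi => ?_) fun i hi => ?_
      · simp [Function.update_apply, h10]; omega
      · simp only [List.length_singleton, Nat.lt_one_iff] at hi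
        subst hi
        simp [h10, h.reg16, hLj]
  · simp only [sampleStep, if_neg hv]
    refine ⟨?_, ?_, h.mem, h.inbox, h.outbox, h.out, ?_, h.holds, N, ?_, ?_, ?_, hNL⟩
    · intro x h1 h2 h3 h4 h5
      simp [PState.setReg_reg_apply, h2, h3, h5, h.reg x h1 h2 h3 h4 h5]
    · simp [PState.setReg_reg_apply, h.reg16, e6, m1]
    · have := h.time; simp; omega
    · rw [htake]; exact hN.trans (List.sublist_append_left _ _)
    · simp [PState.setReg_reg_apply, h14]
    · simp [PState.setReg_reg_apply, h10]

omit [DecidableEq E] in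
theorem Sampled.start {L : List E} {s : PState E} (h16 : s.reg 16 = 0) (h14 : s.reg 14 = 0)
    (h10 : s.reg 10 = L.length) (hL : s.Holds 0 L) : Sampled L s 0 s :=
  ⟨fun _ _ _ _ _ _ => rfl, h16, rfl, rfl, rfl, rfl, by simp, hL, [], by simp, by simpa using h14,
    by simpa using h10, by simp [PState.Holds]⟩

theorem surely_sample {L : List E} {s : PState E} (hW : 2 * L.length + 1 < 2 ^ env.wordLen)
    (h5 : s.reg 5 = L.length) (h6 : s.reg 6 = 1) (h16 : s.reg 16 = 0) (h14 : s.reg 14 = 0)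
    (h10 : s.reg 10 = L.length) (hL : s.Holds 0 L) :
    Surely (exec env (.loop 5 sampleBody) s) (Sampled L (s.tick 1) L.length) := by
  rw [exec_loop, h5]
  refine surely_iterPMF (Sampled L (s.tick 1)) (fun j hj s' h => ?_) (Sampled.start h16 h14 h10 hL)
  rw [exec_sampleBody, surely_bind]
  exact surely_of_forall fun v => (surely_pure _ _).2 (Sampled.step (s := s.tick 1) hj hW h6 h v)

/-- The mean of the function that is `c` on the numbers below `w`, and `1` otherwise, at a random
element of `{0, ..., D}`. -/
noncomputable def sampleMean (D w : ℕ) (c : ℝ≥0∞) : ℝ≥0∞ :=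
  (∑ v ∈ Finset.range (D + 1), if v < w then c else 1) / ((D + 1 : ℕ) : ℝ≥0∞)

/-- The potential is the product of h over the sample drawn so far times the mean factors of the
constraints still to come; a turn replaces one mean factor by its realization. Since h is arbitrary,
the same bound serves for missing a set and for the size of the sample. -/
theorem mean_sample_le {L : List E} {s : PState E} (hW : 2 * L.length + 1 < 2 ^ env.wordLen)
    (h5 : s.reg 5 = L.length) (h6 : s.reg 6 = 1) (h16 : s.reg 16 = 0) (h14 : s.reg 14 = 0)
    (h10 : s.reg 10 = L.length) (hL : s.Holds 0 L) (hD : s.reg 8 < 2 ^ env.wordLen)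
    (w : E → ℕ) (hw : ∀ j (hj : j < L.length), s.mem j + 1 = w L[j])
    (hwW : ∀ X ∈ L, w X < 2 ^ env.wordLen) (h : E → ℝ≥0∞) :
    mean (exec env (.loop 5 sampleBody) s)
        (fun s' => ((s'.block L.length (s'.reg 14)).map h).prod) ≤
      (L.map fun X => sampleMean (s.reg 8) (w X) (h X)).prod := by
  rw [exec_loop, h5]
  let Φ : ℕ → PState E → ℝ≥0∞ := fun j s' => ((s'.block L.length (s'.reg 14)).map h).prod *
    ((L.drop j).map fun X => sampleMean (s.reg 8) (w X) (h X)).prod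
  have key := mean_iterPMF_le (g := fun s' => exec env sampleBody (s'.tick 1))
    (Sampled L (s.tick 1)) Φ (m := L.length) (s := s.tick 1) ?_ ?_ (Sampled.start h16 h14 h10 hL)
  · have hb : (s.tick 1).block L.length 0 = [] := by simp [PState.block]
    simpa only [Φ, List.drop_length, List.map_nil, List.prod_nil, mul_one, List.drop_zero, tick_reg,
      h14, hb, one_mul] using key
  · intro j hj s' h
    rw [exec_sampleBody, surely_bind]
    exact surely_of_forall fun v => (surely_pure _ _).2 (Sampled.step (s := s.tick 1) hj hW h6 h v)
  · intro j hj s' hs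
    rw [exec_sampleBody, mean_bind]
    simp only [mean_pure]
    rw [mean_uniformOfFinset, hs.reg 8 (by simp) (by simp) (by simp) (by simp) (by simp),
      Finset.card_range]
    obtain ⟨N, hN, e14, e10, hNL⟩ := hs.sample
    have e6 : s'.reg 6 = 1 := by rw [hs.reg] <;> simp [h6]
    have hNle : N.length ≤ j := hN.length_le.trans (by simp)
    have m2 : (N.length + 1) % 2 ^ env.wordLen = N.length + 1 := Nat.mod_eq_of_lt (by omega)
    have hLj : s'.cmem j = some L[j] := by simpa [hj] using hs.holds j hj
    have hwj := hw j hj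
    have hwlt := hwW L[j] (List.getElem_mem hj)
    have hterm : ∀ v ∈ Finset.range (s.reg 8 + 1),
        Φ (j + 1) (sampleStep env.wordLen s' v) = (N.map h).prod *
          ((L.drop (j + 1)).map fun X => sampleMean (s.reg 8) (w X) (h X)).prod *
            (if v < w L[j] then h L[j] else 1) := by
      intro v hv
      rw [Finset.mem_range] at hv
      have hcond : (s'.mem (s'.reg 16) % 2 ^ env.wordLen + s'.reg 6) % 2 ^ env.wordLen = w L[j] := by
        rw [hs.mem, hs.reg16, e6, tick_mem, Nat.mod_eq_of_lt (by omega : s.mem j < _), hwj,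
          Nat.mod_eq_of_lt hwlt]
      have hblock : ((sampleStep env.wordLen s' v).block L.length
          ((sampleStep env.wordLen s' v).reg 14)) = if v < w L[j] then N ++ [L[j]] else N := by
        simp only [sampleStep, hcond, Nat.mod_eq_of_lt (by omega : v < 2 ^ env.wordLen)]
        split_ifs with hv
        · have hl : (N ++ [L[j]]).length = N.length + 1 := by simp
          simp only [tick_reg, PState.setReg_reg_apply, Nat.reduceEqDiff, if_false, if_true, e14, e6,
            m2]
          rw [← hl]
          refine PState.Holds.block (PState.Holds.append (hNL.congr fun i hi => ?_) fun i hi => ?_)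
          · simp [Function.update_apply, e10]; omega
          · simp only [List.length_singleton, Nat.lt_one_iff] at hi
            subst hi
            simp [e10, hs.reg16, hLj]
        · simp only [tick_reg, PState.setReg_reg_apply, Nat.reduceEqDiff, if_false, e14]
          exact PState.Holds.block hNL
      simp only [Φ]
      rw [hblock]
      split_ifs with hv <;> simp [mul_right_comm]
    rw [tick_reg, Finset.sum_congr rfl hterm, ← Finset.mul_sum]
    have hb : s'.block L.length (s'.reg 14) = N := by rw [e14]; exact hNL.block
    simp only [Φ]
    rw [hb, List.drop_eq_getElem_cons hj, List.map_cons, List.prod_cons, sampleMean,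
      ENNReal.div_eq_inv_mul, ENNReal.div_eq_inv_mul]
    exact le_of_eq (by ring)

/-! ### A complete turn of a site -/

/-- What a site remembers between two rounds: its constraints `L` and its last sample `N`. -/
structure SiteState (L N : List E) (s : PState E) : Prop where
  reg5 : s.reg 5 = L.length
  reg19 : s.reg 19 = 0
  reg14 : s.reg 14 = N.length
  holds : s.Holds 0 L
  holds_sample : s.Holds L.length N
  sublist : N.Sublist L

/-- The state of a site with the constraints `L` after it has read the basis `B`. -/
structure BasisRead (P : LPTypeProblem E R) (Tv : ℕ → ℕ → ℕ) (L B : List E) (mult D : ℕ)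
    (s s' : PState E) : Prop where
  reg5 : s'.reg 5 = L.length
  reg6 : s'.reg 6 = 1
  reg7 : s'.reg 7 = mult
  reg8 : s'.reg 8 = D
  reg16 : s'.reg 16 = 0
  reg17 : s'.reg 17 = 0
  reg19 : s'.reg 19 = 0
  holds : s'.Holds 0 L
  mem : ∀ j < L.length, s'.mem j = s.mem j
  flag_le : ∀ j < L.length, s'.mem (L.length + j) ≤ 1
  flag : ∀ j (hj : j < L.length), 0 < s'.mem (L.length + j) ↔ P.Violates L[j] B.toFinset
  outbox : s'.outbox = s.outbox
  time : s'.time ≤ s.time + (Tv L.length B.length + 3 * B.length + 12)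

/-- The basis is stored behind the constraints of the site, where the old sample is no longer
needed. The message consists of two numbers and the basis, which explains the two subtractions from
its length. -/
theorem surely_readBasis {L N B : List E} {mult D : ℕ} {s : PState E} (hs : SiteState L N s)
    (h6 : s.reg 6 = 1) (h9 : s.reg 9 = B.length + 2)
    (hin : s.inbox 0 = .num mult :: .num D :: B.map .con)
    (hW : L.length + B.length + 2 < 2 ^ env.wordLen) (hmult : mult < 2 ^ env.wordLen)
    (hD : D < 2 ^ env.wordLen) :
    Surely (exec env readBasis s) (BasisRead env.prob env.Tv L B mult D s) := by
  have m1 : (B.length + 1) % 2 ^ env.wordLen = B.length + 1 := Nat.mod_eq_of_lt (by omega)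
  have m2 : B.length % 2 ^ env.wordLen = B.length := Nat.mod_eq_of_lt (by omega)
  have m3 : L.length % 2 ^ env.wordLen = L.length := Nat.mod_eq_of_lt (by omega)
  let s1 : PState E := { s with
    reg := Function.update (Function.update (Function.update (Function.update s.reg 7 mult) 8 D)
      9 B.length) 10 L.length
    inbox := Function.update s.inbox 0 (B.map .con)
    time := s.time + 5 }
  have e1 : exec env readBasis s = exec env (.seq (recvCons 9 10 19 6) <|
      .seq (.viol 19 5 5 9 5) <| .seq (.const 16 0) (.const 17 0)) s1 := by
    simp only [readBasis, exec_seq]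
    simp [exec, hs.reg19, hin, hs.reg5, h6, h9, PState.setReg, PState.tick, ArithOp.apply, s1, m1,
      m2, m3, Nat.mod_eq_of_lt hmult, Nat.mod_eq_of_lt hD]
  have e2 : ∃ s2 : PState E, exec env (recvCons 9 10 19 6) s1 = PMF.pure s2 ∧
      s2.reg = Function.update s1.reg 10 (L.length + B.length) ∧ s2.mem = s.mem ∧
      s2.cmem = (s1.writeBlock L.length B).cmem ∧ s2.outbox = s.outbox ∧
      s2.time = s.time + 5 + (3 * B.length + 1) := by
    rw [exec_recvCons env (by simp) (by simp) B []]
    · exact ⟨_, rfl, by simp [s1], rfl, by simp [s1], rfl, rfl⟩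
    · simp [s1, h6]
    · simp [s1]
    · simp [s1, hs.reg19]
    · simp [s1]; omega
  obtain ⟨s2, e2, hreg, hmem, hcmem, hout, htime⟩ := e2
  have e5 : s2.reg 5 = L.length := by simp [hreg, s1, hs.reg5]
  have e9 : s2.reg 9 = B.length := by simp [hreg, s1]
  have e19 : s2.reg 19 = 0 := by simp [hreg, s1, hs.reg19]
  have hB : s2.block L.length B.length = B :=
    PState.Holds.block ((PState.holds_writeBlock s1 _ _).congr fun i _ => by rw [hcmem])
  have hL : s2.Holds 0 L := hs.holds.congr fun j hj => by
    simp [hcmem, s1, PState.writeBlock]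
    omega
  rw [e1, exec_seq, e2]
  simp only [PMF.pure_bind, exec, surely_pure, e5, e9, e19]
  refine ⟨?_, ?_, ?_, ?_, ?_, ?_, ?_, hL, ?_, ?_, ?_, hout, ?_⟩
  · simpa [PState.setReg_reg_apply, violFlags] using e5
  · simp [PState.setReg_reg_apply, violFlags, hreg, s1, h6]
  · simp [PState.setReg_reg_apply, violFlags, hreg, s1]
  · simp [PState.setReg_reg_apply, violFlags, hreg, s1]
  · simp [PState.setReg_reg_apply]
  · simp [PState.setReg_reg_apply]
  · simpa [PState.setReg_reg_apply, violFlags] using e19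
  · intro j hj
    simp [violFlags, Nat.not_le.2 hj, hmem]
  · intro j hj
    simp only [violFlags, tick_mem, setReg_mem]
    rw [if_pos (by omega)]
    split_ifs <;> simp
  · intro j hj
    have hc : s2.cmem (0 + j) = some L[j] := by simpa [hj] using hL j hj
    simp only [violFlags, tick_mem, setReg_mem]
    rw [if_pos (by omega)]
    have hiff : (∃ X, s2.cmem (0 + (L.length + j - L.length)) = some X ∧
        env.prob.Violates X (s2.block L.length B.length).toFinset) ↔
        env.prob.Violates L[j] B.toFinset := by
      rw [Nat.add_sub_cancel_left, hc, hB]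
      simp
    split_ifs with h
    · simpa using hiff.1 h
    · simpa using fun h' => h (hiff.2 h')
  · simp [violFlags, htime]
    omega

theorem surely_resetSample {s : PState E} {l : ℕ} (h5 : s.reg 5 = l) (h19 : s.reg 19 = 0)
    (hl : l < 2 ^ env.wordLen) :
    Surely (exec env resetSample s) (fun s' => s' = { s with
      reg := Function.update (Function.update (Function.update s.reg 16 0) 14 0) 10 l
      time := s.time + 3 }) := by
  simp [resetSample, exec, PState.setReg, PState.tick, ArithOp.apply, h5, h19, Nat.mod_eq_of_lt hl]

theorem surely_sendCounts {s : PState E} (h19 : s.reg 19 = 0) :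
    Surely (exec env sendCounts s) (fun s' => s'.reg = s.reg ∧ s'.mem = s.mem ∧ s'.cmem = s.cmem ∧
      s'.outbox 0 = s.outbox 0 ++ [.num (s.reg 17), .num (s.reg 14)] ∧ s'.time = s.time + 2) := by
  simp [sendCounts, exec, PState.post, PState.tick, h19]

/-- The state of a site with the constraints `L` after it has reweighted them and is about to draw
a sample. -/
structure SampleReady (P : LPTypeProblem E R) (Tv : ℕ → ℕ → ℕ) (W : ℕ) (L B : List E)
    (mult D : ℕ) (s s' : PState E) : Prop where
  reg5 : s'.reg 5 = L.length
  reg6 : s'.reg 6 = 1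
  reg8 : s'.reg 8 = D
  reg10 : s'.reg 10 = L.length
  reg14 : s'.reg 14 = 0
  reg16 : s'.reg 16 = 0
  reg19 : s'.reg 19 = 0
  reg17_le : s'.reg 17 ≤ L.length
  reg17_eq : s'.reg 17 = 0 ↔ ∀ X ∈ L, ¬ P.Violates X B.toFinset
  holds : s'.Holds 0 L
  mem_viol : ∀ j (hj : j < L.length), 0 < mult → (s.mem j + 1) * mult < 2 ^ W →
    P.Violates L[j] B.toFinset → s'.mem j + 1 = (s.mem j + 1) * mult
  mem_not_viol : ∀ j (hj : j < L.length), 0 < mult → (s.mem j + 1) * mult < 2 ^ W →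
    ¬ P.Violates L[j] B.toFinset → s'.mem j + 1 = s.mem j + 1
  outbox : s'.outbox = s.outbox
  time : s'.time ≤ s.time + (Tv L.length B.length + 3 * B.length + 11 * L.length + 20)

theorem surely_prepareSample {L N B : List E} {mult D : ℕ} {s : PState E} (hs : SiteState L N s)
    (h6 : s.reg 6 = 1) (h9 : s.reg 9 = B.length + 2)
    (hin : s.inbox 0 = .num mult :: .num D :: B.map .con)
    (hW : 2 * L.length + B.length + 2 < 2 ^ env.wordLen) (hmult : mult < 2 ^ env.wordLen)
    (hD : D < 2 ^ env.wordLen) :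
    Surely (exec env prepareSample s)
      (SampleReady env.prob env.Tv env.wordLen L B mult D s) := by
  rw [prepareSample, exec_seq, surely_bind]
  refine (surely_readBasis env hs h6 h9 hin (by omega) hmult hD).mono fun s2 h2 => ?_
  rw [exec_seq, surely_bind]
  refine (surely_reweigh env (by omega) h2.reg5 h2.reg6 h2.reg19 h2.reg16 h2.reg17
    h2.flag_le).mono fun s3 h3 => ?_
  have h35 : s3.reg 5 = L.length := by rw [h3.reg] <;> simp [h2.reg5]
  have h319 : s3.reg 19 = 0 := by rw [h3.reg] <;> simp [h2.reg19]
  have h17 : (∀ i < L.length, (s2.tick 1).mem (L.length + i) = 0) ↔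
      ∀ X ∈ L, ¬ env.prob.Violates X B.toFinset := by
    rw [List.forall_mem_iff_forall_getElem]
    refine forall_congr' fun i => forall_congr' fun hi => ?_
    rw [← h2.flag i hi, not_lt, Nat.le_zero, tick_mem]
  refine (surely_resetSample env h35 h319 (by omega)).mono ?_
  rintro s4 rfl
  have h7 : (s2.tick 1).reg 7 = mult := h2.reg7
  refine ⟨?_, ?_, ?_, ?_, ?_, ?_, ?_, ?_, ?_, ?_, ?_, ?_, ?_, ?_⟩
  · simp [h35]
  · simp [h3.reg, h2.reg6]
  · simp [h3.reg, h2.reg8]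
  · simp
  · simp
  · simp
  · simp [h319]
  · simpa using h3.reg17_le
  · simp only [Function.update_apply, Nat.reduceEqDiff, if_false]
    rw [h3.reg17_eq, h17]
  · exact h2.holds.congr fun j hj => by simp [h3.cmem]
  · intro j hj hm hlt hv
    have hmem : (s2.tick 1).mem j = s.mem j := h2.mem j hj
    have := h3.mem_new j hj (by rwa [h7]) (by rwa [h7, hmem])
    rw [if_pos (show 0 < (s2.tick 1).mem _ from (h2.flag j hj).2 hv), h7, hmem] at this
    exact this
  · intro j hj hm hlt hv
    have hmem : (s2.tick 1).mem j = s.mem j := h2.mem j hj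
    have := h3.mem_new j hj (by rwa [h7]) (by rwa [h7, hmem])
    rw [if_neg (show ¬ 0 < (s2.tick 1).mem _ from fun h => hv ((h2.flag j hj).1 h)), hmem] at this
    exact this
  · exact h3.outbox.trans h2.outbox
  · have t3 := h3.time
    have t2 := h2.time
    simp only [tick_time] at t3 t2 ⊢
    omega

/-- The state of a site after it has seen the length of the message. -/
def siteStart (s : PState E) : PState E :=
  { s with
    reg := Function.update (Function.update s.reg 6 1) 9 (s.inbox 0).length
    time := s.time + 3 }

omit [DecidableEq E] in
theorem SiteState.siteStart {L N : List E} {s : PState E} (hs : SiteState L N s) :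
    SiteState L N (siteStart s) :=
  ⟨by simp [_root_.siteStart, hs.reg5], by simp [_root_.siteStart, hs.reg19],
    by simp [_root_.siteStart, hs.reg14], hs.holds, hs.holds_sample, hs.sublist⟩

/-- The length of the message is the only control signal: a message with a basis has at least two
items even if the basis is empty, and the empty message asks for the sample. -/
theorem exec_siteProgram {s : PState E} (h19 : s.reg 19 = 0)
    (hW : (s.inbox 0).length + 1 < 2 ^ env.wordLen) :
    exec env siteProgram s = if 0 < (s.inbox 0).length then
      exec env (.seq prepareSample <| .seq (.loop 5 sampleBody) sendCounts) (siteStart s)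
      else exec env sendSample (siteStart s) := by
  have e1 : exec env siteProgram s =
      exec env (.ifLt 19 9 (.seq prepareSample <| .seq (.loop 5 sampleBody) sendCounts) sendSample)
        { s with
          reg := Function.update (Function.update s.reg 6 1) 9 (s.inbox 0).length
          time := s.time + 2 } := by
    rw [siteProgram, exec_seq, exec, PMF.pure_bind, exec_seq, exec, PMF.pure_bind]
    simp [h19, PState.setReg, PState.tick, Nat.mod_eq_of_lt (by omega : 1 < 2 ^ env.wordLen),
      Nat.mod_eq_of_lt (by omega : (s.inbox 0).length < 2 ^ env.wordLen)]
  rw [e1, exec_ifLt]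
  simp [h19, PState.tick, siteStart]

/-- The outcome of a turn of a site with the constraints `L` that has received the basis `B`. -/
structure Reported (P : LPTypeProblem E R) (Tv : ℕ → ℕ → ℕ) (W : ℕ) (L B N : List E)
    (mult : ℕ) (s s' : PState E) : Prop where
  state : SiteState L N s'
  reply : ∃ x ≤ L.length, (x = 0 ↔ ∀ X ∈ L, ¬ P.Violates X B.toFinset) ∧
    s'.outbox 0 = [.num x, .num N.length]
  mem_viol : ∀ j (hj : j < L.length), 0 < mult → (s.mem j + 1) * mult < 2 ^ W →
    P.Violates L[j] B.toFinset → s'.mem j + 1 = (s.mem j + 1) * mult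
  mem_not_viol : ∀ j (hj : j < L.length), 0 < mult → (s.mem j + 1) * mult < 2 ^ W →
    ¬ P.Violates L[j] B.toFinset → s'.mem j + 1 = s.mem j + 1
  time : s'.time ≤ s.time + (Tv L.length B.length + 3 * B.length + 20 * L.length + 26)

theorem surely_site_of_basis {L N B : List E} {mult D : ℕ} {s : PState E} (hs : SiteState L N s)
    (hin : s.inbox 0 = .num mult :: .num D :: B.map .con) (hout : s.outbox 0 = [])
    (hW : 2 * L.length + B.length + 3 < 2 ^ env.wordLen) (hmult : mult < 2 ^ env.wordLen)
    (hD : D < 2 ^ env.wordLen) :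
    Surely (exec env siteProgram s)
      (fun s' => ∃ N', Reported env.prob env.Tv env.wordLen L B N' mult s s') := by
  have hlen : (s.inbox 0).length = B.length + 2 := by simp [hin]
  rw [exec_siteProgram env hs.reg19 (by omega), if_pos (by omega), exec_seq, surely_bind]
  refine (surely_prepareSample env hs.siteStart (by simp [siteStart])
    (by simp [siteStart, hlen]) hin (by omega) hmult hD).mono fun s2 h2 => ?_
  rw [exec_seq, surely_bind]
  refine (surely_sample env (by omega) h2.reg5 h2.reg6 h2.reg16 h2.reg14 h2.reg10 h2.holds).mono
    fun s3 h3 => ?_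
  have h319 : s3.reg 19 = 0 := by rw [h3.reg] <;> simp [h2.reg19]
  refine (surely_sendCounts env h319).mono ?_
  rintro s4 ⟨e1, e2, e3, e4, e5⟩
  obtain ⟨N', hN', h14, h10, hNL⟩ := h3.sample
  have h317 : s3.reg 17 = s2.reg 17 := by rw [h3.reg] <;> simp
  refine ⟨N', ⟨?_, ?_, ?_, ?_, ?_, ?_⟩, ⟨s2.reg 17, h2.reg17_le, h2.reg17_eq, ?_⟩, ?_, ?_, ?_⟩
  · rw [e1, h3.reg] <;> simp [h2.reg5]
  · rw [e1, h319]
  · rw [e1, h14]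
  · exact h3.holds.congr fun j _ => by rw [e3]
  · exact hNL.congr fun j _ => by rw [e3]
  · simpa using hN'
  · rw [e4, h3.outbox, tick_outbox, h2.outbox, h317, h14]
    simp [siteStart, hout]
  · intro j hj hm hlt hv
    rw [e2, h3.mem]
    exact h2.mem_viol j hj hm hlt hv
  · intro j hj hm hlt hv
    rw [e2, h3.mem]
    exact h2.mem_not_viol j hj hm hlt hv
  · have t3 := h3.time
    have t2 := h2.time
    simp only [tick_time, siteStart] at t3 t2 ⊢
    omega

open Classical in
/-- The new weights after the violators of `B` have been multiplied by `mult`. -/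
noncomputable def reweight (P : LPTypeProblem E R) (B : List E) (mult : ℕ) (w : E → ℕ) (X : E) : ℕ :=
  if P.Violates X B.toFinset then w X * mult else w X

/-- Only the sampling loop draws random numbers. What precedes it fixes the weights, and the reply
does not touch the sample, so the product bound for the loop passes to the whole turn. -/
theorem mean_site_le {L N B : List E} {mult D : ℕ} {s : PState E} (hs : SiteState L N s)
    (hin : s.inbox 0 = .num mult :: .num D :: B.map .con)
    (hW : 2 * L.length + B.length + 3 < 2 ^ env.wordLen) (hmult : mult < 2 ^ env.wordLen)
    (hmult0 : 0 < mult) (hD : D < 2 ^ env.wordLen) (w : E → ℕ)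
    (hw : ∀ j (hj : j < L.length), s.mem j + 1 = w L[j])
    (hwW : ∀ X ∈ L, w X * mult < 2 ^ env.wordLen) (h : E → ℝ≥0∞) :
    mean (exec env siteProgram s) (fun s' => ((s'.block L.length (s'.reg 14)).map h).prod) ≤
      (L.map fun X => sampleMean D (reweight env.prob B mult w X) (h X)).prod := by
  have hlen : (s.inbox 0).length = B.length + 2 := by simp [hin]
  rw [exec_siteProgram env hs.reg19 (by omega), if_pos (by omega), exec_seq, mean_bind]
  refine mean_le_of_surely ((surely_prepareSample env hs.siteStart (by simp [siteStart])
    (by simp [siteStart, hlen]) hin (by omega) hmult hD).mono fun s2 h2 => ?_)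
  rw [exec_seq, mean_bind]
  have key := mean_sample_le env (by omega) h2.reg5 h2.reg6 h2.reg16 h2.reg14 h2.reg10 h2.holds
    (by rwa [h2.reg8]) (reweight env.prob B mult w) ?_ ?_ h
  · rw [h2.reg8] at key
    refine le_trans (mean_mono_of_surely ((surely_sample env (by omega) h2.reg5 h2.reg6 h2.reg16
      h2.reg14 h2.reg10 h2.holds).mono fun s3 h3 => ?_)) key
    have h319 : s3.reg 19 = 0 := by rw [h3.reg] <;> simp [h2.reg19]
    refine mean_le_of_surely ((surely_sendCounts env h319).mono ?_)
    rintro s4 ⟨e1, e2, e3, e4, e5⟩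
    rw [PState.block, PState.block, e1, e3]
  · intro j hj
    have hlt : (s.mem j + 1) * mult < 2 ^ env.wordLen := by
      rw [hw j hj]; exact hwW _ (List.getElem_mem hj)
    rw [reweight]
    split_ifs with hv
    · rw [h2.mem_viol j hj hmult0 hlt hv, ← hw j hj]; rfl
    · rw [h2.mem_not_viol j hj hmult0 hlt hv, ← hw j hj]; rfl
  · intro X hX
    rw [reweight]
    split_ifs
    · exact hwW X hX
    · exact (Nat.le_mul_of_pos_right _ hmult0).trans_lt (hwW X hX)

/-- The outcome of a turn of a site that has been asked to send its sample. -/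
theorem surely_site_of_nil {L N : List E} {s : PState E} (hs : SiteState L N s)
    (hin : s.inbox 0 = []) (hout : s.outbox 0 = []) (hW : 2 * L.length + 2 < 2 ^ env.wordLen) :
    Surely (exec env siteProgram s) (fun s' => SiteState L N s' ∧ s'.mem = s.mem ∧
      s'.outbox 0 = N.map .con ∧ s'.time ≤ s.time + (3 * L.length + 6)) := by
  have hN := hs.sublist.length_le
  rw [exec_siteProgram env hs.reg19 (by rw [hin, List.length_nil]; omega), if_neg (by simp [hin]), sendSample,
    exec_seq, exec, PMF.pure_bind, exec_sendCons env (by simp) (by simp) N]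
  · rw [surely_pure]
    refine ⟨⟨?_, ?_, ?_, hs.holds, hs.holds_sample, hs.sublist⟩, rfl, ?_, ?_⟩
    · simp [PState.setReg, siteStart, hs.reg5]
    · simp [PState.setReg, siteStart, hs.reg19]
    · simp [PState.setReg, siteStart, hs.reg14]
    · simp [PState.setReg, siteStart, hs.reg19, hout, PState.tick]
    · simp [siteStart]; omega
  · simp [PState.setReg, siteStart]
  · simp [PState.setReg, siteStart, hs.reg14]
  · simp only [PState.setReg, siteStart, hs.reg5, hs.reg19, ArithOp.apply, tick_reg,
      Function.update_self, ne_eq, Nat.reduceEqDiff, not_false_eq_true, Function.update_of_ne,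
      add_zero, Nat.mod_eq_of_lt (by omega : L.length < 2 ^ env.wordLen)]
    exact hs.holds_sample
  · simp [PState.setReg, siteStart, hs.reg5, hs.reg19, ArithOp.apply,
      Nat.mod_eq_of_lt (by omega : L.length < 2 ^ env.wordLen)]
    omega

end Site

/-! ### The program of the coordinator -/

section Coord

open PState

/-- Send the multiplier `reg 14`, the threshold `reg 11` and the basis to site `reg 16`. -/
def broadcastBody : Prog :=
  .seq (.sendNum 14 16) <| .seq (.sendNum 11 16) <| .seq (.const 17 0) <|
  .seq (sendCons 13 17 16 6) (.arith .add 16 16 6)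

/-- Start a new iteration. -/
def broadcast : Prog :=
  .seq (.arith .div 11 10 8) <| .seq (.const 5 1) <| .seq (.const 16 0) (.loop 1 broadcastBody)

/-- Compute the multiplier `reg 7`, the scale `reg 8` of the samples, the largest size `reg 9` of a
sample, the bound `reg 10` on the total weight and the number `reg 12` of iterations. -/
def initCoord (c : ℕ) : Prog :=
  .seq (.const 6 1) <| .seq (.size 20 0) <| .seq (.arith .div 21 20 2) <| .seq (.const 22 3) <|
  .seq (.arith .add 21 21 22) <| .seq (.const 7 1) <| .seq (.const 22 2) <|
  .seq (.loop 21 (.arith .mul 7 7 22)) <|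
  .seq (.const 8 c) <| .seq (.arith .mul 8 8 4) <| .seq (.arith .mul 8 8 7) <|
  .seq (.arith .mul 8 8 3) <| .seq (.arith .mul 8 8 20) <| .seq (.const 22 4) <|
  .seq (.arith .mul 9 8 22) <| .seq (.arith .add 10 0 15) <| .seq (.arith .mul 12 3 2)
  (.const 14 1)

/-- Add the numbers of violators and the sizes of the samples that site `reg 16` reports. -/
def countBody : Prog :=
  .seq (.recvNum 20 16) <| .seq (.arith .add 18 18 20) <| .seq (.recvNum 20 16) <|
  .seq (.arith .add 19 19 20) (.arith .add 16 16 6)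

/-- Stop with the last basis if nothing violates it, if the samples are too large, or if the last
iteration is over; otherwise ask for the samples. -/
def decideStop : Prog :=
  .seq (.const 16 0) <| .seq (.const 18 0) <| .seq (.const 19 0) <| .seq (.loop 1 countBody) <|
  .ifLt 15 18
    (.ifLt 9 19 (.output 15 13)
      (.ifLt 15 12 (.seq (.arith .sub 12 12 6) (.const 5 2)) (.output 15 13)))
    (.output 15 13)

/-- Read the sample of site `reg 16`. -/
def gatherBody : Prog :=
  .seq (.recvLen 20 16) <| .seq (recvCons 20 17 16 6) (.arith .add 16 16 6)

/-- Compute a basis of the samples. -/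
def newBasis : Prog :=
  .seq (.const 16 0) <| .seq (.const 17 0) <| .seq (.loop 1 gatherBody) <|
  .seq (.basis 15 17 15 13) <| .seq (.arith .add 14 7 15) <| .seq (.arith .div 20 10 3)
  (.arith .add 10 10 20)

/-- Register 5 holds the phase: 0 at the very start, 1 while counts are awaited, 2 while samples are
awaited. Registers 15 and 6 hold the constants 0 and 1; the latter is not consulted before it has
been set. -/
def coordProgram (c : ℕ) : Prog :=
  .ifLt 15 5 (.ifLt 6 5 (.seq newBasis broadcast) decideStop) (.seq (initCoord c) broadcast)

variable {E : Type u} {R : Type v} [DecidableEq E] [LinearOrder R] (env : Env E R)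

/-- What the coordinator remembers between two rounds: the number `k` of sites, the combinatorial
dimension `ν`, the multiplier `m`, the scale `K` of the samples, the bound `w` on the total weight,
the number `rem` of iterations to come, and the last basis `B`. -/
structure CoordState (k ν m K w rem : ℕ) (B : List E) (s : PState E) : Prop where
  reg1 : s.reg 1 = k
  reg3 : s.reg 3 = ν
  reg6 : s.reg 6 = 1
  reg7 : s.reg 7 = m
  reg8 : s.reg 8 = K
  reg9 : s.reg 9 = K * 4
  reg10 : s.reg 10 = w
  reg12 : s.reg 12 = rem
  reg13 : s.reg 13 = B.length
  reg15 : s.reg 15 = 0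
  holds : s.Holds 0 B
  out : s.out = none

omit [DecidableEq E] in
theorem CoordState.congr {k ν m K w rem : ℕ} {B : List E} {s s' : PState E}
    (h : CoordState k ν m K w rem B s)
    (hreg : ∀ x, x ≠ 5 → x ≠ 11 → x ≠ 14 → x ≠ 16 → x ≠ 17 → x ≠ 18 → x ≠ 19 → x ≠ 20 →
      s'.reg x = s.reg x)
    (hcmem : s'.cmem = s.cmem) (hout : s'.out = s.out) : CoordState k ν m K w rem B s' := by
  refine ⟨?_, ?_, ?_, ?_, ?_, ?_, ?_, ?_, ?_, ?_, h.holds.congr fun j _ => by rw [hcmem],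
    hout.trans h.out⟩
  all_goals
    rw [hreg] <;> simp [h.reg1, h.reg3, h.reg6, h.reg7, h.reg8, h.reg9, h.reg10, h.reg12, h.reg13,
      h.reg15]

/-- The coordinator's message at the start of an iteration. -/
def basisMsg (mult D : ℕ) (B : List E) : Msg E := .num mult :: .num D :: B.map .con

structure BroadcastInv (mult D : ℕ) (B : List E) (s : PState E) (j : ℕ) (s' : PState E) : Prop where
  reg : ∀ x, x ≠ 16 → x ≠ 17 → s'.reg x = s.reg x
  reg16 : s'.reg 16 = j
  cmem : s'.cmem = s.cmem
  out : s'.out = s.out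
  time : s'.time = s.time + (3 * B.length + 6) * j
  outbox_lt : ∀ i < j, s'.outbox i = basisMsg mult D B
  outbox_ge : ∀ i, j ≤ i → s'.outbox i = []

theorem surely_broadcastBody {k mult D : ℕ} {B : List E} {s s' : PState E} {j : ℕ}
    (h6 : s.reg 6 = 1) (h14 : s.reg 14 = mult) (h11 : s.reg 11 = D) (h13 : s.reg 13 = B.length)
    (hB : s.Holds 0 B) (hj : j < k) (hk : k < 2 ^ env.wordLen) (hBW : B.length < 2 ^ env.wordLen)
    (h : BroadcastInv mult D B s j s') :
    Surely (exec env broadcastBody (s'.tick 1)) (BroadcastInv mult D B s (j + 1)) := by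
  have e6 : s'.reg 6 = 1 := by rw [h.reg] <;> simp [h6]
  have e14 : s'.reg 14 = mult := by rw [h.reg] <;> simp [h14]
  have e11 : s'.reg 11 = D := by rw [h.reg] <;> simp [h11]
  have e13 : s'.reg 13 = B.length := by rw [h.reg] <;> simp [h13]
  have hB' : s'.Holds 0 B := hB.congr fun i _ => by rw [h.cmem]
  have hjbox := h.outbox_ge j le_rfl
  let s1 : PState E := { s' with
    reg := Function.update s'.reg 17 0
    outbox := Function.update s'.outbox j [.num mult, .num D]
    time := s'.time + 4 }
  have e1 : exec env broadcastBody (s'.tick 1) =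
      exec env (.seq (sendCons 13 17 16 6) (.arith .add 16 16 6)) s1 := by
    rw [broadcastBody, exec_seq, exec, PMF.pure_bind, exec_seq, exec, PMF.pure_bind, exec_seq, exec,
      PMF.pure_bind]
    simp [PState.tick, PState.post, PState.setReg, s1, e14, e11, h.reg16, hjbox]
  rw [e1, exec_seq, exec_sendCons env (by simp) (by simp) B]
  · simp only [exec, PMF.pure_bind, surely_pure]
    refine ⟨?_, ?_, h.cmem, h.out, ?_, ?_, ?_⟩
    · intro x h1 h2
      simp [PState.setReg_reg_apply, s1, h1, h2, h.reg x h1 h2]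
    · simp [PState.setReg_reg_apply, s1, h.reg16, e6, ArithOp.apply,
        Nat.mod_eq_of_lt (by omega : j + 1 < 2 ^ env.wordLen)]
    · simp [s1, h.time]; ring
    · intro i hi
      rcases Nat.lt_succ_iff_lt_or_eq.1 hi with hi | rfl
      · simp [s1, h.reg16, hi.ne, h.outbox_lt i hi]
      · simp [s1, h.reg16, basisMsg]
    · intro i hi
      simp [s1, h.reg16, show i ≠ j by omega, h.outbox_ge i (by omega)]
  · simp [s1, e6]
  · simp [s1, e13]
  · simp only [s1, Function.update_self]
    exact hB'
  · simpa [s1] using hBW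

theorem surely_broadcast {k ν m K w rem mult : ℕ} {B : List E} {s : PState E}
    (hs : CoordState k ν m K w rem B s) (h14 : s.reg 14 = mult) (hout : ∀ j, s.outbox j = [])
    (hW : 1 < 2 ^ env.wordLen)
    (hk : k < 2 ^ env.wordLen) (hBW : B.length < 2 ^ env.wordLen) (hw : w < 2 ^ env.wordLen) :
    Surely (exec env broadcast s) (fun s' => CoordState k ν m K w rem B s' ∧ s'.reg 5 = 1 ∧
      (∀ j < k, s'.outbox j = basisMsg mult (w / K) B) ∧
      s'.time ≤ s.time + ((3 * B.length + 6) * k + 4)) := by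
  have hD : w / K < 2 ^ env.wordLen := (Nat.div_le_self _ _).trans_lt hw
  have h1 : 1 % 2 ^ env.wordLen = 1 := Nat.mod_eq_of_lt hW
  let s1 : PState E := { s with
    reg := Function.update (Function.update (Function.update s.reg 11 (w / K)) 5 1) 16 0
    time := s.time + 4 }
  have e1 : exec env broadcast s = iterPMF (fun s' => exec env broadcastBody (s'.tick 1)) k s1 := by
    rw [broadcast, exec_seq, exec, PMF.pure_bind, exec_seq, exec, PMF.pure_bind, exec_seq, exec,
      PMF.pure_bind, exec_loop]
    simp [PState.tick, PState.setReg, s1, hs.reg1, hs.reg10, hs.reg8, ArithOp.apply,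
      Nat.mod_eq_of_lt hD, h1]
  rw [e1]
  refine (surely_iterPMF (BroadcastInv mult (w / K) B s1) (fun j hj s' h =>
    surely_broadcastBody env (by simp [s1, hs.reg6]) (by simp [s1, h14]) (by simp [s1])
      (by simp [s1, hs.reg13]) hs.holds hj hk hBW h) ?_).mono fun s' h => ?_
  · exact ⟨fun _ _ _ => rfl, by simp [s1], rfl, rfl, by simp, by simp, fun i _ => hout i⟩
  · refine ⟨hs.congr ?_ h.cmem h.out, ?_, h.outbox_lt, ?_⟩
    · intro x h1 h2 h3 h4 h5 _ _ _
      rw [h.reg x h4 h5]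
      simp [s1, h1, h2, h4]
    · rw [h.reg] <;> simp [s1]
    · rw [h.time]; simp [s1]; omega

structure CountInv (x y : ℕ → ℕ) (s : PState E) (j : ℕ) (s' : PState E) : Prop where
  reg : ∀ z, z ≠ 16 → z ≠ 18 → z ≠ 19 → z ≠ 20 → s'.reg z = s.reg z
  reg16 : s'.reg 16 = j
  reg18 : s'.reg 18 = ∑ i ∈ Finset.range j, x i
  reg19 : s'.reg 19 = ∑ i ∈ Finset.range j, y i
  cmem : s'.cmem = s.cmem
  out : s'.out = s.out
  outbox : s'.outbox = s.outbox
  inbox : ∀ i, j ≤ i → s'.inbox i = s.inbox i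
  time : s'.time = s.time + 6 * j

theorem surely_countBody {k : ℕ} {x y : ℕ → ℕ} {s s' : PState E} {j : ℕ}
    (h6 : s.reg 6 = 1) (hin : ∀ i < k, s.inbox i = [.num (x i), .num (y i)])
    (hj : j < k) (hk : k < 2 ^ env.wordLen) (hx : ∑ i ∈ Finset.range k, x i < 2 ^ env.wordLen)
    (hy : ∑ i ∈ Finset.range k, y i < 2 ^ env.wordLen) (h : CountInv x y s j s') :
    Surely (exec env countBody (s'.tick 1)) (CountInv x y s (j + 1)) := by
  have e6 : s'.reg 6 = 1 := by rw [h.reg] <;> simp [h6]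
  have ein : s'.inbox j = [.num (x j), .num (y j)] := by rw [h.inbox j le_rfl, hin j hj]
  have hsub : Finset.range (j + 1) ⊆ Finset.range k := Finset.range_mono hj
  have hx1 : ∑ i ∈ Finset.range (j + 1), x i < 2 ^ env.wordLen :=
    (Finset.sum_le_sum_of_subset hsub).trans_lt hx
  have hy1 : ∑ i ∈ Finset.range (j + 1), y i < 2 ^ env.wordLen :=
    (Finset.sum_le_sum_of_subset hsub).trans_lt hy
  have hxj : x j < 2 ^ env.wordLen :=
    (Finset.single_le_sum (fun _ _ => Nat.zero_le _) (Finset.mem_range.2 hj)).trans_lt hx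
  have hyj : y j < 2 ^ env.wordLen :=
    (Finset.single_le_sum (fun _ _ => Nat.zero_le _) (Finset.mem_range.2 hj)).trans_lt hy
  rw [Finset.sum_range_succ] at hx1 hy1
  simp only [countBody, exec, PMF.pure_bind, ArithOp.apply, tick_reg, tick_inbox, h.reg16, ein,
    PState.setReg_reg_apply, Function.update_self, setReg_inbox, List.head?_cons, List.tail_cons,
    Nat.reduceEqDiff, if_false, if_true, e6, surely_pure]
  refine ⟨?_, ?_, ?_, ?_, h.cmem, h.out, h.outbox, ?_, ?_⟩
  · intro z h1 h2 h3 h4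
    simp [PState.setReg_reg_apply, h1, h2, h3, h4, h.reg z h1 h2 h3 h4]
  · simp [PState.setReg_reg_apply, Nat.mod_eq_of_lt (by omega : j + 1 < 2 ^ env.wordLen)]
  · simp [PState.setReg_reg_apply, h.reg18, Finset.sum_range_succ, Nat.mod_eq_of_lt hx1,
      Nat.mod_eq_of_lt hxj]
  · simp [PState.setReg_reg_apply, h.reg19, Finset.sum_range_succ, Nat.mod_eq_of_lt hy1,
      Nat.mod_eq_of_lt hyj]
  · intro i hi
    simp [show i ≠ j by omega, h.inbox i (by omega)]
  · simp [h.time]; ring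

theorem surely_decideStop {k ν m K w rem : ℕ} {B : List E} {x y : ℕ → ℕ} {s : PState E}
    (hs : CoordState k ν m K w rem B s) (hout : ∀ j, s.outbox j = [])
    (hin : ∀ i < k, s.inbox i = [.num (x i), .num (y i)])
    (hW : 2 < 2 ^ env.wordLen) (hk : k < 2 ^ env.wordLen) (hrem : rem < 2 ^ env.wordLen)
    (hx : ∑ i ∈ Finset.range k, x i < 2 ^ env.wordLen)
    (hy : ∑ i ∈ Finset.range k, y i < 2 ^ env.wordLen) :
    Surely (exec env decideStop s) (fun s' => s'.time ≤ s.time + (6 * k + B.length + 9) ∧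
      if 0 < ∑ i ∈ Finset.range k, x i ∧ ∑ i ∈ Finset.range k, y i ≤ K * 4 ∧ 0 < rem then
        CoordState k ν m K w (rem - 1) B s' ∧ s'.reg 5 = 2 ∧ ∀ j, s'.outbox j = []
      else s'.out = some B) := by
  let s1 : PState E := { s with
    reg := Function.update (Function.update (Function.update s.reg 16 0) 18 0) 19 0
    time := s.time + 4 }
  rw [decideStop, exec_seq, exec, PMF.pure_bind, exec_seq, exec, PMF.pure_bind, exec_seq, exec,
      PMF.pure_bind, exec_seq, surely_bind, exec_loop]
  have e1 : ((((((s.setReg env.wordLen 16 0).tick 1).setReg env.wordLen 18 0).tick 1).setReg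
      env.wordLen 19 0).tick 1).tick 1 = s1 := by
    simp [PState.tick, PState.setReg, s1]
  have e2 : ((((((s.setReg env.wordLen 16 0).tick 1).setReg env.wordLen 18 0).tick 1).setReg
      env.wordLen 19 0).tick 1).reg 1 = k := by
    simp [PState.setReg, hs.reg1]
  rw [e1, e2]
  refine (surely_iterPMF (CountInv x y s1) (fun j hj s' h =>
    surely_countBody env (by simp [s1, hs.reg6]) hin hj hk hx hy h) ?_).mono fun s2 h => ?_
  · exact ⟨fun _ _ _ _ _ => rfl, by simp [s1], by simp [s1], by simp [s1], rfl, rfl, rfl,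
      fun _ _ => rfl, by simp⟩
  have h2 : CoordState k ν m K w rem B s2 := by
    refine hs.congr (fun z _ _ _ h1 _ h2 h3 h4 => ?_) h.cmem h.out
    rw [h.reg z h1 h2 h3 h4]
    simp [s1, h1, h2, h3]
  have htime : s2.time = s.time + 4 + 6 * k := h.time
  have hblock : s2.block 0 B.length = B := h2.holds.block
  -- All three reasons for stopping lead to the same output; `t` counts the tests made before it,
  -- which are one, two or three.
  have hhalt : ∀ t, Surely (exec env (.output 15 13) (s2.tick t)) (fun s' =>
      s'.time ≤ s.time + (6 * k + B.length + 5 + t) ∧ s'.out = some B) := by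
    intro t
    simp only [exec, surely_pure, tick_reg, h2.reg15, h2.reg13]
    refine ⟨?_, congrArg some hblock⟩
    simp [htime]; omega
  rw [exec_ifLt, h2.reg15, h.reg18]
  have h19 := h.reg19
  generalize ∑ i ∈ Finset.range k, x i = X at *
  generalize ∑ i ∈ Finset.range k, y i = Y at *
  by_cases c1 : 0 < X
  · rw [if_pos c1, exec_ifLt, tick_reg, h2.reg9, h19]
    by_cases c2 : K * 4 < Y
    · rw [if_pos c2]
      simp only [if_neg (show ¬ (0 < X ∧ Y ≤ K * 4 ∧ 0 < rem) by omega)]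
      exact (hhalt 2).mono fun s' h' => ⟨by omega, h'.2⟩
    · rw [if_neg c2, exec_ifLt, tick_reg, tick_reg, h2.reg15, h2.reg12]
      by_cases c3 : 0 < rem
      · rw [if_pos c3]
        simp only [if_pos (show 0 < X ∧ Y ≤ K * 4 ∧ 0 < rem by omega), exec, PMF.pure_bind, surely_pure, ArithOp.apply, tick_reg, h2.reg12, h2.reg6]
        refine ⟨by simp [htime]; omega, ?_, ?_, ?_⟩
        · refine ⟨?_, ?_, ?_, ?_, ?_, ?_, ?_, ?_, ?_, ?_, h2.holds, h2.out⟩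
          all_goals simp [PState.setReg_reg_apply, h2.reg1, h2.reg3, h2.reg6, h2.reg7, h2.reg8,
            h2.reg9, h2.reg10, h2.reg13, h2.reg15,
            Nat.mod_eq_of_lt (by omega : rem - 1 < 2 ^ env.wordLen)]
        · simp [PState.setReg_reg_apply, Nat.mod_eq_of_lt hW]
        · intro j
          simpa [h.outbox] using hout j
      · rw [if_neg c3]
        simp only [if_neg (show ¬ (0 < X ∧ Y ≤ K * 4 ∧ 0 < rem) by omega)]
        exact (hhalt 3).mono fun s' h' => ⟨by omega, h'.2⟩
  · rw [if_neg c1]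
    simp only [if_neg (show ¬ (0 < X ∧ Y ≤ K * 4 ∧ 0 < rem) by omega)]
    exact (hhalt 1).mono fun s' h' => ⟨by omega, h'.2⟩

structure GatherInv (N : ℕ → List E) (s : PState E) (j : ℕ) (s' : PState E) : Prop where
  reg : ∀ z, z ≠ 16 → z ≠ 17 → z ≠ 20 → s'.reg z = s.reg z
  reg16 : s'.reg 16 = j
  reg17 : s'.reg 17 = ((List.range j).flatMap N).length
  holds : s'.Holds 0 ((List.range j).flatMap N)
  out : s'.out = s.out
  outbox : s'.outbox = s.outbox
  inbox : ∀ i, j ≤ i → s'.inbox i = s.inbox i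
  time : s'.time = s.time + (4 * j + 3 * ((List.range j).flatMap N).length)

omit [DecidableEq E] in
theorem length_flatMap_range_le {N : ℕ → List E} {j k : ℕ} (h : j ≤ k) :
    ((List.range j).flatMap N).length ≤ ((List.range k).flatMap N).length := by
  obtain ⟨l, rfl⟩ := Nat.exists_eq_add_of_le h
  rw [List.range_add, List.flatMap_append, List.length_append]
  exact Nat.le_add_right _ _

theorem surely_gatherBody {k : ℕ} {N : ℕ → List E} {s s' : PState E} {j : ℕ}
    (h6 : s.reg 6 = 1) (hin : ∀ i < k, s.inbox i = (N i).map .con) (hj : j < k)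
    (hk : k < 2 ^ env.wordLen) (hN : ((List.range k).flatMap N).length < 2 ^ env.wordLen)
    (h : GatherInv N s j s') :
    Surely (exec env gatherBody (s'.tick 1)) (GatherInv N s (j + 1)) := by
  have e6 : s'.reg 6 = 1 := by rw [h.reg] <;> simp [h6]
  have ein : s'.inbox j = (N j).map .con := by rw [h.inbox j le_rfl, hin j hj]
  have hsucc : (List.range (j + 1)).flatMap N = (List.range j).flatMap N ++ N j := by
    simp [List.range_succ]
  have hlen := (length_flatMap_range_le (N := N) (Nat.succ_le_of_lt hj)).trans_lt hN
  rw [Nat.succ_eq_add_one, hsucc, List.length_append] at hlen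
  let s1 : PState E := { s' with
    reg := Function.update s'.reg 20 (N j).length
    time := s'.time + 2 }
  have e1 : exec env gatherBody (s'.tick 1) =
      exec env (.seq (recvCons 20 17 16 6) (.arith .add 16 16 6)) s1 := by
    rw [gatherBody, exec_seq, exec, PMF.pure_bind]
    simp [PState.tick, PState.setReg, s1, h.reg16, ein,
      Nat.mod_eq_of_lt (by omega : (N j).length < 2 ^ env.wordLen)]
  rw [e1, exec_seq, exec_recvCons env (by simp) (by simp) (N j) []]
  · simp only [exec, PMF.pure_bind, surely_pure]
    refine ⟨?_, ?_, ?_, ?_, h.out, h.outbox, ?_, ?_⟩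
    · intro x h1 h2 h3
      simp [PState.setReg_reg_apply, s1, h1, h2, h3, h.reg x h1 h2 h3]
    · simp [PState.setReg_reg_apply, s1, h.reg16, e6, ArithOp.apply,
        Nat.mod_eq_of_lt (by omega : j + 1 < 2 ^ env.wordLen)]
    · rw [hsucc]
      simp [PState.setReg_reg_apply, s1, h.reg17]
    · rw [hsucc]
      refine PState.Holds.append (h.holds.congr fun i hi => ?_)
        ((PState.holds_writeBlock s1 _ _).congr fun i hi => ?_)
      · simp [PState.writeBlock, s1, h.reg17] at hi ⊢
        omega
      · simp [PState.writeBlock, s1, h.reg17]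
    · intro i hi
      simp [s1, h.reg16, show i ≠ j by omega, h.inbox i (by omega)]
    · rw [hsucc]; simp [s1, h.time]; ring
  · simp [s1, e6]
  · simp [s1]
  · simp [s1, h.reg16, ein]
  · simpa [s1, h.reg17] using hlen

/-- The samples are concatenated from cell 0 on and then overwritten by their basis. The bound w
advances in step with `totalBound`, whatever the true weights are, and register 14 now holds the
real multiplier in place of the 1 of the first iteration. -/
theorem surely_newBasis {k ν m K w rem : ℕ} {B : List E} {N : ℕ → List E} {s : PState E}
    (hs : CoordState k ν m K w rem B s) (hout : ∀ j, s.outbox j = [])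
    (hin : ∀ i < k, s.inbox i = (N i).map .con)
    (hk : k < 2 ^ env.wordLen) (hN : ((List.range k).flatMap N).length < 2 ^ env.wordLen)
    (hBW : (env.basisOf ((List.range k).flatMap N)).length < 2 ^ env.wordLen)
    (hm : m < 2 ^ env.wordLen) (hw : w + w / ν < 2 ^ env.wordLen) :
    Surely (exec env newBasis s) (fun s' =>
      CoordState k ν m K (w + w / ν) rem (env.basisOf ((List.range k).flatMap N)) s' ∧
      s'.reg 14 = m ∧ (∀ j, s'.outbox j = []) ∧
      s'.time ≤ s.time + (4 * k + 3 * ((List.range k).flatMap N).length +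
        env.Tb ((List.range k).flatMap N).length + 7)) := by
  let s1 : PState E := { s with
    reg := Function.update (Function.update s.reg 16 0) 17 0
    time := s.time + 3 }
  rw [newBasis, exec_seq, exec, PMF.pure_bind, exec_seq, exec, PMF.pure_bind, exec_seq, surely_bind,
    exec_loop]
  have e1 : ((((s.setReg env.wordLen 16 0).tick 1).setReg env.wordLen 17 0).tick 1).tick 1 =
      s1 := by
    simp [PState.tick, PState.setReg, s1]
  have e2 : ((((s.setReg env.wordLen 16 0).tick 1).setReg env.wordLen 17 0).tick 1).reg 1 = k := by
    simp [PState.setReg, hs.reg1]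
  rw [e1, e2]
  refine (surely_iterPMF (GatherInv N s1) (fun j hj s' h =>
    surely_gatherBody env (by simp [s1, hs.reg6]) hin hj hk hN h) ?_).mono fun s2 h => ?_
  · exact ⟨fun _ _ _ _ => rfl, by simp [s1], by simp [s1], by simp [PState.Holds], rfl, rfl,
      fun _ _ => rfl, by simp⟩
  have h15 : s2.reg 15 = 0 := by rw [h.reg] <;> simp [s1, hs.reg15]
  have hblock := h.holds.block
  rw [exec_seq, exec, PMF.pure_bind]
  simp only [h15, h.reg17, hblock]
  simp only [exec, PMF.pure_bind, surely_pure, ArithOp.apply, PState.setReg_reg_apply, tick_reg,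
    Nat.reduceEqDiff, if_false, if_true]
  have hreg : ∀ z, (s2.writeBlock 0 (env.basisOf ((List.range k).flatMap N))).reg z = s2.reg z :=
    fun _ => rfl
  simp only [hreg]
  have hdiv : w / ν % 2 ^ env.wordLen = w / ν := Nat.mod_eq_of_lt ((Nat.le_add_left _ _).trans_lt hw)
  have r10 : s2.reg 10 = w := by rw [h.reg] <;> simp [s1, hs.reg10]
  have r3 : s2.reg 3 = ν := by rw [h.reg] <;> simp [s1, hs.reg3]
  have r7 : s2.reg 7 = m := by rw [h.reg] <;> simp [s1, hs.reg7]
  refine ⟨?_, ?_, ?_, ?_⟩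
  · refine ⟨?_, ?_, ?_, ?_, ?_, ?_, ?_, ?_, ?_, ?_, ?_, ?_⟩
    · simp [PState.setReg_reg_apply, hreg, h.reg, s1, hs.reg1]
    · simp [PState.setReg_reg_apply, hreg, h.reg, s1, hs.reg3]
    · simp [PState.setReg_reg_apply, hreg, h.reg, s1, hs.reg6]
    · simp [PState.setReg_reg_apply, hreg, h.reg, s1, hs.reg7]
    · simp [PState.setReg_reg_apply, hreg, h.reg, s1, hs.reg8]
    · simp [PState.setReg_reg_apply, hreg, h.reg, s1, hs.reg9]
    · simp [PState.setReg_reg_apply, r10, r3, hdiv, Nat.mod_eq_of_lt hw]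
    · simp [PState.setReg_reg_apply, hreg, h.reg, s1, hs.reg12]
    · simp [PState.setReg_reg_apply, Nat.mod_eq_of_lt hBW]
    · simp [PState.setReg_reg_apply, hreg, h15]
    · exact PState.holds_writeBlock s2 _ _
    · exact h.out.trans hs.out
  · simp [r7, h15, Nat.mod_eq_of_lt hm]
  · intro j
    exact (congrFun h.outbox j).trans (hout j)
  · have t := h.time
    simp only [tick_time, setReg_time]
    rw [show (s2.writeBlock 0 (env.basisOf ((List.range k).flatMap N))).time = s2.time from rfl, t]
    simp [s1]
    omega

theorem iter_double (j : ℕ) (s : PState E) (h22 : s.reg 22 = 2)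
    (hW : s.reg 7 * 2 ^ j < 2 ^ env.wordLen) :
    iterPMF (fun s' : PState E => exec env (.arith .mul 7 7 22) (s'.tick 1)) j s =
      PMF.pure { s with
        reg := Function.update s.reg 7 (s.reg 7 * 2 ^ j)
        time := s.time + 2 * j } := by
  induction j generalizing s with
  | zero => simp [iterPMF]
  | succ j ih =>
    have h1 : s.reg 7 * 2 < 2 ^ env.wordLen :=
      lt_of_le_of_lt (Nat.mul_le_mul_left _ (by rw [pow_succ]; have := Nat.two_pow_pos j; omega)) hW
    have hstep : exec env (.arith .mul 7 7 22) (s.tick 1) = PMF.pure { s with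
        reg := Function.update s.reg 7 (s.reg 7 * 2)
        time := s.time + 2 } := by
      simp [exec, PState.tick, PState.setReg, h22, ArithOp.apply, Nat.mod_eq_of_lt h1]
    rw [iterPMF, hstep, PMF.pure_bind, ih]
    · congr 1
      simp only [Function.update_self, Function.update_idem, PState.mk.injEq, true_and]
      exact ⟨by rw [pow_succ', mul_assoc], by ring⟩
    · simp [h22]
    · simpa [pow_succ', mul_assoc] using hW

/-- The factor by which the weights of the violators are multiplied. -/
def multiplier (n r : ℕ) : ℕ := 2 ^ (Nat.size n / r + 3)

/-- The scale of the expected sizes of the samples. -/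
def sampleScale (c n r ν lam : ℕ) : ℕ := c * lam * multiplier n r * ν * Nat.size n

theorem surely_initCoord {c n k r ν lam : ℕ} {s : PState E} (h0 : s.reg 0 = n) (h1 : s.reg 1 = k)
    (h2 : s.reg 2 = r) (h3 : s.reg 3 = ν) (h4 : s.reg 4 = lam) (h13 : s.reg 13 = 0)
    (h15 : s.reg 15 = 0) (hout : s.out = none) (hc : 1 ≤ c) (hlam : 1 ≤ lam) (hν : 1 ≤ ν)
    (hn : 1 ≤ n) (hW : sampleScale c n r ν lam * 4 < 2 ^ env.wordLen)
    (hnW : n < 2 ^ env.wordLen) (hνW : ν * r < 2 ^ env.wordLen) :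
    Surely (exec env (initCoord c) s) (fun s' =>
      CoordState k ν (multiplier n r) (sampleScale c n r ν lam) n (ν * r) [] s' ∧
      s'.reg 14 = 1 ∧ s'.outbox = s.outbox ∧ s'.time ≤ s.time + (2 * Nat.size n + 24)) := by
  have hsz : 1 ≤ Nat.size n := Nat.size_pos.2 hn
  have hm8 : 8 ≤ multiplier n r := by
    rw [multiplier, pow_add]; have := Nat.one_le_two_pow (n := Nat.size n / r); omega
  -- All factors of the scale are at least 1, so the partial products increase, and no intermediate
  -- result overflows if four times the scale fits into a word.
  have hp1 : c ≤ c * lam := Nat.le_mul_of_pos_right _ hlam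
  have hp2 : c * lam ≤ c * lam * multiplier n r := Nat.le_mul_of_pos_right _ (by omega)
  have hp2' : multiplier n r ≤ c * lam * multiplier n r := Nat.le_mul_of_pos_left _ (by omega)
  have hp3 : c * lam * multiplier n r ≤ c * lam * multiplier n r * ν :=
    Nat.le_mul_of_pos_right _ hν
  have hp4 : c * lam * multiplier n r * ν ≤ c * lam * multiplier n r * ν * Nat.size n :=
    Nat.le_mul_of_pos_right _ hsz
  have hszlt : Nat.size n / r + 3 < 2 ^ (Nat.size n / r + 3) := Nat.lt_two_pow_self
  have hszn : Nat.size n ≤ n := Nat.size_le.2 Nat.lt_two_pow_self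
  rw [sampleScale] at hW
  have hm : multiplier n r = 2 ^ (Nat.size n / r + 3) := rfl
  have m1 : 1 % 2 ^ env.wordLen = 1 := Nat.mod_eq_of_lt (by omega)
  have m2 : 2 % 2 ^ env.wordLen = 2 := Nat.mod_eq_of_lt (by omega)
  have m3 : 3 % 2 ^ env.wordLen = 3 := Nat.mod_eq_of_lt (by omega)
  have m4 : 4 % 2 ^ env.wordLen = 4 := Nat.mod_eq_of_lt (by omega)
  have m5 : Nat.size n % 2 ^ env.wordLen = Nat.size n := Nat.mod_eq_of_lt (by omega)
  have m6 : Nat.size n / r % 2 ^ env.wordLen = Nat.size n / r := Nat.mod_eq_of_lt (by omega)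
  have m7 : (Nat.size n / r + 3) % 2 ^ env.wordLen = Nat.size n / r + 3 :=
    Nat.mod_eq_of_lt (by omega)
  let s1 : PState E := { s with
    reg := Function.update (Function.update (Function.update (Function.update (Function.update s.reg
      6 1) 20 (Nat.size n)) 21 (Nat.size n / r + 3)) 7 1) 22 2
    time := s.time + 8 }
  let s2 : PState E := { s with
    reg := Function.update s1.reg 7 (multiplier n r)
    time := s.time + 8 + 2 * (Nat.size n / r + 3) }
  have e1 : exec env (initCoord c) s = exec env (
      .seq (.const 8 c) <| .seq (.arith .mul 8 8 4) <| .seq (.arith .mul 8 8 7) <|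
      .seq (.arith .mul 8 8 3) <| .seq (.arith .mul 8 8 20) <| .seq (.const 22 4) <|
      .seq (.arith .mul 9 8 22) <| .seq (.arith .add 10 0 15) <| .seq (.arith .mul 12 3 2)
      (.const 14 1)) s2 := by
    rw [initCoord]
    iterate 7 rw [exec_seq, exec, PMF.pure_bind]
    rw [exec_seq, exec_loop]
    have e2 : (((((((((((((((s.setReg env.wordLen 6 1).tick 1).setReg env.wordLen 20
        (Nat.size n)).tick 1).setReg env.wordLen 21 (Nat.size n / r)).tick 1).setReg env.wordLen 22
        3).tick 1).setReg env.wordLen 21 (Nat.size n / r + 3)).tick 1).setReg env.wordLen 7 1).tick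
        1).setReg env.wordLen 22 2).tick 1)).tick 1 = s1 := by
      -- Registers 21 and 22 are used twice as scratch space; their earlier values are forgotten.
      have hcomm : ∀ g : ℕ → ℕ, ∀ a b : ℕ, Function.update (Function.update (Function.update
          (Function.update (Function.update g 21 a) 22 3) 21 b) 7 1) 22 2 =
          Function.update (Function.update (Function.update g 21 b) 7 1) 22 2 := by
        intro g a b
        funext x
        simp only [Function.update_apply]
        split_ifs <;> rfl
      simp [PState.setReg, PState.tick, s1, m1, m2, m3, m5, m6, m7, hcomm]
    simp only [tick_reg, PState.setReg_reg_apply, Nat.reduceEqDiff, if_false, if_true, ArithOp.apply,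
      h0, h2, m5, m6, m3, m7]
    rw [e2, iter_double env _ s1 (by simp [s1]) (by simp [s1, ← hm]; omega), PMF.pure_bind]
    simp [s1, s2, hm]
  rw [e1]
  simp only [exec, PMF.pure_bind, surely_pure, PState.setReg_reg_apply, tick_reg, Nat.reduceEqDiff,
    if_false, if_true, ArithOp.apply]
  have r4 : s2.reg 4 = lam := by simp [s2, s1, h4]
  have r7 : s2.reg 7 = multiplier n r := by simp [s2]
  have r3 : s2.reg 3 = ν := by simp [s2, s1, h3]
  have r2 : s2.reg 2 = r := by simp [s2, s1, h2]
  have r20 : s2.reg 20 = Nat.size n := by simp [s2, s1]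
  have r0 : s2.reg 0 = n := by simp [s2, s1, h0]
  have r15 : s2.reg 15 = 0 := by simp [s2, s1, h15]
  have k1 : c % 2 ^ env.wordLen = c := Nat.mod_eq_of_lt (by omega)
  have k2 : c * lam % 2 ^ env.wordLen = c * lam := Nat.mod_eq_of_lt (by omega)
  have k3 : c * lam * multiplier n r % 2 ^ env.wordLen = c * lam * multiplier n r :=
    Nat.mod_eq_of_lt (by omega)
  have k4 : c * lam * multiplier n r * ν % 2 ^ env.wordLen = c * lam * multiplier n r * ν :=
    Nat.mod_eq_of_lt (by omega)
  have k5 : c * lam * multiplier n r * ν * Nat.size n % 2 ^ env.wordLen =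
    c * lam * multiplier n r * ν * Nat.size n := Nat.mod_eq_of_lt (by omega)
  refine ⟨⟨?_, ?_, ?_, ?_, ?_, ?_, ?_, ?_, ?_, ?_, ?_, ?_⟩, ?_, rfl, ?_⟩
  · simp [PState.setReg_reg_apply, s2, s1, h1]
  · simp [PState.setReg_reg_apply, r3]
  · simp [PState.setReg_reg_apply, s2, s1]
  · simp [PState.setReg_reg_apply, r7]
  · simp [PState.setReg_reg_apply, r4, r7, r3, r20, k1, k2, k3, k4, k5, sampleScale]
  · simp [PState.setReg_reg_apply, r4, r7, r3, r20, k1, k2, k3, k4, k5, m4, sampleScale,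
      Nat.mod_eq_of_lt hW]
  · simp [PState.setReg_reg_apply, r0, r15, Nat.mod_eq_of_lt hnW]
  · simp [PState.setReg_reg_apply, r3, r2, Nat.mod_eq_of_lt hνW]
  · simp [PState.setReg_reg_apply, s2, s1, h13]
  · simp [PState.setReg_reg_apply, r15]
  · simp [PState.Holds]
  · exact hout
  · simp [m1]
  · have := Nat.div_le_self (Nat.size n) r
    simp only [tick_time, setReg_time, s2]
    omega

/-! ### The three kinds of turns of the coordinator -/

theorem surely_coord_init {c n k r ν lam : ℕ} (hc : 1 ≤ c) (hlam : 1 ≤ lam) (hν : 1 ≤ ν)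
    (hn : 1 ≤ n) (hW : sampleScale c n r ν lam * 4 < 2 ^ env.wordLen)
    (hnW : n < 2 ^ env.wordLen) (hνW : ν * r < 2 ^ env.wordLen) (hk : k < 2 ^ env.wordLen) :
    Surely (exec env (coordProgram c) (startState [n, k, r, ν, lam] [])) (fun s' =>
      CoordState k ν (multiplier n r) (sampleScale c n r ν lam) n (ν * r) [] s' ∧ s'.reg 5 = 1 ∧
      (∀ j < k, s'.outbox j = basisMsg 1 (n / sampleScale c n r ν lam) []) ∧
      s'.time ≤ 6 * k + 2 * Nat.size n + 30) := by
  rw [coordProgram, exec_ifLt, if_neg (by simp [startState]), exec_seq, surely_bind]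
  refine (surely_initCoord env (n := n) (k := k) (r := r) (ν := ν) (lam := lam) (by simp [startState])
    (by simp [startState]) (by simp [startState]) (by simp [startState]) (by simp [startState])
    (by simp [startState]) (by simp [startState]) (by simp [startState]) hc hlam hν hn hW hnW
    hνW).mono ?_
  rintro s' ⟨h1, h2, h3, h4⟩
  have hpos : 0 < sampleScale c n r ν lam := by
    have := Nat.size_pos.2 hn
    simp only [sampleScale, multiplier]
    positivity
  refine (surely_broadcast env h1 h2 (fun j => by rw [h3]; simp [startState]) (by omega) hk
    (by simp) hnW).mono ?_
  rintro s2 ⟨g1, g2, g3, g4⟩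
  refine ⟨g1, g2, g3, ?_⟩
  simp [startState] at g4 h4 ⊢
  omega

theorem surely_coord_decide {c k ν m K w rem : ℕ} {B : List E} {x y : ℕ → ℕ} {s : PState E}
    (hs : CoordState k ν m K w rem B s) (h5 : s.reg 5 = 1) (hout : ∀ j, s.outbox j = [])
    (hin : ∀ i < k, s.inbox i = [.num (x i), .num (y i)])
    (hW : 2 < 2 ^ env.wordLen) (hk : k < 2 ^ env.wordLen) (hrem : rem < 2 ^ env.wordLen)
    (hx : ∑ i ∈ Finset.range k, x i < 2 ^ env.wordLen)
    (hy : ∑ i ∈ Finset.range k, y i < 2 ^ env.wordLen) :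
    Surely (exec env (coordProgram c) s) (fun s' => s'.time ≤ s.time + (6 * k + B.length + 11) ∧
      if 0 < ∑ i ∈ Finset.range k, x i ∧ ∑ i ∈ Finset.range k, y i ≤ K * 4 ∧ 0 < rem then
        CoordState k ν m K w (rem - 1) B s' ∧ s'.reg 5 = 2 ∧ ∀ j, s'.outbox j = []
      else s'.out = some B) := by
  rw [coordProgram, exec_ifLt, if_pos (by simp [hs.reg15, h5]), exec_ifLt,
    if_neg (by simp [hs.reg6, h5])]
  refine (surely_decideStop env (s := (s.tick 1).tick 1)
    (hs.congr (fun _ _ _ _ _ _ _ _ _ => rfl) rfl rfl) hout hin hW hk hrem hx hy).mono ?_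
  rintro s' ⟨h1, h2⟩
  refine ⟨?_, h2⟩
  simp at h1
  omega

theorem surely_coord_newBasis {c k ν m K w rem : ℕ} {B : List E} {N : ℕ → List E} {s : PState E}
    (hs : CoordState k ν m K w rem B s) (h5 : s.reg 5 = 2) (hout : ∀ j, s.outbox j = [])
    (hin : ∀ i < k, s.inbox i = (N i).map .con) (hW : 1 < 2 ^ env.wordLen)
    (hk : k < 2 ^ env.wordLen) (hN : ((List.range k).flatMap N).length < 2 ^ env.wordLen)
    (hBW : (env.basisOf ((List.range k).flatMap N)).length < 2 ^ env.wordLen)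
    (hm : m < 2 ^ env.wordLen) (hw : w + w / ν < 2 ^ env.wordLen) :
    Surely (exec env (coordProgram c) s) (fun s' =>
      CoordState k ν m K (w + w / ν) rem (env.basisOf ((List.range k).flatMap N)) s' ∧
      s'.reg 5 = 1 ∧
      (∀ j < k, s'.outbox j =
        basisMsg m ((w + w / ν) / K) (env.basisOf ((List.range k).flatMap N))) ∧
      s'.time ≤ s.time + (10 * k + 3 * ((List.range k).flatMap N).length +
        env.Tb ((List.range k).flatMap N).length +
        3 * k * (env.basisOf ((List.range k).flatMap N)).length + 13)) := by
  rw [coordProgram, exec_ifLt, if_pos (by simp [hs.reg15, h5]), exec_ifLt,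
    if_pos (by simp [hs.reg6, h5]), exec_seq, surely_bind]
  refine (surely_newBasis env (s := (s.tick 1).tick 1)
    (hs.congr (fun _ _ _ _ _ _ _ _ _ => rfl) rfl rfl) hout hin hk hN hBW hm hw).mono ?_
  rintro s' ⟨h1, h2, h3, h4⟩
  refine (surely_broadcast env h1 h2 h3 hW hk hBW hw).mono ?_
  rintro s2 ⟨g1, g2, g3, g4⟩
  refine ⟨g1, g2, g3, ?_⟩
  simp only [tick_time] at h4
  have : (3 * (env.basisOf ((List.range k).flatMap N)).length + 6) * k =
      3 * k * (env.basisOf ((List.range k).flatMap N)).length + 6 * k := by ring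
  omega

end Coord

/-! ### Samples as nets -/

section Net

variable {E : Type u} {R : Type v} [DecidableEq E] [LinearOrder R]

namespace LPTypeProblem

theorem f_mem_sat (P : LPTypeProblem E R) {A : Finset E} {X : E} (hX : X ∈ A) : P.f A ∈ P.sat X :=
  Set.mem_iInter₂.1 (P.isLeast_f A).1 X hX

theorem f_le (P : LPTypeProblem E R) {A : Finset E} {x : R} (hx : ∀ X ∈ A, x ∈ P.sat X) :
    P.f A ≤ x :=
  (P.isLeast_f A).2 (Set.mem_iInter₂.2 hx)

/-- Since f(B) is the least point satisfying B, adding X leaves the value unchanged exactly if this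
point satisfies X already. The violators of B thus form the failing set of a single point, which
brings in the VC dimension. -/
theorem violates_iff (P : LPTypeProblem E R) {X : E} {B : Finset E} :
    P.Violates X B ↔ P.f B ∉ P.sat X := by
  refine ⟨fun h hX => h.not_ge (P.f_le fun Y hY => ?_), fun h => ?_⟩
  · rcases Finset.mem_insert.1 hY with rfl | hY
    · exact hX
    · exact P.f_mem_sat hY
  · refine lt_of_le_of_ne (P.mono _ _ (Finset.subset_insert _ _)) fun he => h ?_
    rw [he]
    exact P.f_mem_sat (Finset.mem_insert_self _ _)

/-- A basis of some set of constraints that no constraint violates is a basis of all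
constraints. -/
theorem IsBasis.univ_of_not_violates [Fintype E] {P : LPTypeProblem E R} {A B : Finset E}
    (h : P.IsBasis A B) (hB : ∀ X, ¬ P.Violates X B) : P.IsBasis Finset.univ B :=
  ⟨Finset.subset_univ _, le_antisymm (P.mono _ _ (Finset.subset_univ _))
    (P.f_le fun X _ => not_not.1 fun hX => hB X (P.violates_iff.2 hX)), h.2.2⟩

theorem IsBasis.card_le_combDim [Fintype E] {P : LPTypeProblem E R} {A B : Finset E}
    (h : P.IsBasis A B) : B.card ≤ P.combDim := by
  classical
  exact Finset.le_sup (f := Finset.card) (Finset.mem_filter.2 ⟨Finset.mem_univ _, A, h⟩)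

theorem combDim_le_card [Fintype E] (P : LPTypeProblem E R) : P.combDim ≤ Fintype.card E :=
  Finset.sup_le fun B _ => B.card_le_univ

theorem Shattered.card_le_vcDim [Fintype E] {P : LPTypeProblem E R} {T : Finset E}
    (h : P.Shattered T) : T.card ≤ P.vcDim := by
  classical
  exact Finset.le_sup (f := Finset.card) (Finset.mem_filter.2 ⟨Finset.mem_univ _, h⟩)

/-- A nonempty basis contains an X that the point f(∅) fails, for otherwise its value would not
exceed f(∅). As f({X}) satisfies X, the singleton {X} is shattered. This makes the scale of the
samples positive. -/
theorem one_le_vcDim [Fintype E] (P : LPTypeProblem E R) (h : 1 ≤ P.combDim) : 1 ≤ P.vcDim := by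
  classical
  obtain ⟨B, hB, hcard⟩ := (Finset.lt_sup_iff (a := 0)).1 h
  obtain ⟨A, hAB⟩ := (Finset.mem_filter.1 hB).2
  have hlt : P.f ∅ < P.f B :=
    hAB.2.2 ∅ (Finset.empty_ssubset.2 (Finset.card_pos.1 hcard))
  obtain ⟨X, hX, hne⟩ : ∃ X ∈ B, P.f ∅ ∉ P.sat X := by
    by_contra! hall
    exact hlt.not_ge (P.f_le hall)
  refine (Finset.card_singleton X).symm.le.trans (Shattered.card_le_vcDim fun U hU => ?_)
  rcases Finset.subset_singleton_iff.1 hU with rfl | rfl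
  · exact ⟨P.f ∅, by simpa using hne⟩
  · exact ⟨P.f {X}, by simpa using P.f_mem_sat (Finset.mem_singleton_self X)⟩

open Classical in
/-- The constraints that the point `x` fails. -/
noncomputable def failing [Fintype E] (P : LPTypeProblem E R) (x : R) : Finset E :=
  Finset.univ.filter fun X => x ∉ P.sat X

theorem mem_failing [Fintype E] (P : LPTypeProblem E R) {x : R} {X : E} :
    X ∈ P.failing x ↔ x ∉ P.sat X := by
  classical
  simp [failing]

open Classical in
/-- The sets of constraints that some point fails. -/
noncomputable def failingSets [Fintype E] (P : LPTypeProblem E R) : Finset (Finset E) :=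
  Finset.univ.filter fun V => ∃ x, V = P.failing x

/-- Termwise comparison with the binomial expansion of (n + 1)^d, as C(n,i) ≤ n^i ≤ n^i·C(d,i). -/
theorem _root_.Nat.sum_range_choose_le_pow (n d : ℕ) :
    ∑ i ∈ Finset.range (d + 1), n.choose i ≤ (n + 1) ^ d := by
  rw [add_pow]
  refine Finset.sum_le_sum fun i hi => ?_
  rw [one_pow, mul_one]
  exact (Nat.choose_le_pow n i).trans
    (Nat.le_mul_of_pos_right _ (Nat.choose_pos (Nat.lt_succ_iff.1 (Finset.mem_range.1 hi))))

/-- The Sauer–Shelah lemma for the failing sets; a set that they shatter is also shattered by the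
satisfied sets, through complements. -/
theorem card_failingSets_le [Fintype E] (P : LPTypeProblem E R) :
    P.failingSets.card ≤ (Fintype.card E + 1) ^ P.vcDim := by
  classical
  refine le_trans ?_ (Nat.sum_range_choose_le_pow _ _)
  refine (Finset.card_le_card_shatterer _).trans (Finset.card_shatterer_le_sum_vcDim.trans ?_)
  refine Finset.sum_le_sum_of_subset fun i hi => ?_
  rw [Finset.mem_Iic] at hi
  refine Finset.mem_range.2 (Nat.lt_succ_of_le (hi.trans ?_))
  refine Finset.sup_le fun T hT => Shattered.card_le_vcDim fun U hU => ?_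
  -- A point that fails exactly T \ U within T satisfies exactly U there.
  obtain ⟨V, hV, hTV⟩ := (Finset.mem_shatterer.1 hT) (Finset.sdiff_subset (s := T) (t := U))
  obtain ⟨x, rfl⟩ := (Finset.mem_filter.1 hV).2
  refine ⟨x, fun X hX => ?_⟩
  have := Finset.ext_iff.1 hTV X
  simp only [Finset.mem_inter, Finset.mem_sdiff, hX, true_and, P.mem_failing] at this
  exact not_iff_not.1 this

/-- Every point that satisfies all constraints of the list `L` fails constraints of total weight at
most `b / q` only. -/
def IsNet [Fintype E] (P : LPTypeProblem E R) (w : E → ℕ) (b q : ℕ) (L : List E) : Prop :=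
  ∀ x : R, (∀ X ∈ L, x ∈ P.sat X) → q * ∑ X ∈ P.failing x, w X ≤ b

end LPTypeProblem

/-! ### Exponential bounds for independent samples -/

theorem sampleMean_one (D w : ℕ) : sampleMean D w 1 = 1 := by
  simp only [sampleMean, ite_self, Finset.sum_const, Finset.card_range, nsmul_eq_mul, mul_one]
  exact ENNReal.div_self (by simp) (by simp)

theorem sampleMean_zero_eq_zero {w : ℕ} (hw : 1 ≤ w) : sampleMean 0 w 0 = 0 := by
  simp [sampleMean, show w ≠ 0 by omega]

/-- This is the probability that a constraint of weight w is left out, max(0, 1 − w/(D+1)), and 1 −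
x ≤ e^{−x}. -/
theorem sampleMean_zero_le (D w : ℕ) :
    sampleMean D w 0 ≤ ENNReal.ofReal (Real.exp (-((w : ℝ) / (D + 1)))) := by
  have hsum : (∑ v ∈ Finset.range (D + 1), if v < w then (0 : ℝ≥0∞) else 1) =
      ((D + 1 - w : ℕ) : ℝ≥0∞) := by
    rw [Finset.sum_ite, Finset.sum_const_zero, zero_add, Finset.sum_const, nsmul_eq_mul, mul_one]
    congr 1
    have : (Finset.range (D + 1)).filter (fun v => ¬ v < w) = Finset.Ico w (D + 1) := by
      ext v; simp; omega
    rw [this, Nat.card_Ico]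
  rw [sampleMean, hsum, ← ENNReal.ofReal_natCast, ← ENNReal.ofReal_natCast,
    ← ENNReal.ofReal_div_of_pos (by positivity)]
  refine ENNReal.ofReal_le_ofReal ?_
  by_cases hw : w ≤ D + 1
  · refine le_trans (le_of_eq ?_) (Real.one_sub_le_exp_neg _)
    push_cast [Nat.cast_sub hw]
    field_simp
  · rw [Nat.sub_eq_zero_of_le (by omega)]
    simp [Real.exp_nonneg]

/-- The mean factor is 1 plus the probability of being kept, and 1 + x ≤ e^x. -/
theorem sampleMean_two_le (D w : ℕ) :
    sampleMean D w 2 ≤ ENNReal.ofReal (Real.exp ((w : ℝ) / (D + 1))) := by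
  have hsum : (∑ v ∈ Finset.range (D + 1), if v < w then (2 : ℝ≥0∞) else 1) ≤
      ((D + 1 + w : ℕ) : ℝ≥0∞) := by
    calc (∑ v ∈ Finset.range (D + 1), if v < w then (2 : ℝ≥0∞) else 1)
        = ∑ v ∈ Finset.range (D + 1), (1 + if v < w then (1 : ℝ≥0∞) else 0) :=
          Finset.sum_congr rfl fun v _ => by split_ifs <;> norm_num
      _ = (D + 1 : ℕ) + ((Finset.range (D + 1)).filter (fun v => v < w)).card := by
          rw [Finset.sum_add_distrib, Finset.sum_const, Finset.sum_boole, Finset.card_range,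
            nsmul_eq_mul, mul_one]
      _ ≤ ((D + 1 + w : ℕ) : ℝ≥0∞) := by
          rw [Nat.cast_add (D + 1) w]
          gcongr
          calc _ ≤ (Finset.range w).card := Finset.card_le_card fun v hv => by simp at hv ⊢; omega
            _ = w := Finset.card_range w
  rw [sampleMean]
  refine (ENNReal.div_le_div_right hsum _).trans ?_
  rw [← ENNReal.ofReal_natCast, ← ENNReal.ofReal_natCast,
    ← ENNReal.ofReal_div_of_pos (by positivity)]
  refine ENNReal.ofReal_le_ofReal (le_trans (le_of_eq ?_) (Real.add_one_le_exp _))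
  push_cast
  field_simp
  ring

-- With D = ⌊b/K⌋ the exponent is the weight of V divided by D + 1. If D ≥ 1, then K(D+1) ≤ 2KD ≤ 2b
-- < 2q·w(V), which gives K/(2q). If D = 0, every constraint is kept because its weight is positive,
-- and the nonempty set V cannot be missed.
omit [DecidableEq E] in
theorem prod_sampleMean_zero_le {V : Finset E} {w : E → ℕ} (hw : ∀ X, 1 ≤ w X) {b K q : ℕ}
    (hq : 1 ≤ q) (hV : b < q * ∑ X ∈ V, w X) :
    ∏ X ∈ V, sampleMean (b / K) (w X) 0 ≤ ENNReal.ofReal (Real.exp (-((K : ℝ) / (2 * q)))) := by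
  rcases Nat.eq_zero_or_pos (b / K) with hD | hD
  · obtain ⟨X, hX⟩ : V.Nonempty := by
      rw [Finset.nonempty_iff_ne_empty]
      rintro rfl
      simp at hV
    rw [Finset.prod_eq_zero hX (by rw [hD]; exact sampleMean_zero_eq_zero (hw X))]
    exact bot_le
  · calc ∏ X ∈ V, sampleMean (b / K) (w X) 0
        ≤ ∏ X ∈ V, ENNReal.ofReal (Real.exp (-((w X : ℝ) / ((b / K : ℕ) + 1)))) :=
          Finset.prod_le_prod' fun X _ => sampleMean_zero_le _ _
      _ = ENNReal.ofReal (Real.exp (-((∑ X ∈ V, w X : ℕ) / ((b / K : ℕ) + 1) : ℝ))) := by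
          rw [← ENNReal.ofReal_prod_of_nonneg (fun _ _ => Real.exp_nonneg _), ← Real.exp_sum,
            Finset.sum_neg_distrib, ← Finset.sum_div, Nat.cast_sum]
      _ ≤ _ := by
          refine ENNReal.ofReal_le_ofReal (Real.exp_le_exp.2 (neg_le_neg ?_))
          have h1 : (b / K : ℕ) * K ≤ b := Nat.div_mul_le_self b K
          have h2 : K * ((b / K : ℕ) + 1) ≤ 2 * q * ∑ X ∈ V, w X := by nlinarith
          rw [div_le_div_iff₀ (by positivity) (by positivity)]
          rw [mul_comm _ (2 * (q : ℝ))]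
          exact_mod_cast h2

-- The total weight is at most b < K(⌊b/K⌋+1), so the exponents add up to at most K.
omit [DecidableEq E] in
theorem prod_sampleMean_two_le [Fintype E] {w : E → ℕ} {b K : ℕ} (hK : 1 ≤ K)
    (hw : ∑ X, w X ≤ b) :
    ∏ X, sampleMean (b / K) (w X) 2 ≤ ENNReal.ofReal (Real.exp K) := by
  calc ∏ X, sampleMean (b / K) (w X) 2
      ≤ ∏ X, ENNReal.ofReal (Real.exp ((w X : ℝ) / ((b / K : ℕ) + 1))) :=
        Finset.prod_le_prod' fun X _ => sampleMean_two_le _ _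
    _ = ENNReal.ofReal (Real.exp ((∑ X, w X : ℕ) / ((b / K : ℕ) + 1) : ℝ)) := by
        rw [← ENNReal.ofReal_prod_of_nonneg (fun _ _ => Real.exp_nonneg _), ← Real.exp_sum,
          ← Finset.sum_div, Nat.cast_sum]
    _ ≤ _ := by
        refine ENNReal.ofReal_le_ofReal (Real.exp_le_exp.2 ?_)
        rw [div_le_iff₀ (by positivity)]
        have h1 : b < K * (b / K + 1) := by
          rw [mul_comm]; exact Nat.lt_mul_of_div_lt (Nat.lt_succ_self _) hK
        exact_mod_cast (hw.trans h1.le)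

/-- The hypothesis `hN` is all that is used about the sampling. With h = 0 on V and 1 elsewhere, a
heavy set V is missed with probability at most e^{−K/(2q)} = e^{−(c+1)λs}; there are at most 2^{λs}
failing sets, and the union bound leaves e^{−cλs}. With h = 2, Markov's inequality for 2^{|N|}
bounds the probability of more than 4K members by e^K/2^{4K}. -/
theorem prob_sample_bad_le [Fintype E] {σ : Type*} (P : LPTypeProblem E R) (μ : PMF σ)
    (N : σ → List E) {w : E → ℕ} (hw : ∀ X, 1 ≤ w X) {b c q s : ℕ} (hq : 1 ≤ q)
    (hlam : 1 ≤ P.vcDim) (hb : ∑ X, w X ≤ b) (hs : Fintype.card E < 2 ^ s) (hs1 : 1 ≤ s)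
    (hN : ∀ h : E → ℝ≥0∞, mean μ (fun a => ((N a).map h).prod) ≤
      ∏ X, sampleMean (b / ((2 * c + 2) * P.vcDim * q * s)) (w X) (h X)) :
    prob μ (fun a => ¬ (P.IsNet w b q (N a) ∧
      (N a).length ≤ (2 * c + 2) * P.vcDim * q * s * 4)) ≤
      ENNReal.ofReal (2 * Real.exp (-(c * s : ℝ))) := by
  classical
  set K := (2 * c + 2) * P.vcDim * q * s with hKdef
  have hK : 1 ≤ K := by
    have : 0 < (2 * c + 2) * P.vcDim * q * s := by positivity
    omega
  let 𝒱 : Finset (Finset E) := P.failingSets.filter fun V => b < q * ∑ X ∈ V, w X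
  have hlen : prob μ (fun a => K * 4 < (N a).length) ≤ ENNReal.ofReal (Real.exp (-(c * s : ℝ))) := by
    have h1 : (2 : ℝ≥0∞) ^ (K * 4) * prob μ (fun a => K * 4 < (N a).length) ≤
        ENNReal.ofReal (Real.exp K) := by
      rw [prob, ← mean_const_mul]
      refine le_trans (mean_mono_of_surely (surely_of_forall fun a => ?_))
        ((hN fun _ => 2).trans (prod_sampleMean_two_le hK hb))
      rw [List.map_const', List.prod_replicate]
      split_ifs with h
      · rw [mul_one]
        exact pow_le_pow_right₀ (by norm_num) h.le
      · simp
    have h2 : (2 : ℝ≥0∞) ^ (K * 4) = ENNReal.ofReal (2 ^ (K * 4)) := by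
      rw [ENNReal.ofReal_pow (by norm_num)]; norm_num
    have hpos : (0 : ℝ) < 2 ^ (K * 4) := by positivity
    rw [mul_comm, ← ENNReal.le_div_iff_mul_le (by simp) (by simp), h2,
      ← ENNReal.ofReal_div_of_pos hpos] at h1
    refine h1.trans (ENNReal.ofReal_le_ofReal ?_)
    rw [div_le_iff₀ hpos]
    -- The factor 4 in the size limit is used here: 4·ln 2 > 2, so e^K/2^{4K} ≤ e^{−K}.
    have h3 : Real.exp (2 * K) ≤ (2 : ℝ) ^ (K * 4) := by
      rw [← Real.exp_log hpos, Real.log_pow]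
      refine Real.exp_le_exp.2 ?_
      have := Real.log_two_gt_d9
      push_cast
      nlinarith [(Nat.cast_nonneg K : (0 : ℝ) ≤ K)]
    have h4 : (c : ℝ) * s ≤ K := by
      have : c * s ≤ K := by
        rw [hKdef]
        refine Nat.mul_le_mul_right _ ?_
        calc c ≤ (2 * c + 2) * 1 * 1 := by omega
          _ ≤ _ := by gcongr
      exact_mod_cast this
    calc Real.exp K = Real.exp (-K) * Real.exp (2 * K) := by rw [← Real.exp_add]; ring_nf
      _ ≤ Real.exp (-(c * s : ℝ)) * 2 ^ (K * 4) := by gcongr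
  have hmiss : ∀ V ∈ 𝒱, prob μ (fun a => ∀ X ∈ N a, X ∉ V) ≤
      ENNReal.ofReal (Real.exp (-((c + 1) * P.vcDim * s : ℝ))) := by
    intro V hV
    have hVw := (Finset.mem_filter.1 hV).2
    -- The factor 2c + 2 in K is there for this: half of it is lost to rounding b/K, and one of the
    -- remaining c + 1 pays for the union bound.
    have h1 : ((K : ℝ) / (2 * q)) = (c + 1) * P.vcDim * s := by
      rw [hKdef]; push_cast; field_simp
    refine le_trans ?_ (h1 ▸ prod_sampleMean_zero_le hw hq hVw)
    refine le_trans ?_ ((hN fun X => if X ∈ V then 0 else 1).trans_eq ?_)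
    · refine mean_mono_of_surely (surely_of_forall fun a => ?_)
      split_ifs with h
      · rw [List.map_congr_left (g := fun _ => 1) (fun X hX => if_neg (h X hX))]
        simp
      · exact bot_le
    · rw [← Finset.prod_subset (Finset.subset_univ V)]
      · exact Finset.prod_congr rfl fun X hX => by rw [if_pos hX]
      · intro X _ hX
        rw [if_neg hX, sampleMean_one]
  have hnet : prob μ (fun a => ¬ P.IsNet w b q (N a)) ≤
      ENNReal.ofReal (Real.exp (-(c * s : ℝ))) := by
    calc prob μ (fun a => ¬ P.IsNet w b q (N a))
        ≤ prob μ (fun a => ∃ V ∈ 𝒱, ∀ X ∈ N a, X ∉ V) := by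
          refine prob_mono_of_surely (surely_of_forall fun a h => ?_)
          simp only [LPTypeProblem.IsNet, not_forall, not_le] at h
          obtain ⟨x, hx, hlt⟩ := h
          refine ⟨P.failing x, Finset.mem_filter.2 ⟨Finset.mem_filter.2
            ⟨Finset.mem_univ _, x, rfl⟩, hlt⟩, fun X hX => ?_⟩
          rw [P.mem_failing, not_not]
          exact hx X hX
      _ ≤ ∑ V ∈ 𝒱, prob μ (fun a => ∀ X ∈ N a, X ∉ V) := prob_exists_le μ 𝒱 _
      _ ≤ 𝒱.card • ENNReal.ofReal (Real.exp (-((c + 1) * P.vcDim * s : ℝ))) :=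
          Finset.sum_le_card_nsmul _ _ _ hmiss
      _ ≤ ENNReal.ofReal (Real.exp (-(c * s : ℝ))) := by
          rw [nsmul_eq_mul, ← ENNReal.ofReal_natCast, ← ENNReal.ofReal_mul (by positivity)]
          refine ENNReal.ofReal_le_ofReal ?_
          have h1 : ((𝒱.card : ℕ) : ℝ) ≤ Real.exp (P.vcDim * s) := by
            have h2 : 𝒱.card ≤ (2 ^ s) ^ P.vcDim :=
              (Finset.card_filter_le _ _).trans (P.card_failingSets_le.trans
                (Nat.pow_le_pow_left hs _))
            calc ((𝒱.card : ℕ) : ℝ) ≤ ((2 : ℝ) ^ s) ^ P.vcDim := by exact_mod_cast h2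
              _ ≤ (Real.exp 1 ^ s) ^ P.vcDim := by
                  gcongr
                  have := Real.add_one_le_exp (1 : ℝ)
                  linarith
              _ = Real.exp (P.vcDim * s) := by
                  rw [← Real.exp_nat_mul, ← Real.exp_nat_mul, mul_one]
          calc _ ≤ Real.exp (P.vcDim * s) * Real.exp (-((c + 1) * P.vcDim * s : ℝ)) := by gcongr
            _ = Real.exp (-(c * s * P.vcDim : ℝ)) := by rw [← Real.exp_add]; ring_nf
            _ ≤ _ := by
              refine Real.exp_le_exp.2 (neg_le_neg (le_mul_of_one_le_right (by positivity) ?_))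
              exact_mod_cast hlam
  calc _ ≤ prob μ (fun a => ¬ P.IsNet w b q (N a) ∨ K * 4 < (N a).length) :=
        prob_mono_of_surely (surely_of_forall fun a h => by
          rwa [not_and_or, not_le] at h)
    _ ≤ _ := prob_or_le _ _ _
    _ ≤ _ := add_le_add hnet hlen
    _ = _ := by rw [← ENNReal.ofReal_add (by positivity) (by positivity), two_mul]

end Net

/-! ### The progress of the weights -/

section Progress

variable {E : Type u} {R : Type v} [DecidableEq E] [LinearOrder R] [Fintype E]

/-- The bound on the total weight after `t` successful iterations. -/
def totalBound (n ν : ℕ) : ℕ → ℕ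
  | 0 => n
  | t + 1 => totalBound n ν t + totalBound n ν t / ν

/-- The point f(B) = f(L) satisfies all of the net L, so the constraints that it fails, the
violators of B, weigh at most b/(mν). Multiplying them by m adds at most b/ν. -/
theorem sum_reweight_le {P : LPTypeProblem E R} {B L : List E} {w : E → ℕ} {b m ν : ℕ}
    (hν : 1 ≤ ν) (hw : ∑ X, w X ≤ b) (hB : P.IsBasis L.toFinset B.toFinset)
    (hL : P.IsNet w b (m * ν) L) : ∑ X, reweight P B m w X ≤ b + b / ν := by
  classical
  have h1 := hL (P.f B.toFinset) fun X hX => by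
    rw [hB.2.1]; exact P.f_mem_sat (List.mem_toFinset.2 hX)
  have h2 : m * ∑ X ∈ P.failing (P.f B.toFinset), w X ≤ b / ν := by
    rw [Nat.le_div_iff_mul_le hν]
    calc _ = m * ν * ∑ X ∈ P.failing (P.f B.toFinset), w X := by ring
      _ ≤ b := h1
  calc ∑ X, reweight P B m w X
      ≤ ∑ X, (w X + if X ∈ P.failing (P.f B.toFinset) then m * w X else 0) := by
        refine Finset.sum_le_sum fun X _ => ?_
        by_cases h : P.f B.toFinset ∈ P.sat X
        · simp [reweight, P.violates_iff, P.mem_failing, h]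
        · simp only [reweight, P.violates_iff, P.mem_failing, h, not_false_eq_true, if_true]
          rw [mul_comm]; omega
    _ = ∑ X, w X + m * ∑ X ∈ P.failing (P.f B.toFinset), w X := by
        rw [Finset.sum_add_distrib, Finset.sum_ite_mem, Finset.univ_inter, Finset.mul_sum]
    _ ≤ b + b / ν := add_le_add hw h2

/-- If no member of O violated B, the point f(B) would satisfy all of O, whence f(B) would be at
least the optimum f(O) and nothing at all could violate B. -/
theorem le_prod_reweight {P : LPTypeProblem E R} {B : List E} {O : Finset E} {w : E → ℕ} {m t : ℕ}
    (hm : 1 ≤ m) (hO : P.IsBasis Finset.univ O) (hw : m ^ t ≤ ∏ X ∈ O, w X)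
    (hV : ∃ X, P.Violates X B.toFinset) : m ^ (t + 1) ≤ ∏ X ∈ O, reweight P B m w X := by
  classical
  obtain ⟨Y, hYO, hY⟩ : ∃ Y ∈ O, P.Violates Y B.toFinset := by
    by_contra! hall
    obtain ⟨X, hX⟩ := hV
    have h1 : P.f Finset.univ ≤ P.f B.toFinset := by
      rw [← hO.2.1]
      exact P.f_le fun Z hZ => not_not.1 fun h => hall Z hZ (P.violates_iff.2 h)
    exact hX.not_ge ((P.mono _ _ (Finset.subset_univ _)).trans h1)
  rw [← Finset.mul_prod_erase _ _ hYO] at hw ⊢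
  have h1 : ∏ X ∈ O.erase Y, w X ≤ ∏ X ∈ O.erase Y, reweight P B m w X :=
    Finset.prod_le_prod' fun X _ => by
      rw [reweight]
      split_ifs
      · exact Nat.le_mul_of_pos_right _ hm
      · exact le_rfl
  calc m ^ (t + 1) = m ^ t * m := pow_succ _ _
    _ ≤ w Y * (∏ X ∈ O.erase Y, w X) * m := Nat.mul_le_mul_right _ hw
    _ = w Y * m * ∏ X ∈ O.erase Y, w X := by ring
    _ ≤ _ := by rw [reweight, if_pos hY]; exact Nat.mul_le_mul_left _ h1

/-- (1 + 1/ν)^t ≤ e^{t/ν} ≤ e^r ≤ 4^r, and rounding down only helps. The base 4 in place of e keeps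
the bound an integer and a power of two. -/
theorem totalBound_le {n ν r t : ℕ} (hν : 1 ≤ ν) (ht : t ≤ ν * r) :
    totalBound n ν t ≤ n * 4 ^ r := by
  have hν0 : (0 : ℝ) < ν := by exact_mod_cast hν
  have h1 : ∀ t, (totalBound n ν t : ℝ) ≤ n * Real.exp (t / ν) := by
    intro t
    induction t with
    | zero => simp [totalBound]
    | succ t ih =>
      rw [totalBound]
      have h2 : ((totalBound n ν t / ν : ℕ) : ℝ) ≤ (totalBound n ν t : ℝ) / ν := Nat.cast_div_le
      have h3 := Real.add_one_le_exp ((1 : ℝ) / ν)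
      calc ((totalBound n ν t + totalBound n ν t / ν : ℕ) : ℝ)
          ≤ totalBound n ν t * (1 / ν + 1) := by
            push_cast
            calc _ ≤ (totalBound n ν t : ℝ) + (totalBound n ν t : ℝ) / ν := by gcongr
              _ = _ := by ring
        _ ≤ (n * Real.exp (t / ν)) * Real.exp (1 / ν) := by gcongr
        _ = n * Real.exp ((t + 1 : ℕ) / ν) := by
            rw [mul_assoc, ← Real.exp_add]; push_cast; ring_nf
  have h2 : (totalBound n ν t : ℝ) ≤ n * 4 ^ r := by
    refine (h1 t).trans ?_
    gcongr
    calc Real.exp (t / ν) ≤ Real.exp r := by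
          refine Real.exp_le_exp.2 ?_
          rw [div_le_iff₀ hν0, mul_comm]
          exact_mod_cast ht
      _ = Real.exp 1 ^ r := by rw [← Real.exp_nat_mul, mul_one]
      _ ≤ 4 ^ r := by
          gcongr
          have := Real.exp_one_lt_d9
          linarith
  exact_mod_cast h2

/-- Of the 3 in the exponent of the multiplier, one makes up for rounding down the quotient by r,
and two absorb the growth 4^r of the total weight. -/
theorem lt_multiplier_pow {n r : ℕ} (hr : 1 ≤ r) : n * 4 ^ r < multiplier n r ^ r := by
  have h1 : Nat.size n < r * (Nat.size n / r + 1) := Nat.lt_mul_div_succ _ hr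
  calc n * 4 ^ r < 2 ^ Nat.size n * 4 ^ r := by
        have := Nat.lt_size_self n
        gcongr
    _ = 2 ^ (Nat.size n + 2 * r) := by rw [pow_add, pow_mul]; norm_num
    _ ≤ 2 ^ ((Nat.size n / r + 3) * r) := by
        refine Nat.pow_le_pow_right (by norm_num) ?_
        nlinarith
    _ = multiplier n r ^ r := by rw [multiplier, ← pow_mul]

-- At most ν factors, each at most the total weight and hence below m^r, cannot have a product as
-- large as m^{νr}.
omit [DecidableEq E] in
theorem false_of_heavy {O : Finset E} {w : E → ℕ} {n ν r : ℕ} (hν : 1 ≤ ν) (hr : 1 ≤ r)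
    (hO : O.card ≤ ν) (hw : ∑ X, w X ≤ totalBound n ν (ν * r))
    (hw1 : 1 ≤ totalBound n ν (ν * r))
    (hprod : multiplier n r ^ (ν * r) ≤ ∏ X ∈ O, w X) : False := by
  have h1 : ∏ X ∈ O, w X ≤ totalBound n ν (ν * r) ^ O.card :=
    Finset.prod_le_pow_card _ _ _ fun X _ =>
      (Finset.single_le_sum (fun _ _ => Nat.zero_le _) (Finset.mem_univ X)).trans hw
  have h2 := (totalBound_le (n := n) hν (le_refl (ν * r))).trans_lt (lt_multiplier_pow hr)
  have h3 : totalBound n ν (ν * r) ^ O.card < (multiplier n r ^ r) ^ ν :=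
    (Nat.pow_le_pow_right hw1 hO).trans_lt (Nat.pow_lt_pow_left h2 (by omega))
  rw [← pow_mul, mul_comm r] at h3
  omega

end Progress

/-! ### Lengths of messages -/

section Bits

variable {E : Type u} {b : ℕ} (enc : E → Fin b → Bool)

theorem length_natCode (x : ℕ) : (natCode x).length = 2 * Nat.size x + 1 := by
  simp [natCode, List.length_flatMap, Nat.size_eq_bits_len, mul_comm]

theorem msgBits_nil : msgBits enc [] = 1 := rfl

theorem msgBits_num (x : ℕ) (l : Msg E) :
    msgBits enc (.num x :: l) = 2 * Nat.size x + 3 + msgBits enc l := by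
  simp [msgBits, msgCode, itemCode, length_natCode]
  ring

theorem msgBits_map_con (L : List E) : msgBits enc (L.map .con) = L.length * (b + 2) + 1 := by
  induction L with
  | nil => simp [msgBits, msgCode]
  | cons X L ih =>
    simp only [msgBits, msgCode, itemCode, List.map_cons, List.flatMap_cons, List.length_append,
      List.length_cons, List.length_ofFn] at ih ⊢
    rw [add_one_mul]
    omega

theorem msgBits_basisMsg (m D : ℕ) (B : List E) :
    msgBits enc (basisMsg m D B) = 2 * Nat.size m + 2 * Nat.size D + B.length * (b + 2) + 7 := by
  rw [basisMsg, msgBits_num, msgBits_num, msgBits_map_con]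
  ring

end Bits

/-! ### Running all sites -/

section Sites

variable {E : Type u} {R : Type v} [DecidableEq E] [LinearOrder R] (env : Env E R)

/-- The state of a site when it begins its turn. -/
def delivered (s : PState E) (l : Msg E) : PState E :=
  { s with
    inbox := fun j => if j = 0 then l else []
    outbox := fun _ => [] }

/-- A turn of a site changes only its own state, so for distinct sites the order is irrelevant and
each turn can be analysed from the state before the round. -/
theorem surely_runSites {k : ℕ} {p : Prog} {sent : Fin k → Msg E} {Q : Fin k → PState E → Prop}
    {l : List (Fin k)} (hl : l.Nodup) {st : Fin k → PState E}
    (h : ∀ i ∈ l, Surely (exec env p (delivered (st i) (sent i))) (Q i)) :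
    Surely (runSites env p sent l st)
      (fun st' => (∀ i ∈ l, Q i (st' i)) ∧ ∀ i ∉ l, st' i = st i) := by
  induction l generalizing st with
  | nil => simp [runSites]
  | cons i l ih =>
    rw [List.nodup_cons] at hl
    rw [runSites, surely_bind]
    refine (h i (by simp)).mono fun s hs => ?_
    refine (ih hl.2 (st := Function.update st i s) fun j hj => ?_).mono fun st' hst' => ⟨?_, ?_⟩
    · rw [Function.update_of_ne (ne_of_mem_of_not_mem hj hl.1)]
      exact h j (by simp [hj])
    · intro j hj
      rcases List.mem_cons.1 hj with rfl | hj
      · rw [hst'.2 _ hl.1, Function.update_self]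
        exact hs
      · exact hst'.1 j hj
    · intro j hj
      rw [List.mem_cons, not_or] at hj
      rw [hst'.2 j hj.2, Function.update_of_ne hj.1]

/-- Independence of the sites: once a site has had its turn its factor is fixed and comes out of the
mean over the remaining ones. -/
theorem mean_runSites_le {k : ℕ} {p : Prog} {sent : Fin k → Msg E} {φ : Fin k → PState E → ℝ≥0∞}
    {v : Fin k → ℝ≥0∞} {l : List (Fin k)} (hl : l.Nodup) {st : Fin k → PState E}
    (h : ∀ i ∈ l, mean (exec env p (delivered (st i) (sent i))) (φ i) ≤ v i) :
    mean (runSites env p sent l st) (fun st' => (l.map fun i => φ i (st' i)).prod) ≤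
      (l.map v).prod := by
  induction l generalizing st with
  | nil => simp [runSites]
  | cons i l ih =>
    rw [List.nodup_cons] at hl
    rw [runSites, mean_bind, List.map_cons, List.prod_cons]
    have hstep : ∀ s, mean (runSites env p sent l (Function.update st i s))
        (fun st' => ((i :: l).map fun i => φ i (st' i)).prod) ≤ (l.map v).prod * φ i s := by
      intro s
      have hih := ih hl.2 (st := Function.update st i s) fun j hj => by
        rw [Function.update_of_ne (ne_of_mem_of_not_mem hj hl.1)]
        exact h j (by simp [hj])
      calc mean (runSites env p sent l (Function.update st i s))
            (fun st' => ((i :: l).map fun i => φ i (st' i)).prod)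
          ≤ mean (runSites env p sent l (Function.update st i s))
            (fun st' => φ i s * (l.map fun i => φ i (st' i)).prod) := by
            refine mean_mono_of_surely ((surely_runSites env (Q := fun _ _ => True) hl.2
              (fun _ _ => surely_of_forall fun _ => trivial)).mono fun st' hst' => ?_)
            rw [List.map_cons, List.prod_cons, hst'.2 i hl.1, Function.update_self]
        _ ≤ (l.map v).prod * φ i s := by
            rw [mean_const_mul, mul_comm]
            exact mul_le_mul_left hih _
    calc _ ≤ mean (exec env p (delivered (st i) (sent i))) (fun s => (l.map v).prod * φ i s) :=
          mean_mono_of_surely (surely_of_forall hstep)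
      _ ≤ v i * (l.map v).prod := by
          rw [mean_const_mul, mul_comm]
          exact mul_le_mul_left (h i (by simp)) _

end Sites

/-! ### Rounds -/

/-- Extend a function on `Fin k` by a default value. -/
def extendFin {α : Type*} {k : ℕ} (d : α) (x : Fin k → α) (j : ℕ) : α :=
  if h : j < k then x ⟨j, h⟩ else d

theorem extendFin_val {α : Type*} {k : ℕ} (d : α) (x : Fin k → α) (i : Fin k) :
    extendFin d x i = x i := by simp [extendFin]

theorem sum_range_extendFin {k : ℕ} (x : Fin k → ℕ) :
    ∑ j ∈ Finset.range k, extendFin 0 x j = ∑ i, x i := by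
  rw [Finset.sum_range]
  exact Finset.sum_congr rfl fun i _ => extendFin_val 0 x i

theorem flatMap_range_extendFin {α : Type*} {k : ℕ} (N : Fin k → List α) :
    (List.range k).flatMap (extendFin [] N) = (List.finRange k).flatMap N := by
  rw [← List.map_coe_finRange_eq_range, List.flatMap_map]
  congr 1
  funext i
  exact extendFin_val [] N i

theorem length_flatMap_finRange {α : Type*} {k : ℕ} (N : Fin k → List α) :
    ((List.finRange k).flatMap N).length = ∑ i, (N i).length := by
  rw [List.length_flatMap, Fin.sum_univ_def]

namespace Env

variable {E : Type u} {R : Type v} [DecidableEq E] [LinearOrder R] [Fintype E]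

/-- The scale of the samples. -/
noncomputable abbrev scale (env : Env E R) (c r : ℕ) : ℕ :=
  sampleScale (2 * c + 2) (Fintype.card E) r env.prob.combDim env.prob.vcDim

/-- The bound on the total weight in iteration `t`. -/
noncomputable abbrev bound (env : Env E R) (t : ℕ) : ℕ :=
  totalBound (Fintype.card E) env.prob.combDim t

/-- The time that suffices for a turn of the coordinator. -/
noncomputable def coordUnit (env : Env E R) (c k r : ℕ) : ℕ :=
  env.Tb (env.scale c r * 4) + 12 * env.scale c r + 13 * k * env.prob.combDim +
    2 * Nat.size (Fintype.card E) + 30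

/-- The time that suffices for a turn of a site with `l` constraints. -/
noncomputable def siteUnit (env : Env E R) (l : ℕ) : ℕ :=
  env.Tv l env.prob.combDim + 3 * env.prob.combDim + 20 * l + 26

/-- The number of bits that suffices for distributing the basis and counting. -/
noncomputable def basisBits (env : Env E R) (k r b : ℕ) : ℕ :=
  k * (8 * Nat.size (Fintype.card E) + 4 * r + env.prob.combDim * (b + 2) + 22)

/-- The number of bits that suffices for collecting the samples. -/
noncomputable def sampleBits (env : Env E R) (c k r b : ℕ) : ℕ :=
  2 * k + env.scale c r * 4 * (b + 2)

end Env

/-- The assumptions on the input of the protocol. -/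
structure Admissible {E : Type u} {R : Type v} [DecidableEq E] [LinearOrder R] [Fintype E]
    (env : Env E R) (c k r : ℕ) (S : Fin k → List E) : Prop where
  one_le_r : 1 ≤ r
  one_le_k : 1 ≤ k
  r_le : r ≤ Nat.size (Fintype.card E)
  one_le_dim : 1 ≤ env.prob.combDim
  nodup : ∀ i, (S i).Nodup
  existsUnique : ∀ X : E, ∃! i, X ∈ S i
  basisOf : ∀ A : List E, (env.basisOf A).Nodup ∧
    env.prob.IsBasis A.toFinset (env.basisOf A).toFinset
  mono_Tb : Monotone env.Tb
  mono_Tv : ∀ t t' s s', t ≤ t' → s ≤ s' → env.Tv t s ≤ env.Tv t' s'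
  word_card : 3 * Fintype.card E + 3 < 2 ^ env.wordLen
  word_k : k < 2 ^ env.wordLen
  word_scale : env.scale c r * 4 < 2 ^ env.wordLen
  word_iter : env.prob.combDim * r < 2 ^ env.wordLen
  word_weight : Fintype.card E * 4 ^ r * multiplier (Fintype.card E) r < 2 ^ env.wordLen

namespace Admissible

variable {E : Type u} {R : Type v} [DecidableEq E] [LinearOrder R] [Fintype E] {env : Env E R}
  {c k r : ℕ} {S : Fin k → List E}

theorem nodup_flatMap (h : Admissible env c k r S) : ((List.finRange k).flatMap S).Nodup := by
  rw [List.nodup_flatMap]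
  refine ⟨fun i _ => h.nodup i, ?_⟩
  refine (List.nodup_finRange k).imp fun {i j} hij => ?_
  exact List.disjoint_left.2 fun X hi hj => hij ((h.existsUnique X).unique hi hj)

theorem toFinset_flatMap (h : Admissible env c k r S) :
    ((List.finRange k).flatMap S).toFinset = Finset.univ := by
  refine Finset.eq_univ_of_forall fun X => ?_
  obtain ⟨i, hi, _⟩ := h.existsUnique X
  exact List.mem_toFinset.2 (List.mem_flatMap.2 ⟨i, List.mem_finRange i, hi⟩)

theorem prod_eq (h : Admissible env c k r S) (g : E → ℝ≥0∞) :
    ((List.finRange k).map fun i => ((S i).map g).prod).prod = ∏ X, g X := by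
  rw [← h.toFinset_flatMap, List.prod_toFinset g h.nodup_flatMap, List.map_flatMap, List.flatMap,
    List.prod_flatten, List.map_map]
  rfl

theorem sum_length (h : Admissible env c k r S) : ∑ i, (S i).length = Fintype.card E := by
  rw [← length_flatMap_finRange, ← List.toFinset_card_of_nodup h.nodup_flatMap, h.toFinset_flatMap,
    Finset.card_univ]

theorem length_le (h : Admissible env c k r S) (i : Fin k) : (S i).length ≤ Fintype.card E :=
  h.sum_length ▸ Finset.single_le_sum (f := fun i => (S i).length) (fun _ _ => Nat.zero_le _)
    (Finset.mem_univ i)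

theorem one_le_card (h : Admissible env c k r S) : 1 ≤ Fintype.card E :=
  h.one_le_dim.trans env.prob.combDim_le_card

theorem one_le_vcDim (h : Admissible env c k r S) : 1 ≤ env.prob.vcDim :=
  env.prob.one_le_vcDim h.one_le_dim

theorem bound_le (h : Admissible env c k r S) {t : ℕ} (ht : t ≤ env.prob.combDim * r) :
    env.bound t ≤ Fintype.card E * 4 ^ r :=
  totalBound_le h.one_le_dim ht

theorem one_le_multiplier (n r : ℕ) : 1 ≤ multiplier n r := Nat.one_le_two_pow

/-- A single weight is multiplied before anything is known about the new total; the additional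
factor m guarantees that this product does not overflow. -/
theorem weight_lt (h : Admissible env c k r S) {t : ℕ} (ht : t ≤ env.prob.combDim * r) :
    env.bound t * multiplier (Fintype.card E) r < 2 ^ env.wordLen :=
  (Nat.mul_le_mul_right _ (h.bound_le ht)).trans_lt h.word_weight

theorem bound_lt (h : Admissible env c k r S) {t : ℕ} (ht : t ≤ env.prob.combDim * r) :
    env.bound t < 2 ^ env.wordLen :=
  (Nat.le_mul_of_pos_right _ (one_le_multiplier _ r)).trans_lt (h.weight_lt ht)

theorem multiplier_lt (h : Admissible env c k r S) :
    multiplier (Fintype.card E) r < 2 ^ env.wordLen := by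
  refine (Nat.le_mul_of_pos_left _ ?_).trans_lt h.word_weight
  have := h.one_le_card
  positivity

theorem size_bound_div_le (h : Admissible env c k r S) {t : ℕ} (ht : t ≤ env.prob.combDim * r)
    (K : ℕ) : Nat.size (env.bound t / K) ≤ Nat.size (Fintype.card E) + 2 * r := by
  rw [Nat.size_le, pow_add, pow_mul]
  refine ((Nat.div_le_self _ _).trans (h.bound_le ht)).trans_lt ?_
  have := Nat.lt_size_self (Fintype.card E)
  norm_num
  gcongr

theorem size_multiplier_le (n r : ℕ) : Nat.size (multiplier n r) ≤ Nat.size n + 4 := by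
  rw [multiplier, Nat.size_pow]
  have := Nat.div_le_self (Nat.size n) r
  omega

end Admissible

section Rounds

variable {E : Type u} {R : Type v} [DecidableEq E] [LinearOrder R] [Fintype E] (env : Env E R)
  {c k r b : ℕ} (enc : E → Fin b → Bool) (S : Fin k → List E)

/-- The resources used in `p` rounds that distribute a basis and `q` rounds that collect the
samples. -/
structure Used (c r p q : ℕ) (cfg : Config E k) : Prop where
  bits : cfg.bits ≤ p * env.basisBits k r b + q * env.sampleBits c k r b
  rounds : cfg.rounds ≤ p + q
  coord : cfg.coord.time ≤ (p + q) * env.coordUnit c k r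
  site : ∀ i, (cfg.site i).time ≤ (p + q) * env.siteUnit (S i).length

/-- The coordinator remembers `B`, which is a basis of some set of constraints, in iteration `t`
with `rem` iterations to come. -/
structure CoordReady (c k r t rem : ℕ) (B : List E) (a : PState E) : Prop where
  state : CoordState k env.prob.combDim (multiplier (Fintype.card E) r) (env.scale c r)
    (env.bound t) rem B a
  basis : ∃ A, env.prob.IsBasis A B.toFinset
  nodup : B.Nodup

/-- In iteration `t`, the sites have received the basis `B`, drawn the samples `N i`, and reported
the numbers of violators and the sizes of the samples. -/
structure Reporting (c r t : ℕ) (B : List E) (N : Fin k → List E) (cfg : Config E k) : Prop where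
  coord : CoordReady env c k r t (env.prob.combDim * r - t) B cfg.coord
  reg5 : cfg.coord.reg 5 = 1
  outbox : ∀ j, cfg.coord.outbox j = []
  le : t ≤ env.prob.combDim * r
  sites : ∀ i, SiteState (S i) (N i) (cfg.site i)
  inbox : ∃ x : Fin k → ℕ, ∀ i, x i ≤ (S i).length ∧
    (x i = 0 ↔ ∀ X ∈ S i, ¬ env.prob.Violates X B.toFinset) ∧
    cfg.coord.inbox i = [.num (x i), .num (N i).length]
  used : Used env (b := b) S c r (t + 1) t cfg

/-- In iteration `t`, the sites have sent their samples `N i`. -/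
structure Collecting (c r t : ℕ) (B : List E) (N : Fin k → List E) (cfg : Config E k) : Prop where
  coord : CoordReady env c k r t (env.prob.combDim * r - t - 1) B cfg.coord
  reg5 : cfg.coord.reg 5 = 2
  outbox : ∀ j, cfg.coord.outbox j = []
  lt : t < env.prob.combDim * r
  sites : ∀ i, SiteState (S i) (N i) (cfg.site i)
  inbox : ∀ i : Fin k, cfg.coord.inbox i = (N i).map .con
  sum_le : ∑ i, (N i).length ≤ env.scale c r * 4
  used : Used env (b := b) S c r (t + 1) (t + 1) cfg

/-- The coordinator has stopped within the resource bounds. -/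
structure Stopped (c r : ℕ) (cfg : Config E k) : Prop where
  out : cfg.coord.out.isSome
  used : Used env (b := b) S c r (env.prob.combDim * r + 1) (env.prob.combDim * r + 1) cfg

/-- The output is a basis of the set of all constraints. -/
def Correct (P : LPTypeProblem E R) (cfg : Config E k) : Prop :=
  ∃ B : List E, cfg.coord.out = some B ∧ P.IsBasis Finset.univ B.toFinset

/-- The weights that the sites remember. -/
def HasWeights (st : Fin k → PState E) (w : E → ℕ) : Prop :=
  ∀ i, ∀ j (hj : j < (S i).length), (st i).mem j + 1 = w (S i)[j]

/-- The weights of iteration `t` are as they should be: their total is small, but the weights of an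
optimal basis `O` are large. -/
structure BalancedWeights (r t : ℕ) (O : Finset E) (w : E → ℕ) : Prop where
  sum_le : ∑ X, w X ≤ env.bound t
  le_prod : multiplier (Fintype.card E) r ^ t ≤ ∏ X ∈ O, w X

/-- The samples are small, and a net for the weights `w`. -/
def GoodSample (c r t : ℕ) (w : E → ℕ) (L : List E) : Prop :=
  env.prob.IsNet w (env.bound t) (multiplier (Fintype.card E) r * env.prob.combDim) L ∧
    L.length ≤ env.scale c r * 4

variable {env S}

theorem HasWeights.one_le (h : Admissible env c k r S) {st : Fin k → PState E} {w : E → ℕ}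
    (hw : HasWeights S st w) (X : E) : 1 ≤ w X := by
  obtain ⟨i, hi, _⟩ := h.existsUnique X
  obtain ⟨j, hj, rfl⟩ := List.getElem_of_mem hi
  rw [← hw i j hj]
  omega

theorem CoordReady.length_le {t rem : ℕ} {B : List E} {a : PState E}
    (h : CoordReady env c k r t rem B a) : B.length ≤ env.prob.combDim := by
  obtain ⟨A, hA⟩ := h.basis
  rw [← List.toFinset_card_of_nodup h.nodup]
  exact hA.card_le_combDim

/-- What a site does when it receives the basis `B`. -/
theorem surely_site_report (h : Admissible env c k r S) {t rem mult : ℕ} {B : List E} {a : PState E}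
    (ha : CoordReady env c k r t rem B a) (ht : t ≤ env.prob.combDim * r)
    (hmult : mult ≤ multiplier (Fintype.card E) r) {i : Fin k} {N : List E} {s : PState E}
    (hs : SiteState (S i) N s) :
    Surely (exec env siteProgram (delivered s (basisMsg mult (env.bound t / env.scale c r) B)))
      (fun s' => ∃ N', Reported env.prob env.Tv env.wordLen (S i) B N' mult s s') := by
  have hB := ha.length_le
  have hn := env.prob.combDim_le_card
  have hl := h.length_le i
  have hW := h.word_card
  exact (surely_site_of_basis env (s := delivered s _) (mult := mult) (N := N)
    ⟨hs.reg5, hs.reg19, hs.reg14, hs.holds, hs.holds_sample, hs.sublist⟩ rfl rfl (by omega)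
    (hmult.trans_lt h.multiplier_lt) ((Nat.div_le_self _ _).trans_lt (h.bound_lt ht))).mono
      fun s' ⟨N', hN'⟩ => ⟨N', hN'.state, hN'.reply, hN'.mem_viol, hN'.mem_not_viol, hN'.time⟩

/-- The configuration after a round in which the coordinator has reached the state `a` and the sites
have reached the states `st`. -/
def nextConfig (cfg : Config E k) (a : PState E) (st : Fin k → PState E) : Config E k where
  coord := { a with
    inbox := fun j => if h : j < k then (st ⟨j, h⟩).outbox 0 else []
    outbox := fun _ => [] }
  site := st
  bits := cfg.bits + ∑ i : Fin k, (msgBits enc (a.outbox i) + msgBits enc ((st i).outbox 0))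
  rounds := cfg.rounds + 1

omit [Fintype E] in
theorem roundStep_eq (π : Protocol) {cfg : Config E k} (h : cfg.coord.out = none) :
    roundStep env π enc cfg = (exec env π.coordProg cfg.coord).bind (fun a =>
      if a.out.isSome then PMF.pure { cfg with coord := a }
      else (runSites env π.siteProg (fun i : Fin k => a.outbox i) (List.finRange k) cfg.site).bind
        (fun st => PMF.pure (nextConfig enc cfg a st))) := by
  rw [roundStep, h]
  rfl

omit [Fintype E] in
theorem roundStep_of_isSome (π : Protocol) {cfg : Config E k} (h : cfg.coord.out.isSome) :
    roundStep env π enc cfg = PMF.pure cfg := by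
  rw [roundStep, if_pos h]

/-- The weights appear only in a conditional second claim, so that the first one, with the resource
bounds, also covers runs on which the weights are out of control. -/
theorem surely_report (h : Admissible env c k r S) {t mult : ℕ} {B : List E} {a : PState E}
    (ha : CoordReady env c k r t (env.prob.combDim * r - t) B a) (ha5 : a.reg 5 = 1)
    (ht : t ≤ env.prob.combDim * r)
    (hout : ∀ j < k, a.outbox j = basisMsg mult (env.bound t / env.scale c r) B)
    (hmult1 : 1 ≤ mult) (hmult : mult ≤ multiplier (Fintype.card E) r)
    {N : Fin k → List E} {cfg : Config E k} (hs : ∀ i, SiteState (S i) (N i) (cfg.site i))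
    (hbits : cfg.bits ≤ t * env.basisBits k r b + t * env.sampleBits c k r b)
    (hrounds : cfg.rounds ≤ t + t) (htime : a.time ≤ (t + 1 + t) * env.coordUnit c k r)
    (htimes : ∀ i, (cfg.site i).time ≤ (t + t) * env.siteUnit (S i).length) :
    Surely (runSites env siteProgram (fun i : Fin k => a.outbox i) (List.finRange k) cfg.site)
      (fun st => (∃ N', Reporting env (b := b) S c r t B N' (nextConfig enc cfg a st)) ∧
        ∀ w, HasWeights S cfg.site w → (∀ X, w X * mult < 2 ^ env.wordLen) →
          HasWeights S st (reweight env.prob B mult w)) := by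
  have hB := ha.length_le
  have hn := env.prob.combDim_le_card
  refine (surely_runSites env (Q := fun i s' => ∃ N', Reported env.prob env.Tv env.wordLen (S i) B N'
    mult (cfg.site i) s') (List.nodup_finRange k) fun i _ => ?_).mono fun st hst => ?_
  · rw [hout i i.2]
    exact surely_site_report h ha ht hmult (hs i)
  replace hst := fun i => hst.1 i (List.mem_finRange i)
  choose N' hN' using hst
  choose x hx using fun i => (hN' i).reply
  refine ⟨⟨N', ⟨⟨?_, ha.basis, ha.nodup⟩, ha5, fun _ => rfl, ht, fun i => (hN' i).state,
    ⟨x, fun i => ⟨(hx i).1, (hx i).2.1, ?_⟩⟩, ?_, ?_, ?_, ?_⟩⟩, ?_⟩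
  · exact ha.state.congr (fun _ _ _ _ _ _ _ _ _ => rfl) rfl rfl
  · simpa [nextConfig] using (hx i).2.2
  -- The constant is 22 = 8 + 7 + 7: twice the 4 surplus digits of the multiplier, the overhead of
  -- the basis message, and that of the reply.
  · have hi : ∀ i : Fin k, msgBits enc (a.outbox i) + msgBits enc ((st i).outbox 0) ≤
        8 * Nat.size (Fintype.card E) + 4 * r + env.prob.combDim * (b + 2) + 22 := by
      intro i
      rw [hout i i.2, (hx i).2.2, msgBits_basisMsg, msgBits_num, msgBits_num, msgBits_nil]
      have e1 := Nat.size_le_size hmult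
      have e2 := Admissible.size_multiplier_le (Fintype.card E) r
      have e3 := h.size_bound_div_le ht (env.scale c r)
      have e4 := Nat.size_le_size ((hx i).1.trans (h.length_le i))
      have e5 := Nat.size_le_size ((hN' i).state.sublist.length_le.trans (h.length_le i))
      have e6 := Nat.mul_le_mul_right (b + 2) hB
      omega
    have hsum := Finset.sum_le_sum (s := Finset.univ) fun i _ => hi i
    rw [Finset.sum_const, Finset.card_univ, Fintype.card_fin, smul_eq_mul, ← Env.basisBits] at hsum
    simp only [nextConfig]
    rw [add_one_mul]
    omega
  · simp only [nextConfig]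
    omega
  · exact htime
  · intro i
    have e1 := (hN' i).time
    have e2 := h.mono_Tv _ _ _ _ (le_refl (S i).length) hB
    have e3 := htimes i
    rw [show t + 1 + t = t + t + 1 by ring, add_one_mul]
    simp only [nextConfig]
    generalize (t + t) * env.siteUnit (S i).length = u at *
    rw [Env.siteUnit]
    omega
  · intro w hw hwW i j hj
    have hlt : ((cfg.site i).mem j + 1) * mult < 2 ^ env.wordLen := by
      rw [hw i j hj]; exact hwW _
    rw [reweight]
    split_ifs with hv
    · rw [(hN' i).mem_viol j hj hmult1 hlt hv, hw i j hj]
    · rw [(hN' i).mem_not_viol j hj hmult1 hlt hv, hw i j hj]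

/-- The sample that a site with `l` constraints remembers. -/
def sampleOf (l : ℕ) (s : PState E) : List E := s.block l (s.reg 14)

omit [DecidableEq E] [Fintype E] in
theorem SiteState.sampleOf_eq {L N : List E} {s : PState E} (h : SiteState L N s) :
    sampleOf L.length s = N := by
  rw [sampleOf, h.reg14]
  exact h.holds_sample.block

theorem prob_report_bad_le (h : Admissible env c k r S) {t rem mult : ℕ} {B : List E} {a : PState E}
    (ha : CoordReady env c k r t rem B a)
    (ht : t ≤ env.prob.combDim * r)
    (hout : ∀ j < k, a.outbox j = basisMsg mult (env.bound t / env.scale c r) B)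
    (hmult1 : 1 ≤ mult) (hmult : mult ≤ multiplier (Fintype.card E) r)
    {N : Fin k → List E} {st : Fin k → PState E} (hs : ∀ i, SiteState (S i) (N i) (st i))
    {w : E → ℕ} (hw : HasWeights S st w) (hwW : ∀ X, w X * mult < 2 ^ env.wordLen)
    (hsum : ∑ X, reweight env.prob B mult w X ≤ env.bound t) :
    prob (runSites env siteProgram (fun i : Fin k => a.outbox i) (List.finRange k) st)
      (fun st' => ¬ GoodSample env c r t (reweight env.prob B mult w)
        ((List.finRange k).flatMap fun i => sampleOf (S i).length (st' i))) ≤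
      ENNReal.ofReal (2 * Real.exp (-(c * Nat.size (Fintype.card E) : ℝ))) := by
  have hB := ha.length_le
  have hn := env.prob.combDim_le_card
  -- The scale in the form required by `prob_sample_bad_le`, with q = mν and s the number of binary
  -- digits of n.
  have hscale : env.scale c r = (2 * c + 2) * env.prob.vcDim *
      (multiplier (Fintype.card E) r * env.prob.combDim) * Nat.size (Fintype.card E) := by
    simp only [Env.scale, sampleScale]; ring
  have hw1 : ∀ X, 1 ≤ reweight env.prob B mult w X := fun X => by
    have := hw.one_le h X
    rw [reweight]
    split_ifs
    · exact this.trans (Nat.le_mul_of_pos_right _ hmult1)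
    · exact this
  simp only [GoodSample, hscale]
  refine prob_sample_bad_le env.prob _ _ hw1 ?_ h.one_le_vcDim hsum (Nat.lt_size_self _)
    (Nat.size_pos.2 h.one_le_card) fun g => ?_
  · have := h.one_le_dim
    have := Admissible.one_le_multiplier (Fintype.card E) r
    exact Nat.mul_pos (by omega) (by omega)
  · rw [← hscale, ← h.prod_eq]
    have key := mean_runSites_le env (p := siteProgram) (sent := fun i : Fin k => a.outbox i)
      (st := st) (φ := fun i s' => ((sampleOf (S i).length s').map g).prod)
      (v := fun i => ((S i).map fun X => sampleMean (env.bound t / env.scale c r)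
        (reweight env.prob B mult w X) (g X)).prod) (List.nodup_finRange k) fun i _ => by
      rw [hout i i.2]
      have hl := h.length_le i
      have hW := h.word_card
      exact mean_site_le env (s := delivered (st i) _) (N := N i)
        ⟨(hs i).reg5, (hs i).reg19, (hs i).reg14, (hs i).holds, (hs i).holds_sample,
          (hs i).sublist⟩ rfl (by omega) (hmult.trans_lt h.multiplier_lt) hmult1
        ((Nat.div_le_self _ _).trans_lt (h.bound_lt ht)) w (hw i) (fun X _ => hwW X) g
    refine le_trans (le_of_eq ?_) key
    congr 1
    funext st'
    rw [List.map_flatMap, List.flatMap, List.prod_flatten, List.map_map]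
    rfl

end Rounds

/-! ### Success and failure of an iteration -/

section Iterations

variable {E : Type u} {R : Type v} [DecidableEq E] [LinearOrder R]

theorem surely_roundStep (env : Env E R) (π : Protocol) {k b : ℕ} (enc : E → Fin b → Bool)
    {cfg : Config E k} {A : PState E → Prop} {Q : Config E k → Prop} (h : cfg.coord.out = none)
    (hA : Surely (exec env π.coordProg cfg.coord) A)
    (hhalt : ∀ a, A a → a.out.isSome → Q { cfg with coord := a })
    (hgo : ∀ a, A a → a.out = none →
      Surely (runSites env π.siteProg (fun i : Fin k => a.outbox i) (List.finRange k) cfg.site)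
        (fun st => Q (nextConfig enc cfg a st))) :
    Surely (roundStep env π enc cfg) Q := by
  rw [roundStep_eq enc π h, surely_bind]
  refine hA.mono fun a ha => ?_
  split_ifs with ho
  · exact (surely_pure _ _).2 (hhalt a ha ho)
  · rw [surely_bind]
    exact (hgo a ha (by simpa using ho)).mono fun st hst => (surely_pure _ _).2 hst

theorem prob_roundStep_le (env : Env E R) (π : Protocol) {k b : ℕ} (enc : E → Fin b → Bool)
    {cfg : Config E k} {A : PState E → Prop} {Q : Config E k → Prop} {δ : ℝ≥0∞}
    (h : cfg.coord.out = none) (hA : Surely (exec env π.coordProg cfg.coord) A)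
    (hnone : ∀ a, A a → a.out = none)
    (hgo : ∀ a, A a →
      prob (runSites env π.siteProg (fun i : Fin k => a.outbox i) (List.finRange k) cfg.site)
        (fun st => Q (nextConfig enc cfg a st)) ≤ δ) :
    prob (roundStep env π enc cfg) Q ≤ δ := by
  rw [roundStep_eq enc π h, prob, mean_bind]
  refine mean_le_of_surely (hA.mono fun a ha => ?_)
  rw [if_neg (by simp [hnone a ha]), mean_bind]
  simp only [mean_pure]
  exact hgo a ha

/-- The protocol. -/
def clarkson (c : ℕ) : Protocol := ⟨coordProgram (2 * c + 2), siteProgram⟩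

variable [Fintype E] {env : Env E R} {c k r b : ℕ} {enc : E → Fin b → Bool} {S : Fin k → List E}
  {O : Finset E}

/-- The protocol is on its way in iteration `t`, and the samples are going to be collected. -/
def GoodReporting (env : Env E R) (b : ℕ) (S : Fin k → List E) (O : Finset E) (c r t : ℕ)
    (cfg : Config E k) : Prop :=
  ∃ B N, Reporting env (b := b) S c r t B N cfg ∧ ((∀ X, ¬ env.prob.Violates X B.toFinset) ∨
    ∃ w, HasWeights S cfg.site w ∧ BalancedWeights env r t O w ∧
      GoodSample env c r t w ((List.finRange k).flatMap N))

/-- The protocol is on its way in iteration `t`, and the samples have been collected. -/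
def GoodCollecting (env : Env E R) (b : ℕ) (S : Fin k → List E) (O : Finset E) (c r t : ℕ)
    (cfg : Config E k) : Prop :=
  ∃ B N, Collecting env (b := b) S c r t B N cfg ∧
    ∃ w, HasWeights S cfg.site w ∧ BalancedWeights env r t O w ∧
      GoodSample env c r t w ((List.finRange k).flatMap N)

/-- The failure probability of an iteration. -/
noncomputable def failureBound (E : Type u) [Fintype E] (c : ℕ) : ℝ≥0∞ :=
  ENNReal.ofReal (2 * Real.exp (-(c * Nat.size (Fintype.card E) : ℝ)))

/-- If nothing violates B, the outcome is good whatever the samples are; only in the other case does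
success depend on the draw. -/
theorem prob_not_goodReporting_le (h : Admissible env c k r S) {t mult : ℕ} {B : List E}
    {a : PState E}
    (ha : CoordReady env c k r t (env.prob.combDim * r - t) B a) (ha5 : a.reg 5 = 1)
    (ht : t ≤ env.prob.combDim * r)
    (hout : ∀ j < k, a.outbox j = basisMsg mult (env.bound t / env.scale c r) B)
    (hmult1 : 1 ≤ mult) (hmult : mult ≤ multiplier (Fintype.card E) r)
    {N : Fin k → List E} {cfg : Config E k} (hs : ∀ i, SiteState (S i) (N i) (cfg.site i))
    (hbits : cfg.bits ≤ t * env.basisBits k r b + t * env.sampleBits c k r b)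
    (hrounds : cfg.rounds ≤ t + t) (htime : a.time ≤ (t + 1 + t) * env.coordUnit c k r)
    (htimes : ∀ i, (cfg.site i).time ≤ (t + t) * env.siteUnit (S i).length)
    {w : E → ℕ} (hw : HasWeights S cfg.site w) (hwW : ∀ X, w X * mult < 2 ^ env.wordLen)
    (hsum : ∑ X, reweight env.prob B mult w X ≤ env.bound t)
    (hprod : (∀ X, ¬ env.prob.Violates X B.toFinset) ∨
      multiplier (Fintype.card E) r ^ t ≤ ∏ X ∈ O, reweight env.prob B mult w X) :
    prob (runSites env siteProgram (fun i : Fin k => a.outbox i) (List.finRange k) cfg.site)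
      (fun st => ¬ GoodReporting env b S O c r t (nextConfig enc cfg a st)) ≤ failureBound E c := by
  have hrep := surely_report enc h ha ha5 ht hout hmult1 hmult hs hbits hrounds htime htimes
  rcases hprod with hV | hprod
  · refine le_of_eq_of_le (prob_eq_zero (hrep.mono ?_)) bot_le
    rintro st ⟨⟨N', hN'⟩, -⟩
    exact not_not.2 ⟨B, N', hN', Or.inl hV⟩
  · refine (prob_mono_of_surely (hrep.mono ?_)).trans
      (prob_report_bad_le h ha ht hout hmult1 hmult hs hw hwW hsum)
    rintro st ⟨⟨N', hN'⟩, hst⟩ hbad hgood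
    refine hbad ⟨B, N', hN', Or.inr ⟨_, hst w hw hwW, ⟨hsum, hprod⟩, ?_⟩⟩
    have : (fun i => sampleOf (S i).length (st i)) = N' :=
      funext fun i => (hN'.sites i).sampleOf_eq
    rwa [this] at hgood

theorem start_round (h : Admissible env c k r S) :
    Surely (roundStep env (clarkson c) enc (startConfig
        [Fintype.card E, k, r, env.prob.combDim, env.prob.vcDim] S))
      (fun cfg => ∃ B N, Reporting env (b := b) S c r 0 B N cfg) ∧
    prob (roundStep env (clarkson c) enc (startConfig
        [Fintype.card E, k, r, env.prob.combDim, env.prob.vcDim] S))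
      (fun cfg => ¬ GoodReporting env b S O c r 0 cfg) ≤ failureBound E c := by
  set cfg : Config E k :=
    startConfig [Fintype.card E, k, r, env.prob.combDim, env.prob.vcDim] S with hcfg
  have hW := h.word_card
  have hA := surely_coord_init env (c := 2 * c + 2) (k := k) (r := r) (by omega) h.one_le_vcDim
    h.one_le_dim h.one_le_card h.word_scale (by omega) h.word_iter h.word_k
  have hready : ∀ a, CoordState k env.prob.combDim (multiplier (Fintype.card E) r) (env.scale c r)
      (Fintype.card E) (env.prob.combDim * r) [] a →
      CoordReady env c k r 0 (env.prob.combDim * r - 0) [] a := fun a ha =>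
    ⟨ha, ⟨∅, Finset.Subset.refl _, rfl, fun B' hB' => absurd hB' (by simp)⟩, List.nodup_nil⟩
  have hsites : ∀ i, SiteState (S i) [] (cfg.site i) := fun i =>
    ⟨by simp [hcfg, startConfig, startState], by simp [hcfg, startConfig, startState],
      by simp [hcfg, startConfig, startState], fun j _ => by simp [hcfg, startConfig, startState],
      fun j hj => absurd hj (by simp), by simp⟩
  have htime : ∀ a : PState E, a.time ≤ 6 * k + 2 * Nat.size (Fintype.card E) + 30 →
      a.time ≤ (0 + 1 + 0) * env.coordUnit c k r := by
    intro a ha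
    have : k ≤ k * env.prob.combDim := Nat.le_mul_of_pos_right _ h.one_le_dim
    rw [Env.coordUnit, mul_assoc 13]
    omega
  have hm := Admissible.one_le_multiplier (Fintype.card E) r
  constructor
  · refine surely_roundStep env _ enc (by simp [hcfg, startConfig, startState]) hA
      (fun a ha ho => absurd ho (by simp [ha.1.out])) fun a ha _ => ?_
    refine (surely_report enc h (hready a ha.1) ha.2.1 (Nat.zero_le _) ha.2.2.1 le_rfl hm hsites
      (by simp [hcfg, startConfig]) (by simp [hcfg, startConfig]) (htime a ha.2.2.2)
      (by simp [hcfg, startConfig, startState])).mono fun st hst => ⟨_, hst.1⟩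
  · refine prob_roundStep_le env _ enc (by simp [hcfg, startConfig, startState]) hA
      (fun a ha => ha.1.out) fun a ha => ?_
    -- The multiplier 1 makes reweighting by the empty basis harmless: the zero memory cells stand
    -- for weights 1, and these are kept whether or not a constraint violates the empty basis.
    have hre : ∀ X, reweight env.prob [] 1 (fun _ => 1) X = 1 := fun X => by
      rw [reweight]; split_ifs <;> rfl
    refine prob_not_goodReporting_le h (hready a ha.1) ha.2.1 (Nat.zero_le _) ha.2.2.1 le_rfl hm
      hsites (by simp [hcfg, startConfig]) (by simp [hcfg, startConfig]) (htime a ha.2.2.2)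
      (by simp [hcfg, startConfig, startState]) (w := fun _ => 1)
      (fun i j _ => by simp [hcfg, startConfig, startState]) (fun X => by omega) ?_ (Or.inr ?_)
    · simp [hre, Env.bound, totalBound]
    · simp [hre]

/-- A good sample in iteration t keeps the next total within its bound, and a violator of the new
basis raises the product over O; thus the new weights are balanced surely, and the only risk is the
new sample. -/
theorem report_round (h : Admissible env c k r S) (hO : env.prob.IsBasis Finset.univ O) {t : ℕ}
    {B : List E} {N : Fin k → List E} {cfg : Config E k}
    (hcfg : Collecting env (b := b) S c r t B N cfg) :
    Surely (roundStep env (clarkson c) enc cfg)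
      (fun cfg => ∃ B N, Reporting env (b := b) S c r (t + 1) B N cfg) ∧
    ((∃ w, HasWeights S cfg.site w ∧ BalancedWeights env r t O w ∧
        GoodSample env c r t w ((List.finRange k).flatMap N)) →
      prob (roundStep env (clarkson c) enc cfg)
        (fun cfg => ¬ GoodReporting env b S O c r (t + 1) cfg) ≤ failureBound E c) := by
  have hW := h.word_card
  have ht : t + 1 ≤ env.prob.combDim * r := hcfg.lt
  have hflat := flatMap_range_extendFin N
  have hlen : ((List.finRange k).flatMap N).length ≤ env.scale c r * 4 := by
    rw [length_flatMap_finRange]; exact hcfg.sum_le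
  set L := (List.finRange k).flatMap N with hL
  obtain ⟨hnd, hbas⟩ := h.basisOf L
  have hready : ∀ a, CoordState k env.prob.combDim (multiplier (Fintype.card E) r) (env.scale c r)
      (env.bound (t + 1)) (env.prob.combDim * r - t - 1) (env.basisOf L) a →
      CoordReady env c k r (t + 1) (env.prob.combDim * r - (t + 1)) (env.basisOf L) a :=
    fun a ha => ⟨by rwa [← Nat.sub_sub], ⟨_, hbas⟩, hnd⟩
  have hBlen : (env.basisOf L).length ≤ env.prob.combDim := by
    rw [← List.toFinset_card_of_nodup hnd]
    exact hbas.card_le_combDim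
  have hBn := env.prob.combDim_le_card
  have hA := surely_coord_newBasis env (c := 2 * c + 2) (N := extendFin [] N) hcfg.coord.state
    hcfg.reg5 hcfg.outbox (fun i hi => by
      rw [hcfg.inbox ⟨i, hi⟩, ← extendFin_val [] N ⟨i, hi⟩]) (by omega) h.word_k
    (by rw [hflat]; exact hlen.trans_lt h.word_scale) (by rw [hflat]; omega) h.multiplier_lt
    (h.bound_lt ht)
  rw [hflat] at hA
  have htime : ∀ a : PState E, a.time ≤ cfg.coord.time + (10 * k + 3 * L.length + env.Tb L.length +
      3 * k * (env.basisOf L).length + 13) → a.time ≤ (t + 1 + 1 + (t + 1)) * env.coordUnit c k r := by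
    intro a ha
    have e1 : 10 * k + 3 * k * (env.basisOf L).length ≤ 13 * k * env.prob.combDim := by
      have e2 : k ≤ k * env.prob.combDim := Nat.le_mul_of_pos_right _ h.one_le_dim
      have e3 := Nat.mul_le_mul_left (3 * k) hBlen
      nlinarith
    have e2 := h.mono_Tb hlen
    have e3 := hcfg.used.coord
    rw [show t + 1 + 1 + (t + 1) = t + 1 + (t + 1) + 1 by ring, add_one_mul]
    generalize (t + 1 + (t + 1)) * env.coordUnit c k r = u at *
    rw [Env.coordUnit]
    omega
  have hm := Admissible.one_le_multiplier (Fintype.card E) r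
  constructor
  · refine surely_roundStep env _ enc hcfg.coord.state.out hA
      (fun a ha ho => absurd ho (by simp [ha.1.out])) fun a ha _ => ?_
    exact (surely_report enc h (hready a ha.1) ha.2.1 ht ha.2.2.1 hm le_rfl hcfg.sites
      hcfg.used.bits hcfg.used.rounds (htime a ha.2.2.2) hcfg.used.site).mono
        fun st hst => ⟨_, hst.1⟩
  · rintro ⟨w, hw, hbal, hgood⟩
    refine prob_roundStep_le env _ enc hcfg.coord.state.out hA
      (fun a ha => ha.1.out) fun a ha => ?_
    refine prob_not_goodReporting_le h (hready a ha.1) ha.2.1 ht ha.2.2.1 hm le_rfl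
      hcfg.sites hcfg.used.bits hcfg.used.rounds (htime a ha.2.2.2) hcfg.used.site hw
      (fun X => ?_) ?_ ?_
    · have hX : w X ≤ env.bound t :=
        (Finset.single_le_sum (fun _ _ => Nat.zero_le _) (Finset.mem_univ X)).trans hbal.sum_le
      exact (Nat.mul_le_mul_right _ hX).trans_lt (h.weight_lt (by omega))
    · exact sum_reweight_le h.one_le_dim hbal.sum_le hbas hgood.1
    · by_cases hV : ∃ X, env.prob.Violates X (env.basisOf L).toFinset
      · exact Or.inr (le_prod_reweight hm hO hbal.le_prod hV)
      · exact Or.inl (not_exists.1 hV)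

theorem totalBound_pos {n ν : ℕ} (hn : 1 ≤ n) (t : ℕ) : 1 ≤ totalBound n ν t := by
  induction t with
  | zero => exact hn
  | succ t ih => exact ih.trans (Nat.le_add_right _ _)

/-- No random number matters in this round, so both claims are sure. The sum of the reported counts
vanishes exactly if nothing violates B, as every constraint lies at some site. -/
theorem collect_round (h : Admissible env c k r S) (hO : env.prob.IsBasis Finset.univ O) {t : ℕ}
    {B : List E} {N : Fin k → List E} {cfg : Config E k}
    (hcfg : Reporting env (b := b) S c r t B N cfg) :
    Surely (roundStep env (clarkson c) enc cfg)
      (fun cfg' => ((∃ B N, Collecting env (b := b) S c r t B N cfg') ∨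
          Stopped env (b := b) S c r cfg') ∧
        ((∀ X, ¬ env.prob.Violates X B.toFinset) ∨ (∃ w, HasWeights S cfg.site w ∧
            BalancedWeights env r t O w ∧ GoodSample env c r t w ((List.finRange k).flatMap N)) →
          GoodCollecting env b S O c r t cfg' ∨ Stopped env (b := b) S c r cfg' ∧
            Correct env.prob cfg')) := by
  have hW := h.word_card
  obtain ⟨x, hx⟩ := hcfg.inbox
  have hBlen := hcfg.coord.length_le
  have hNle : ∀ i, (N i).length ≤ (S i).length := fun i => (hcfg.sites i).sublist.length_le
  have hBn := env.prob.combDim_le_card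
  have hsumx : ∑ i, x i ≤ Fintype.card E :=
    (Finset.sum_le_sum fun i _ => (hx i).1).trans_eq h.sum_length
  have hsumN : ∑ i, (N i).length ≤ Fintype.card E :=
    (Finset.sum_le_sum fun i _ => hNle i).trans_eq h.sum_length
  have hA := surely_coord_decide env (c := 2 * c + 2) (x := extendFin 0 x)
    (y := extendFin 0 fun i => (N i).length) hcfg.coord.state
    hcfg.reg5 hcfg.outbox (fun i hi => by
      rw [(hx ⟨i, hi⟩).2.2, ← extendFin_val 0 x ⟨i, hi⟩,
        ← extendFin_val 0 (fun i => (N i).length) ⟨i, hi⟩]) (by omega) h.word_k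
    (by have := h.word_iter; omega) (by rw [sum_range_extendFin]; omega)
    (by rw [sum_range_extendFin]; omega)
  rw [sum_range_extendFin, sum_range_extendFin] at hA
  have hle := hcfg.le
  have htime : ∀ a : PState E, a.time ≤ cfg.coord.time + (6 * k + B.length + 11) →
      a.time ≤ (t + 1 + (t + 1)) * env.coordUnit c k r := by
    intro a ha
    have e1 : 6 * k + B.length ≤ 13 * k * env.prob.combDim := by
      have e2 : k ≤ k * env.prob.combDim := Nat.le_mul_of_pos_right _ h.one_le_dim
      have e3 : env.prob.combDim ≤ k * env.prob.combDim := Nat.le_mul_of_pos_left _ h.one_le_k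
      nlinarith
    have e3 := hcfg.used.coord
    rw [show t + 1 + (t + 1) = t + 1 + t + 1 by ring, add_one_mul]
    generalize (t + 1 + t) * env.coordUnit c k r = u at *
    rw [Env.coordUnit]
    omega
  have hzero : (∀ X, ¬ env.prob.Violates X B.toFinset) ↔ ∑ i, x i = 0 := by
    rw [Finset.sum_eq_zero_iff]
    refine ⟨fun hV i _ => (hx i).2.1.2 fun X _ => hV X, fun h0 X => ?_⟩
    obtain ⟨i, hi, -⟩ := h.existsUnique X
    exact (hx i).2.1.1 (h0 i (Finset.mem_univ i)) X hi
  -- With balanced weights and a good sample, a stop means that there are no violators: the sample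
  -- is not too large, and having used up the iterations with violators left contradicts
  -- `false_of_heavy`.
  have hhalt : ∀ w, BalancedWeights env r t O w →
      GoodSample env c r t w ((List.finRange k).flatMap N) → ¬ (0 < ∑ i, x i ∧
        ∑ i, (N i).length ≤ env.scale c r * 4 ∧ 0 < env.prob.combDim * r - t) →
      ∑ i, x i = 0 := by
    intro w hbal hgood hC
    by_contra h0
    have h2 := hgood.2
    rw [length_flatMap_finRange] at h2
    obtain rfl : t = env.prob.combDim * r := by
      by_contra hne
      exact hC ⟨Nat.pos_of_ne_zero h0, h2, by omega⟩
    exact false_of_heavy h.one_le_dim h.one_le_r hO.card_le_combDim hbal.sum_le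
      (totalBound_pos h.one_le_card _) hbal.le_prod
  refine surely_roundStep env _ enc hcfg.coord.state.out hA (fun a ha ho => ?_) fun a ha ho => ?_
  · obtain ⟨ha1, ha2⟩ := ha
    split_ifs at ha2 with hC
    · simp [ha2.1.out] at ho
    · have hst : Stopped env (b := b) S c r { cfg with coord := a } := by
        refine ⟨ho, ?_, ?_, (htime a ha1).trans ?_, fun i => (hcfg.used.site i).trans ?_⟩
        · exact hcfg.used.bits.trans (by gcongr; omega)
        · exact hcfg.used.rounds.trans (by omega)
        · gcongr
        · exact Nat.mul_le_mul_right _ (by omega)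
      have hcorrect : ∑ i, x i = 0 → Correct env.prob { cfg with coord := a } := by
        intro h0
        obtain ⟨A, hBA⟩ := hcfg.coord.basis
        exact ⟨B, ha2, hBA.univ_of_not_violates (hzero.2 h0)⟩
      refine ⟨Or.inr hst, ?_⟩
      rintro (hV | ⟨w, -, hbal, hgood⟩)
      · exact Or.inr ⟨hst, hcorrect (hzero.1 hV)⟩
      · exact Or.inr ⟨hst, hcorrect (hhalt w hbal hgood hC)⟩
  · obtain ⟨ha1, ha2⟩ := ha
    split_ifs at ha2 with hC
    swap
    · simp [ha2] at ho
    obtain ⟨hstate, ha5, hout⟩ := ha2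
    refine (surely_runSites env (p := (clarkson c).siteProg) (Q := fun i s' =>
      SiteState (S i) (N i) s' ∧ s'.mem = (cfg.site i).mem ∧ s'.outbox 0 = (N i).map .con ∧
      s'.time ≤ (cfg.site i).time + (3 * (S i).length + 6)) (List.nodup_finRange k)
      fun i _ => ?_).mono fun st hst => ?_
    · rw [hout i]
      have hs := hcfg.sites i
      have hl := h.length_le i
      exact surely_site_of_nil env (s := delivered (cfg.site i) [])
        ⟨hs.reg5, hs.reg19, hs.reg14, hs.holds, hs.holds_sample, hs.sublist⟩ rfl rfl (by omega)
    · replace hst := fun i => hst.1 i (List.mem_finRange i)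
      have hcol : Collecting env (b := b) S c r t B N (nextConfig enc cfg a st) := by
        refine ⟨⟨?_, hcfg.coord.basis, hcfg.coord.nodup⟩, ha5, fun _ => rfl, by omega,
          fun i => (hst i).1, fun i => ?_, hC.2.1, ?_, ?_, htime a ha1, fun i => ?_⟩
        · exact hstate.congr (fun _ _ _ _ _ _ _ _ _ => rfl) rfl rfl
        · simpa [nextConfig] using (hst i).2.2.1
        · have e1 : ∑ i : Fin k, (msgBits enc (a.outbox i) + msgBits enc ((st i).outbox 0)) =
              2 * k + (∑ i, (N i).length) * (b + 2) := by
            rw [Finset.sum_mul, show 2 * k = ∑ _i : Fin k, 2 by simp [mul_comm],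
              ← Finset.sum_add_distrib]
            refine Finset.sum_congr rfl fun i _ => ?_
            rw [hout i, (hst i).2.2.1, msgBits_nil, msgBits_map_con]
            ring
          have e2 := Nat.mul_le_mul_right (b + 2) hC.2.1
          have e3 := hcfg.used.bits
          simp only [nextConfig]
          rw [e1, add_one_mul t (env.sampleBits c k r b), Env.sampleBits]
          rw [Env.sampleBits] at e3
          omega
        · have := hcfg.used.rounds
          simp only [nextConfig]
          omega
        · have e1 := (hst i).2.2.2
          have e2 := hcfg.used.site i
          rw [show t + 1 + (t + 1) = t + 1 + t + 1 by ring, add_one_mul]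
          simp only [nextConfig]
          generalize (t + 1 + t) * env.siteUnit (S i).length = u at *
          rw [Env.siteUnit]
          omega
      refine ⟨Or.inl ⟨B, N, hcol⟩, ?_⟩
      rintro (hV | ⟨w, hw, hbal, hgood⟩)
      · have := hzero.1 hV
        omega
      · refine Or.inl ⟨B, N, hcol, w, fun i j hj => ?_, hbal, hgood⟩
        rw [← hw i j hj]
        simp only [nextConfig, (hst i).2.1]

theorem Stopped.surely_iterPMF {cfg : Config E k} (hcfg : Stopped env (b := b) S c r cfg) (m : ℕ) :
    iterPMF (roundStep env (clarkson c) enc) m cfg = PMF.pure cfg := by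
  induction m with
  | zero => rfl
  | succ m ih => rw [iterPMF, roundStep_of_isSome enc _ hcfg.out, PMF.pure_bind, ih]

/-- Each of the d remaining iterations takes a collecting and a reporting round; the additional step
is the last decision to stop. -/
theorem surely_stopped (h : Admissible env c k r S) (hO : env.prob.IsBasis Finset.univ O) (d : ℕ)
    {t : ℕ} (ht : env.prob.combDim * r = t + d) {B : List E} {N : Fin k → List E}
    {cfg : Config E k} (hcfg : Reporting env (b := b) S c r t B N cfg) :
    Surely (iterPMF (roundStep env (clarkson c) enc) (2 * d + 1) cfg)
      (Stopped env (b := b) S c r) := by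
  induction d generalizing t B N cfg with
  | zero =>
    rw [mul_zero, zero_add, iterPMF, surely_bind]
    refine (collect_round h hO hcfg).mono fun cfg' h' => ?_
    rcases h'.1 with ⟨B', N', h1⟩ | h1
    · exact absurd h1.lt (by omega)
    · exact (surely_pure _ _).2 h1
  | succ d ih =>
    rw [show 2 * (d + 1) + 1 = 2 * d + 1 + 1 + 1 by ring, iterPMF, surely_bind]
    refine (collect_round h hO hcfg).mono fun cfg' h' => ?_
    rcases h'.1 with ⟨B', N', h1⟩ | h1
    · rw [iterPMF, surely_bind]
      refine (report_round h hO h1).1.mono ?_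
      rintro cfg2 ⟨B2, N2, h2⟩
      exact ih (by omega) h2
    · rw [h1.surely_iterPMF]
      exact (surely_pure _ _).2 h1

/-- One failure probability is charged for each remaining draw. The current sample is already known
to be good or irrelevant, so for d = 0 nothing is charged. -/
theorem prob_not_correct_le (h : Admissible env c k r S) (hO : env.prob.IsBasis Finset.univ O)
    (d : ℕ) {t : ℕ} (ht : env.prob.combDim * r = t + d)
    {cfg : Config E k} (hcfg : GoodReporting env b S O c r t cfg) :
    prob (iterPMF (roundStep env (clarkson c) enc) (2 * d + 1) cfg)
      (fun cfg' => ¬ Correct env.prob cfg') ≤ d * failureBound E c := by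
  have hhalt : ∀ m cfg', Stopped env (b := b) S c r cfg' → Correct env.prob cfg' →
      prob (iterPMF (roundStep env (clarkson c) enc) m cfg')
        (fun cfg' => ¬ Correct env.prob cfg') = 0 := by
    intro m cfg' h1 h2
    rw [h1.surely_iterPMF]
    exact prob_eq_zero ((surely_pure _ _).2 (not_not.2 h2))
  induction d generalizing t cfg with
  | zero =>
    obtain ⟨B, N, hrep, hgood⟩ := hcfg
    rw [mul_zero, zero_add, iterPMF, Nat.cast_zero, zero_mul, prob, mean_bind]
    refine mean_le_of_surely ((collect_round h hO hrep).mono fun cfg' h' => ?_)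
    rcases h'.2 hgood with ⟨B', N', h1, -⟩ | ⟨h1, h2⟩
    · exact absurd h1.lt (by omega)
    · exact (hhalt 0 cfg' h1 h2).le
  | succ d ih =>
    obtain ⟨B, N, hrep, hgood⟩ := hcfg
    rw [show 2 * (d + 1) + 1 = 2 * d + 1 + 1 + 1 by ring, iterPMF, prob, mean_bind]
    refine mean_le_of_surely ((collect_round h hO hrep).mono fun cfg' h' => ?_)
    rcases h'.2 hgood with ⟨B', N', h1, hw⟩ | ⟨h1, h2⟩
    · rw [iterPMF]
      refine (prob_bind_le ((report_round h hO h1).2 hw) fun cfg2 h2 => ih (by omega) h2).trans ?_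
      rw [Nat.cast_succ, add_one_mul, add_comm]
    · exact (hhalt _ cfg' h1 h2).le.trans bot_le

end Iterations

/-! ### Estimates -/

theorem three_le_of_one_le_log {n : ℕ} (h : 1 ≤ Real.log n) : 3 ≤ n := by
  by_contra! hn
  have h2 : (n : ℝ) ≤ 2 := by exact_mod_cast (by omega : n ≤ 2)
  rcases Nat.eq_zero_or_pos n with rfl | h0
  · simp at h
    linarith
  · have := Real.log_le_log (by exact_mod_cast h0) h2
    have := Real.log_two_lt_d9
    linarith

/-- The number of digits is at most 1 + log₂ n, where log₂ n ≤ 2·ln n because ln 2 > 1/2, and 1 ≤ ln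
n. -/
theorem size_le_three_mul_log {n : ℕ} (h : 1 ≤ Real.log n) : (Nat.size n : ℝ) ≤ 3 * Real.log n := by
  have hn := three_le_of_one_le_log h
  obtain ⟨m, hm⟩ : ∃ m, Nat.size n = m + 1 := Nat.exists_eq_add_one.2 (Nat.size_pos.2 (by omega))
  have h1 : 2 ^ m ≤ n := Nat.lt_size.1 (by omega)
  have h2 := Real.log_le_log (by positivity) (by exact_mod_cast h1 : (2 : ℝ) ^ m ≤ n)
  rw [Real.log_pow] at h2
  have h3 := Real.log_two_gt_d9
  have h4 : (m : ℝ) * 0.5 ≤ m * Real.log 2 := by gcongr; linarith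
  rw [hm]
  push_cast
  linarith

theorem le_size_of_le_log {n r : ℕ} (hn : 1 ≤ n) (h : (r : ℝ) ≤ Real.log n) : r ≤ Nat.size n := by
  have h1 : (n : ℝ) ≤ 2 ^ Nat.size n := by exact_mod_cast (Nat.lt_size_self n).le
  have h2 := Real.log_le_log (by exact_mod_cast hn) h1
  rw [Real.log_pow] at h2
  have h3 : (Nat.size n : ℝ) * Real.log 2 ≤ Nat.size n * 1 := by
    gcongr
    linarith [Real.log_two_lt_d9]
  exact_mod_cast (by linarith : (r : ℝ) ≤ Nat.size n)

theorem two_pow_size_le {n : ℕ} (hn : 1 ≤ n) : 2 ^ Nat.size n ≤ 2 * n := by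
  obtain ⟨m, hm⟩ : ∃ m, Nat.size n = m + 1 := Nat.exists_eq_add_one.2 (Nat.size_pos.2 hn)
  have h1 : 2 ^ m ≤ n := Nat.lt_size.1 (by omega)
  rw [hm, pow_succ]
  omega

/-- The r-th power of 2^⌊size n / r⌋ is at most 2n; taking the root leaves a factor of at most 2,
and the 3 in the exponent contributes 8. -/
theorem multiplier_le {n r : ℕ} (hn : 1 ≤ n) (hr : 1 ≤ r) :
    (multiplier n r : ℝ) ≤ 16 * (n : ℝ) ^ (1 / (r : ℝ)) := by
  have hr0 : (0 : ℝ) < r := by exact_mod_cast hr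
  have hn0 : (1 : ℝ) ≤ n := by exact_mod_cast hn
  have h1 : ((2 : ℝ) ^ (Nat.size n / r)) ^ r ≤ 2 * n := by
    rw [← pow_mul]
    refine (pow_le_pow_right₀ one_le_two (Nat.div_mul_le_self _ _)).trans ?_
    exact_mod_cast two_pow_size_le hn
  have h2 : (2 : ℝ) ^ (Nat.size n / r) ≤ 2 * (n : ℝ) ^ (1 / (r : ℝ)) := by
    refine le_of_pow_le_pow_left₀ (n := r) (by omega) (by positivity) (h1.trans ?_)
    rw [mul_pow, one_div, Real.rpow_inv_natCast_pow (by positivity) (by omega)]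
    gcongr
    exact le_self_pow₀ one_le_two (by omega)
  rw [multiplier]
  push_cast
  rw [pow_add]
  linarith

theorem LPTypeProblem.vcDim_le_card {E : Type u} {R : Type v} [DecidableEq E] [LinearOrder R]
    [Fintype E] (P : LPTypeProblem E R) : P.vcDim ≤ Fintype.card E :=
  Finset.sup_le fun T _ => Finset.card_le_univ T

/-! ### Word length, total resources and failure probability -/

section Bounds

variable {E : Type u} {R : Type v} [DecidableEq E] [LinearOrder R] [Fintype E] {env : Env E R}
  {c k r b : ℕ} {S : Fin k → List E}

/-- With s the number of digits of n, the numbers n, ν, λ are below 2^s, the multiplier is at most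
2^{s+3}, and r ≤ s. The scale and the largest weight then need 4s digits and a constant number more.
-/
theorem admissible_of_wordLen (hk : 1 ≤ k) (hr : 1 ≤ r) (hν : 1 ≤ env.prob.combDim)
    (hlog : (r : ℝ) ≤ Real.log (Fintype.card E)) (hnd : ∀ i, (S i).Nodup)
    (hS : ∀ X : E, ∃! i, X ∈ S i)
    (hbas : ∀ A : List E, (env.basisOf A).Nodup ∧
      env.prob.IsBasis A.toFinset (env.basisOf A).toFinset)
    (hTb : Monotone env.Tb)
    (hTv : ∀ t t' s s', t ≤ t' → s ≤ s' → env.Tv t s ≤ env.Tv t' s')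
    (hW : 2 * c + 20 + 4 * Nat.size (Fintype.card E) + Nat.size k ≤ env.wordLen) :
    Admissible env c k r S := by
  have hn : 1 ≤ Fintype.card E := hν.trans env.prob.combDim_le_card
  have hrs := le_size_of_le_log hn hlog
  have hn2 := Nat.lt_size_self (Fintype.card E)
  have hν2 := env.prob.combDim_le_card.trans_lt hn2
  have hlam2 := env.prob.vcDim_le_card.trans_lt hn2
  have hs2 := Nat.lt_two_pow_self (n := Nat.size (Fintype.card E))
  set s := Nat.size (Fintype.card E) with hs
  have hmult : multiplier (Fintype.card E) r ≤ 2 ^ (s + 3) :=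
    Nat.pow_le_pow_right (by norm_num) (Nat.add_le_add_right (Nat.div_le_self _ _) 3)
  refine ⟨hr, hk, hrs, hν, hnd, hS, hbas, hTb, hTv, ?_, ?_, ?_, ?_, ?_⟩
  · calc 3 * Fintype.card E + 3 < 2 ^ (s + 2) := by rw [pow_add]; omega
      _ ≤ _ := Nat.pow_le_pow_right (by norm_num) (by omega)
  · exact (Nat.lt_size_self k).trans_le (Nat.pow_le_pow_right (by norm_num) (by omega))
  · calc env.scale c r * 4
        = (4 * (2 * c + 2)) * env.prob.vcDim * multiplier (Fintype.card E) r * env.prob.combDim *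
          s := by rw [Env.scale, sampleScale, ← hs]; ring
      _ ≤ 2 ^ (2 * c + 4) * 2 ^ s * 2 ^ (s + 3) * 2 ^ s * 2 ^ s := by
          have : 2 * c + 2 < 2 ^ (2 * c + 2) := Nat.lt_two_pow_self
          have h4 : 4 * (2 * c + 2) ≤ 2 ^ (2 * c + 4) := by
            rw [show 2 * c + 4 = 2 * c + 2 + 2 by ring, pow_add]; omega
          gcongr
      _ = 2 ^ (2 * c + 4 + s + (s + 3) + s + s) := by simp only [pow_add]
      _ < _ := Nat.pow_lt_pow_right (by norm_num) (by omega)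
  · calc env.prob.combDim * r ≤ 2 ^ s * 2 ^ s := by gcongr; exact hrs.trans hs2.le
      _ = 2 ^ (s + s) := by rw [pow_add]
      _ < _ := Nat.pow_lt_pow_right (by norm_num) (by omega)
  · calc Fintype.card E * 4 ^ r * multiplier (Fintype.card E) r
        ≤ 2 ^ s * 4 ^ s * 2 ^ (s + 3) := by gcongr; norm_num
      _ = 2 ^ (s + 2 * s + (s + 3)) := by rw [show 4 = 2 ^ 2 by norm_num, ← pow_mul, ← pow_add, ← pow_add]
      _ < _ := Nat.pow_lt_pow_right (by norm_num) (by omega)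

/-- Here 384(c + 1) = 4·(2c + 2)·16·3, with 16 from `multiplier_le` and 3 from
`size_le_three_mul_log`. -/
theorem scale_mul_four_le (hr : 1 ≤ r) (hlog : 1 ≤ Real.log (Fintype.card E)) :
    ((env.scale c r * 4 : ℕ) : ℝ) ≤ 384 * (c + 1) * Real.log (Fintype.card E) *
      (env.prob.vcDim * (Fintype.card E : ℝ) ^ (1 / (r : ℝ)) * env.prob.combDim) := by
  have hn : 1 ≤ Fintype.card E := by have := three_le_of_one_le_log hlog; omega
  have h1 := multiplier_le hn hr
  have h2 := size_le_three_mul_log hlog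
  have h3 : (0 : ℝ) ≤ (Fintype.card E : ℝ) ^ (1 / (r : ℝ)) := by positivity
  calc ((env.scale c r * 4 : ℕ) : ℝ)
      = 4 * (2 * c + 2) * env.prob.vcDim * multiplier (Fintype.card E) r * env.prob.combDim *
        Nat.size (Fintype.card E) := by
        rw [Env.scale, sampleScale]; push_cast; ring
    _ ≤ 4 * (2 * c + 2) * env.prob.vcDim * (16 * (Fintype.card E : ℝ) ^ (1 / (r : ℝ))) *
        env.prob.combDim * (3 * Real.log (Fintype.card E)) := by gcongr
    _ = _ := by ring

theorem Admissible.size_le_scale (h : Admissible env c k r S) :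
    Nat.size (Fintype.card E) ≤ env.scale c r := by
  refine Nat.le_mul_of_pos_left _ ?_
  have h1 := h.one_le_dim
  have h2 := h.one_le_vcDim
  have h3 := Admissible.one_le_multiplier (Fintype.card E) r
  positivity

theorem Admissible.one_le_iter (h : Admissible env c k r S) : 1 ≤ env.prob.combDim * r :=
  Nat.mul_pos h.one_le_dim h.one_le_r

variable {cfg : Config E k}

theorem Stopped.rounds_le (h : Admissible env c k r S) (hcfg : Stopped env (b := b) S c r cfg) :
    cfg.rounds ≤ 4 * (env.prob.combDim * r) := by
  have h1 := h.one_le_iter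
  have h2 := hcfg.used.rounds
  omega

theorem Stopped.coord_time_le (h : Admissible env c k r S) (hTb : ∀ m, m ≤ env.Tb m)
    (hcfg : Stopped env (b := b) S c r cfg) {M : ℕ} (hM : env.scale c r * 4 ≤ M) :
    cfg.coord.time ≤ 200 * (env.prob.combDim * r * (env.Tb M + k * env.prob.combDim)) := by
  have h1 := h.one_le_iter
  have h2 := h.size_le_scale
  have h3 := hTb (env.scale c r * 4)
  have h4 := h.mono_Tb hM
  have h5 : 1 ≤ k * env.prob.combDim := Nat.mul_pos h.one_le_k h.one_le_dim
  have h6 : env.coordUnit c k r ≤ 50 * (env.Tb M + k * env.prob.combDim) := by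
    rw [Env.coordUnit, mul_assoc 13]
    omega
  calc cfg.coord.time ≤ _ := hcfg.used.coord
    _ ≤ (4 * (env.prob.combDim * r)) * (50 * (env.Tb M + k * env.prob.combDim)) :=
        Nat.mul_le_mul (by omega) h6
    _ = _ := by ring

theorem Stopped.site_time_le (h : Admissible env c k r S) (hTv : ∀ t s, t + s ≤ env.Tv t s)
    (hcfg : Stopped env (b := b) S c r cfg) (i : Fin k) :
    (cfg.site i).time ≤ 200 * (env.prob.combDim * r * env.Tv (S i).length env.prob.combDim) := by
  have h1 := h.one_le_iter
  have h2 := h.one_le_dim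
  have h3 := hTv (S i).length env.prob.combDim
  have h6 : env.siteUnit (S i).length ≤ 50 * env.Tv (S i).length env.prob.combDim := by
    rw [Env.siteUnit]
    omega
  calc (cfg.site i).time ≤ _ := hcfg.used.site i
    _ ≤ (4 * (env.prob.combDim * r)) * (50 * env.Tv (S i).length env.prob.combDim) :=
        Nat.mul_le_mul (by omega) h6
    _ = _ := by ring

/-- Distinct codes force n ≤ 2^b, so the numbers in the messages cost O(b) bits each. Of the two
logarithmic factors one comes from r ≤ ln n in the number of iterations and one from the scale of
the samples. -/
theorem Stopped.bits_le (h : Admissible env c k r S) {enc : E → Fin b → Bool}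
    (henc : Function.Injective enc) (hlog : (r : ℝ) ≤ Real.log (Fintype.card E))
    (hcfg : Stopped env (b := b) S c r cfg) :
    (cfg.bits : ℝ) ≤ 2000 * (c + 1) * Real.log (Fintype.card E) ^ 2 *
      ((env.prob.vcDim * (Fintype.card E : ℝ) ^ (1 / (r : ℝ)) * env.prob.combDim ^ 2 +
        k * env.prob.combDim ^ 2) * b) := by
  have hr1 : (1 : ℝ) ≤ r := by exact_mod_cast h.one_le_r
  have hlog1 := hr1.trans hlog
  have hn3 := three_le_of_one_le_log hlog1
  have hcard : Fintype.card E ≤ 2 ^ b := by simpa using Fintype.card_le_of_injective enc henc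
  have hb2 : 2 ≤ b := by
    by_contra! hb
    have : 2 ^ b ≤ 2 ^ 1 := Nat.pow_le_pow_right (by norm_num) (by omega)
    omega
  have hs : Nat.size (Fintype.card E) ≤ 2 * b :=
    (Nat.size_le.2 (hcard.trans_lt (Nat.pow_lt_pow_right (by norm_num) (by omega))) :
      _ ≤ b + 1).trans (by omega)
  have hr := h.r_le
  have hν := h.one_le_dim
  have hi := h.one_le_iter
  have hscale := scale_mul_four_le (env := env) (c := c) h.one_le_r hlog1
  have h1 : env.basisBits k r b ≤ k * (40 * env.prob.combDim * b) := by
    rw [Env.basisBits]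
    refine Nat.mul_le_mul_left _ ?_
    nlinarith [Nat.mul_le_mul hν hb2, Nat.mul_le_mul_right b hν]
  have h2 : env.sampleBits c k r b ≤ k * (env.prob.combDim * b) + env.scale c r * 4 * (2 * b) := by
    rw [Env.sampleBits]
    refine Nat.add_le_add ?_ (Nat.mul_le_mul_left _ (by omega))
    rw [mul_comm 2]
    exact Nat.mul_le_mul_left _ (Nat.mul_le_mul hν hb2)
  have h3 : cfg.bits ≤ 2 * (env.prob.combDim * r) *
      (41 * (k * (env.prob.combDim * b)) + env.scale c r * 4 * (2 * b)) := by
    refine hcfg.used.bits.trans ?_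
    rw [← mul_add]
    refine Nat.mul_le_mul (by omega) ((Nat.add_le_add h1 h2).trans (le_of_eq ?_))
    ring
  have h4 : (cfg.bits : ℝ) ≤ 2 * (env.prob.combDim * r) *
      (41 * (k * (env.prob.combDim * b)) + (env.scale c r * 4 : ℕ) * (2 * b)) := by
    exact_mod_cast h3
  set ℓ := Real.log (Fintype.card E)
  set y := (Fintype.card E : ℝ) ^ (1 / (r : ℝ)) with hy
  have hy0 : 0 ≤ y := by positivity
  have hℓ : ℓ ≤ ℓ ^ 2 := le_self_pow₀ hlog1 (by norm_num)
  have hℓ0 : 0 ≤ ℓ := by linarith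
  set d : ℝ := (env.prob.combDim : ℝ)
  set lam : ℝ := (env.prob.vcDim : ℝ)
  have hd : 0 ≤ d := Nat.cast_nonneg _
  have hlam : 0 ≤ lam := Nat.cast_nonneg _
  calc (cfg.bits : ℝ) ≤ _ := h4
    _ ≤ 2 * (d * ℓ) * (41 * (k * (d * b)) + (384 * (c + 1) * ℓ * (lam * y * d)) * (2 * b)) := by
        gcongr
    _ = 82 * ℓ * (k * d ^ 2 * b) + 1536 * (c + 1) * ℓ ^ 2 * (lam * y * d ^ 2 * b) := by ring
    _ ≤ 2000 * (c + 1) * ℓ ^ 2 * (k * d ^ 2 * b) +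
        2000 * (c + 1) * ℓ ^ 2 * (lam * y * d ^ 2 * b) := by
        have hc : (0 : ℝ) ≤ c := Nat.cast_nonneg _
        gcongr <;> linarith
    _ = _ := by ring

-- As e^{size n} ≥ n, a failure has probability at most 2n^{−(c+3)}, and 2(d + 1) ≤ 2(n² + 1) ≤ n³
-- for n ≥ 3.
omit [DecidableEq E] in
theorem mul_failureBound_le {c : ℕ} (hlog : 1 ≤ Real.log (Fintype.card E)) {d : ℕ}
    (hd : d ≤ Fintype.card E * Fintype.card E) :
    ((d + 1 : ℕ) : ℝ≥0∞) * failureBound E (c + 3) ≤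
      ENNReal.ofReal (1 / (Fintype.card E : ℝ) ^ c) := by
  have hn3 := three_le_of_one_le_log hlog
  rw [failureBound, ← ENNReal.ofReal_natCast, ← ENNReal.ofReal_mul (Nat.cast_nonneg _)]
  refine ENNReal.ofReal_le_ofReal ?_
  set n := Fintype.card E
  have h0 : (0 : ℝ) < n := by exact_mod_cast (by omega : 0 < n)
  have h1 : (n : ℝ) ^ (c + 3) ≤ Real.exp (((c + 3 : ℕ) : ℝ) * Nat.size n) := by
    rw [Real.exp_nat_mul]
    refine pow_le_pow_left₀ h0.le ?_ _
    calc (n : ℝ) ≤ (2 : ℝ) ^ Nat.size n := by exact_mod_cast (Nat.lt_size_self n).le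
      _ ≤ Real.exp 1 ^ Nat.size n :=
          pow_le_pow_left₀ zero_le_two (by linarith [Real.exp_one_gt_d9]) _
      _ = Real.exp (Nat.size n) := by rw [← Real.exp_nat_mul, mul_one]
  have h2 : ((d + 1 : ℕ) : ℝ) * 2 ≤ (n : ℝ) ^ 3 := by
    have : (d + 1) * 2 ≤ n ^ 3 := by nlinarith
    exact_mod_cast this
  rw [Real.exp_neg, le_div_iff₀ (by positivity)]
  calc ((d + 1 : ℕ) : ℝ) * (2 * (Real.exp (((c + 3 : ℕ) : ℝ) * Nat.size n))⁻¹) * (n : ℝ) ^ c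
      ≤ (n : ℝ) ^ 3 * ((n : ℝ) ^ (c + 3))⁻¹ * (n : ℝ) ^ c := by
        rw [← mul_assoc]
        gcongr
    _ = 1 := by rw [pow_add]; field_simp

theorem runProtocol_clarkson (h : Admissible env c k r S) {enc : E → Fin b → Bool} :
    Surely (runProtocol env (clarkson c) enc [Fintype.card E, k, r, env.prob.combDim,
        env.prob.vcDim] S (2 * (env.prob.combDim * r) + 1 + 1)) (Stopped env (b := b) S c r) ∧
    prob (runProtocol env (clarkson c) enc [Fintype.card E, k, r, env.prob.combDim,
        env.prob.vcDim] S (2 * (env.prob.combDim * r) + 1 + 1)) (fun cfg => ¬ Correct env.prob cfg) ≤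
      ((env.prob.combDim * r + 1 : ℕ) : ℝ≥0∞) * failureBound E c := by
  -- The optimal basis O occurs only in the analysis; that one exists is seen by applying the basis
  -- procedure to all constraints.
  obtain ⟨-, hO⟩ := h.basisOf Finset.univ.toList
  rw [Finset.toList_toFinset] at hO
  obtain ⟨h1, h2⟩ := start_round (O := (env.basisOf Finset.univ.toList).toFinset) (enc := enc) h
  rw [runProtocol, iterPMF]
  constructor
  · rw [surely_bind]
    refine h1.mono ?_
    rintro cfg ⟨B, N, hcfg⟩
    exact surely_stopped h hO _ (zero_add _).symm hcfg
  · refine (prob_bind_le (G := GoodReporting env b S _ c r 0) h2 fun cfg hcfg =>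
      prob_not_correct_le h hO (env.prob.combDim * r) (zero_add _).symm hcfg).trans ?_
    rw [Nat.cast_succ, add_one_mul, add_comm]

end Bounds

theorem mainTheorem6 :
    ∃ a : ℕ, ∀ c : ℕ, 1 ≤ c → ∃ (C : ℕ) (π : Protocol),
      ∀ (E : Type u) (R : Type v) [Fintype E] [DecidableEq E] [LinearOrder R]
        (P : LPTypeProblem E R) (n k r ν lam b : ℕ) (enc : E → Fin b → Bool)
        (S : Fin k → List E) (basisOf : List E → List E) (Tb : ℕ → ℕ) (Tv : ℕ → ℕ → ℕ) (W : ℕ),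
        n = Fintype.card E →
        ν = P.combDim → 1 ≤ ν →
        lam = P.vcDim →
        Function.Injective enc →
        2 ≤ k → 1 ≤ r → (r : ℝ) ≤ Real.log n →
        -- the constraints are partitioned among the sites
        (∀ i, (S i).Nodup) → (∀ X : E, ∃! i, X ∈ S i) →
        -- `basisOf` is a procedure that computes bases
        (∀ A : List E, (basisOf A).Nodup ∧ P.IsBasis A.toFinset (basisOf A).toFinset) →
        -- running times are monotone, and at least the time needed to read the input
        Monotone Tb → (∀ m, m ≤ Tb m) →
        (∀ t t' s s', t ≤ t' → s ≤ s' → Tv t s ≤ Tv t' s') → (∀ t s, t + s ≤ Tv t s) →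
        -- the word length suffices for the weights
        C * ν * (Nat.size n + Nat.size k) ≤ W →
        ∃ t : ℕ,
          (∀ cfg ∈ (runProtocol ⟨W, P, basisOf, Tb, Tv⟩ π enc [n, k, r, ν, lam] S t).support,
            cfg.coord.out.isSome ∧
            cfg.rounds ≤ C * (ν * r) ∧
            (cfg.bits : ℝ) ≤
              C * (Real.log n) ^ a *
                ((lam * (n : ℝ) ^ (1 / (r : ℝ)) * ν ^ 2 + k * ν ^ 2) * b) ∧
            cfg.coord.time ≤
              C * (ν * r *
                (Tb ⌊C * (Real.log n) ^ a * (lam * (n : ℝ) ^ (1 / (r : ℝ)) * ν)⌋₊ + k * ν)) ∧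
            ∀ i, (cfg.site i).time ≤ C * (ν * r * Tv (S i).length ν)) ∧
          ENNReal.ofReal (1 - 1 / (n : ℝ) ^ c) ≤
            (runProtocol ⟨W, P, basisOf, Tb, Tv⟩ π enc [n, k, r, ν, lam] S t).toOuterMeasure
              {cfg | ∃ B : List E, cfg.coord.out = some B ∧
                P.IsBasis Finset.univ B.toFinset ∧ P.f B.toFinset = P.f Finset.univ} := by
  -- Running with c + 3 leaves a factor n³ for the union over the iterations, and 2000(c + 4) is the
  -- constant of `Stopped.bits_le` for c + 3, the largest one needed.
  refine ⟨2, fun c _ => ⟨2000 * (c + 4), clarkson (c + 3), ?_⟩⟩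
  intro E R _ _ _ P n k r ν lam b enc S basisOf Tb Tv W hn hν hν1 hlam henc hk hr hlog hnd hS hbas
    hTb hTb' hTv hTv' hW
  subst hn hν hlam
  set env : Env E R := ⟨W, P, basisOf, Tb, Tv⟩ with henv
  have hr1 : (1 : ℝ) ≤ r := by exact_mod_cast hr
  have hlog1 := hr1.trans hlog
  have hcard := three_le_of_one_le_log hlog1
  have h : Admissible env (c + 3) k r S := by
    refine admissible_of_wordLen (by omega) hr hν1 hlog hnd hS hbas hTb hTv ?_
    have hs : 1 ≤ Nat.size (Fintype.card E) := Nat.size_pos.2 (by omega)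
    refine le_trans ?_ hW
    calc _ ≤ (2000 * (c + 4)) * 1 * (Nat.size (Fintype.card E) + Nat.size k) := by nlinarith
      _ ≤ _ := Nat.mul_le_mul_right _ (Nat.mul_le_mul_left _ hν1)
  obtain ⟨hhalt, hprob⟩ := runProtocol_clarkson (enc := enc) h
  refine ⟨2 * (P.combDim * r) + 1 + 1, fun cfg hcfg => ?_, ?_⟩
  · have hc := hhalt cfg hcfg
    refine ⟨hc.out, (hc.rounds_le h).trans (Nat.mul_le_mul_right _ (by omega)), ?_,
      (hc.coord_time_le h hTb' ?_).trans (Nat.mul_le_mul_right _ (by omega)),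
      fun i => (hc.site_time_le h hTv' i).trans (Nat.mul_le_mul_right _ (by omega))⟩
    · refine (hc.bits_le h henc hlog).trans (le_of_eq ?_)
      push_cast
      ring
    · refine Nat.le_floor ((scale_mul_four_le hr hlog1).trans ?_)
      have hlog2 : Real.log (Fintype.card E) ≤ Real.log (Fintype.card E) ^ 2 :=
        le_self_pow₀ hlog1 (by norm_num)
      have hc0 : (0 : ℝ) ≤ c := Nat.cast_nonneg _
      push_cast
      gcongr ?_ * ?_ * ?_
      linarith
  · have hd : P.combDim * r ≤ Fintype.card E * Fintype.card E := by
      refine Nat.mul_le_mul P.combDim_le_card ?_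
      exact_mod_cast hlog.trans (Real.log_le_self (Nat.cast_nonneg _))
    have hbad := hprob.trans (mul_failureBound_le hlog1 hd)
    have hsum := prob_add_prob_not (runProtocol env (clarkson (c + 3)) enc
      [Fintype.card E, k, r, P.combDim, P.vcDim] S (2 * (P.combDim * r) + 1 + 1))
      (fun cfg => Correct P cfg)
    -- Writing 1 as the sum of the probabilities of success and failure reduces the claim to the
    -- bound on failure.
    rw [ENNReal.ofReal_sub _ (by positivity), ENNReal.ofReal_one, tsub_le_iff_right, ← hsum]
    refine add_le_add ?_ hbad
    rw [prob_eq_toOuterMeasure]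
    refine MeasureTheory.measure_mono ?_
    rintro cfg ⟨B, hB, hbasis⟩
    exact ⟨B, hB, hbasis, hbasis.2.1⟩
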